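/- Let $\mathbb{H}$ and $\mathbb{U}$ be real Hilbert spaces. Let $A\colon \mathcal{D}(A)\subset\mathbb{H}\to\mathbb{H}$ be the generator of a $C_0$-semigroup $G(t)$, $t\ge 0$, in $\mathbb{H}$ that admits an exponential dichotomy of finite rank $j\ge 0$: there is a decomposition $\mathbb{H}=\mathbb{H}^s_A\oplus\mathbb{H}^u_A$ into closed $G$-invariant subspaces with $\dim\mathbb{H}^u_A=j$, each $G(t)$ is invertible on $\mathbb{H}^u_A$, and for some $M,\varepsilon>0$ we have $|G(t)v|\le Me^{-\varepsilon t}|v|$ for $v\in\mathbb{H}^s_A$ and $|(G(t)|_{\mathbb{H}^u_A})^{-1}v|\le Me^{-\varepsilon t}|v|$ for $v\in\mathbb{H}^u_A$, for all $t\ge0$. Let $B\in\mathcal{L}(\mathbb{U};\mathbb{H})$, $F_1\in\mathcal{L}(\mathbb{H})$, $F_2\in\mathcal{L}(\mathbb{H};\mathbb{U})$, $F_3\in\mathcal{L}(\mathbb{U})$, where $F_1$ and $F_3$ are self-adjoint and $F_3$ is invertible and positive-definite ($F_3\ge\delta_0 I$ for some $\delta_0>0$). Put $\mathcal{F}(v,\xi)=(F_1v,v)_{\mathbb{H}}+2(F_2v,\xi)_{\mathbb{U}}+(F_3\xi,\xi)_{\mathbb{U}}$,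 let $\mathcal{F}^{\mathbb{C}}$ be its Hermitian extension to the complexifications, $\mathcal{F}^{\mathbb{C}}(v_1+iv_2,\xi_1+i\xi_2)=\mathcal{F}(v_1,\xi_1)+\mathcal{F}(v_2,\xi_2)$, and suppose that the frequency condition holds: for some $\delta>0$, $$\mathcal{F}^{\mathbb{C}}(-(A-i\omega I)^{-1}B\xi,\xi)\ge\delta|\xi|^2_{\mathbb{U}^{\mathbb{C}}}\quad\text{for all }\xi\in\mathbb{U}^{\mathbb{C}},\ \omega\in\mathbb{R}.$$ Consider the Hamiltonian system $$\dot v=(A-BF_3^{-1}F_2)v+BF_3^{-1}B^*\eta,\qquad \dot\eta=(F_1-F_2^*F_3^{-1}F_2)v-(A-BF_3^{-1}F_2)^*\eta .$$ A solution on $[0,\infty)$ is a pair of continuous functions $v,\eta\colon[0,\infty)\to\mathbb{H}$ which is a mild solution, i.e. for all $0\le s\le t$ $$v(t)=G(t-s)v(s)+\int_s^tG(t-\theta)f(\theta)\,d\theta,\qquad \eta(s)=G(t-s)^*\eta(t)-\int_s^tG(\theta-s)^*g(\theta)\,d\theta,$$ with $f=-BF_3^{-1}F_2v+BF_3^{-1}B^*\eta$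 and $g=(F_1-F_2^*F_3^{-1}F_2)v+(BF_3^{-1}F_2)^*\eta$. Let $\mathbb{L}^+_b\subset\mathbb{H}\times\mathbb{H}$ be the subspace of all $(v(0),\eta(0))$ for solutions $(v,\eta)$ bounded on $[0,\infty)$, and let $\mathbb{L}_\eta=\{0\}\times\mathbb{H}$. A subspace $\mathbb{L}\subset\mathbb{H}\times\mathbb{H}$ is called Lagrange if $J\mathbb{L}=\mathbb{L}^\perp$, where $J(v,\eta)=(-\eta,v)$. Then $\mathbb{L}^+_b$ and $\mathbb{L}_\eta$ are Lagrange subspaces and 1. $\dim(\mathbb{L}^+_b\cap\mathbb{L}_\eta)\le j$; 2. $\mathbb{L}^+_b+\mathbb{L}_\eta$ is closed and has finite codimension $\le j$ in $\mathbb{H}\times\mathbb{H}$. In particular, $(\mathbb{L}^+_b,\mathbb{L}_\eta)$ is a Fredholm pair, i.e. a pair of closed subspaces with finite-dimensional intersection and with closed sum of finite codimension. -/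

import Mathlib

open Set Filter Topology MeasureTheory

namespace FredPair

noncomputable section

/-- `G t`, `t ≥ 0`, is a `C₀`-semigroup (the values at negative times are irrelevant). -/
structure IsC0Semigroup {H : Type*} [NormedAddCommGroup H] [InnerProductSpace ℝ H]
    (G : ℝ → H →L[ℝ] H) : Prop where
  map_zero : G 0 = ContinuousLinearMap.id ℝ H
  map_add : ∀ s t : ℝ, 0 ≤ s → 0 ≤ t → G (s + t) = (G s).comp (G t)
  strong_cont : ∀ v : H, ContinuousOn (fun t => G t v) (Ici 0)

/-- The unbounded operator `A` is the infinitesimal generator of `G`: `v ∈ D(A)` and `A v = w`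
if and only if `(G(t) v - v) / t → w` as `t → 0+`. -/
def IsGenerator {H : Type*} [NormedAddCommGroup H] [InnerProductSpace ℝ H]
    (A : H →ₗ.[ℝ] H) (G : ℝ → H →L[ℝ] H) : Prop :=
  ∀ v w : H, (v, w) ∈ A.graph ↔ Tendsto (fun t : ℝ => t⁻¹ • (G t v - v)) (𝓝[>] 0) (𝓝 w)

/-- Exponential dichotomy of finite rank `j`: `H = Hs ⊕ Hu` with closed `G`-invariant subspaces,
`dim Hu = j`, exponential decay of `G(t)` on `Hs`, and `G(t)` invertible on `Hu` with
exponentially decaying inverse (the last estimate is `‖G(t)⁻¹ w‖ ≤ M e^{-εt} ‖w‖` with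
`w = G(t) v`). -/
def HasExpDichotomy {H : Type*} [NormedAddCommGroup H] [InnerProductSpace ℝ H]
    (G : ℝ → H →L[ℝ] H) (j : ℕ) : Prop :=
  ∃ Hs Hu : Submodule ℝ H,
    IsClosed (Hs : Set H) ∧ IsClosed (Hu : Set H) ∧ IsCompl Hs Hu ∧
    FiniteDimensional ℝ Hu ∧ Module.finrank ℝ Hu = j ∧
    (∀ t : ℝ, 0 ≤ t → MapsTo (G t) Hs Hs) ∧
    (∀ t : ℝ, 0 ≤ t → BijOn (G t) Hu Hu) ∧
    ∃ M ε : ℝ, 0 < M ∧ 0 < ε ∧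
      (∀ t : ℝ, 0 ≤ t → ∀ v ∈ Hs, ‖G t v‖ ≤ M * Real.exp (-ε * t) * ‖v‖) ∧
      (∀ t : ℝ, 0 ≤ t → ∀ v ∈ Hu, ‖v‖ ≤ M * Real.exp (-ε * t) * ‖G t v‖)

/-- The underlying real Hilbert space of the complexification of `E`; the pair `(x, y)` stands
for `x + i y`, and `‖x + i y‖² = ‖x‖² + ‖y‖²`. -/
abbrev Cx (E : Type*) := WithLp 2 (E × E)

/-- Multiplication by the complex scalar `a` in the complexification. -/
def cxSmul {E : Type*} [NormedAddCommGroup E] [InnerProductSpace ℝ E] (a : ℂ) (x : Cx E) : Cx E :=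
  WithLp.toLp 2 (a.re • x.fst - a.im • x.snd, a.im • x.fst + a.re • x.snd)

/-- Complexification of a bounded operator. -/
def cxMap {E F : Type*} [NormedAddCommGroup E] [InnerProductSpace ℝ E]
    [NormedAddCommGroup F] [InnerProductSpace ℝ F] (B : E →L[ℝ] F) (x : Cx E) : Cx F :=
  WithLp.toLp 2 (B x.fst, B x.snd)

/-- `x ∈ D(A^ℂ)` and `A^ℂ x = y` for the complexification `A^ℂ` of an unbounded operator `A`. -/
def CxGraph {H : Type*} [NormedAddCommGroup H] [InnerProductSpace ℝ H]
    (A : H →ₗ.[ℝ] H) (x y : Cx H) : Prop :=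
  (x.fst, y.fst) ∈ A.graph ∧ (x.snd, y.snd) ∈ A.graph

section Hamiltonian

variable {H U : Type*} [NormedAddCommGroup H] [InnerProductSpace ℝ H] [CompleteSpace H]
  [NormedAddCommGroup U] [InnerProductSpace ℝ U] [CompleteSpace U]

/-- The quadratic form `𝓕(v, ξ) = (F₁ v, v) + 2 (F₂ v, ξ) + (F₃ ξ, ξ)`. -/
def quadForm (F₁ : H →L[ℝ] H) (F₂ : H →L[ℝ] U) (F₃ : U →L[ℝ] U) (v : H) (ξ : U) : ℝ :=
  inner ℝ (F₁ v) v + 2 * inner ℝ (F₂ v) ξ + inner ℝ (F₃ ξ) ξ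

/-- The Hermitian extension of `𝓕` to the complexifications. -/
def quadFormC (F₁ : H →L[ℝ] H) (F₂ : H →L[ℝ] U) (F₃ : U →L[ℝ] U) (v : Cx H) (ξ : Cx U) : ℝ :=
  quadForm F₁ F₂ F₃ v.fst ξ.fst + quadForm F₁ F₂ F₃ v.snd ξ.snd

/-- Frequency condition: for some `δ > 0`, `𝓕^ℂ(-(A - iωI)⁻¹ B ξ, ξ) ≥ δ |ξ|²` for all
`ξ ∈ U^ℂ` and `ω ∈ ℝ`. Here `w = (A - iωI)⁻¹ B ξ` is expressed by `A w = iω w + B ξ`; under an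
exponential dichotomy there is exactly one such `w` for every `ξ` and `ω`. -/
def FrequencyCondition (A : H →ₗ.[ℝ] H) (B : U →L[ℝ] H)
    (F₁ : H →L[ℝ] H) (F₂ : H →L[ℝ] U) (F₃ : U →L[ℝ] U) : Prop :=
  ∃ δ : ℝ, 0 < δ ∧ ∀ (ω : ℝ) (ξ : Cx U) (w : Cx H),
    CxGraph A w (cxSmul (Complex.I * (ω : ℂ)) w + cxMap B ξ) →
      δ * ‖ξ‖ ^ 2 ≤ quadFormC F₁ F₂ F₃ (-w) ξ

/-- First row of the bounded part of the Hamiltonian: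
`- B F₃⁻¹ F₂ v + B F₃⁻¹ B* η`. -/
def hamV (B : U →L[ℝ] H) (F₂ : H →L[ℝ] U) (F₃ : U →L[ℝ] U) (v η : H) : H :=
  -(B (Ring.inverse F₃ (F₂ v))) + B (Ring.inverse F₃ (B.adjoint η))

/-- Second row of the bounded part of the Hamiltonian:
`(F₁ - F₂* F₃⁻¹ F₂) v + (B F₃⁻¹ F₂)* η`. -/
def hamEta (B : U →L[ℝ] H) (F₁ : H →L[ℝ] H) (F₂ : H →L[ℝ] U) (F₃ : U →L[ℝ] U) (v η : H) : H :=
  (F₁ v - F₂.adjoint (Ring.inverse F₃ (F₂ v))) +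
    ((B.comp ((Ring.inverse F₃).comp F₂)).adjoint) η

/-- `(v, η)` is a (mild) solution on `[0, ∞)` of the Hamiltonian system
`v' = A v + hamV(v, η)`, `η' = -A* η + hamEta(v, η)`, where `A` generates `G`. As `A*` generates
the adjoint semigroup, the Cauchy formula of the second equation runs backwards in time. The
integrability conditions only say that the Cauchy formulas make sense. -/
structure IsMildSolution (G : ℝ → H →L[ℝ] H) (B : U →L[ℝ] H)
    (F₁ : H →L[ℝ] H) (F₂ : H →L[ℝ] U) (F₃ : U →L[ℝ] U) (v η : ℝ → H) : Prop where
  cont_v : ContinuousOn v (Ici 0)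
  cont_eta : ContinuousOn η (Ici 0)
  int_v : ∀ s t : ℝ, 0 ≤ s → s ≤ t →
    IntervalIntegrable (fun θ => G (t - θ) (hamV B F₂ F₃ (v θ) (η θ))) volume s t
  int_eta : ∀ s t : ℝ, 0 ≤ s → s ≤ t →
    IntervalIntegrable
      (fun θ => (G (θ - s)).adjoint (hamEta B F₁ F₂ F₃ (v θ) (η θ))) volume s t
  eq_v : ∀ s t : ℝ, 0 ≤ s → s ≤ t →
    v t = G (t - s) (v s) + ∫ θ in s..t, G (t - θ) (hamV B F₂ F₃ (v θ) (η θ))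
  eq_eta : ∀ s t : ℝ, 0 ≤ s → s ≤ t →
    η s = (G (t - s)).adjoint (η t) -
      ∫ θ in s..t, (G (θ - s)).adjoint (hamEta B F₁ F₂ F₃ (v θ) (η θ))

theorem hamV_add (B : U →L[ℝ] H) (F₂ : H →L[ℝ] U) (F₃ : U →L[ℝ] U) (v v' η η' : H) :
    hamV B F₂ F₃ (v + v') (η + η') = hamV B F₂ F₃ v η + hamV B F₂ F₃ v' η' := by
  simp only [hamV, map_add]; abel

theorem hamV_smul (B : U →L[ℝ] H) (F₂ : H →L[ℝ] U) (F₃ : U →L[ℝ] U) (c : ℝ) (v η : H) :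
    hamV B F₂ F₃ (c • v) (c • η) = c • hamV B F₂ F₃ v η := by
  simp only [hamV, map_smul, smul_add, smul_neg]

theorem hamEta_add (B : U →L[ℝ] H) (F₁ : H →L[ℝ] H) (F₂ : H →L[ℝ] U) (F₃ : U →L[ℝ] U)
    (v v' η η' : H) :
    hamEta B F₁ F₂ F₃ (v + v') (η + η') = hamEta B F₁ F₂ F₃ v η + hamEta B F₁ F₂ F₃ v' η' := by
  simp only [hamEta, map_add]; abel

theorem hamEta_smul (B : U →L[ℝ] H) (F₁ : H →L[ℝ] H) (F₂ : H →L[ℝ] U) (F₃ : U →L[ℝ] U)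
    (c : ℝ) (v η : H) :
    hamEta B F₁ F₂ F₃ (c • v) (c • η) = c • hamEta B F₁ F₂ F₃ v η := by
  simp only [hamEta, map_smul, smul_add, smul_sub]

theorem IsMildSolution.add {G : ℝ → H →L[ℝ] H} {B : U →L[ℝ] H}
    {F₁ : H →L[ℝ] H} {F₂ : H →L[ℝ] U} {F₃ : U →L[ℝ] U} {v η v' η' : ℝ → H}
    (h : IsMildSolution G B F₁ F₂ F₃ v η) (h' : IsMildSolution G B F₁ F₂ F₃ v' η') :
    IsMildSolution G B F₁ F₂ F₃ (fun t => v t + v' t) (fun t => η t + η' t) where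
  cont_v := h.cont_v.add h'.cont_v
  cont_eta := h.cont_eta.add h'.cont_eta
  int_v s t hs hst := by
    simp only [hamV_add, map_add]
    exact (h.int_v s t hs hst).add (h'.int_v s t hs hst)
  int_eta s t hs hst := by
    simp only [hamEta_add, map_add]
    exact (h.int_eta s t hs hst).add (h'.int_eta s t hs hst)
  eq_v s t hs hst := by
    simp only [hamV_add, map_add]
    rw [intervalIntegral.integral_add (h.int_v s t hs hst) (h'.int_v s t hs hst)]
    nth_rewrite 1 [h.eq_v s t hs hst, h'.eq_v s t hs hst]
    abel
  eq_eta s t hs hst := by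
    simp only [hamEta_add, map_add]
    rw [intervalIntegral.integral_add (h.int_eta s t hs hst) (h'.int_eta s t hs hst)]
    nth_rewrite 1 [h.eq_eta s t hs hst, h'.eq_eta s t hs hst]
    abel

theorem IsMildSolution.smul {G : ℝ → H →L[ℝ] H} {B : U →L[ℝ] H}
    {F₁ : H →L[ℝ] H} {F₂ : H →L[ℝ] U} {F₃ : U →L[ℝ] U} {v η : ℝ → H}
    (h : IsMildSolution G B F₁ F₂ F₃ v η) (c : ℝ) :
    IsMildSolution G B F₁ F₂ F₃ (fun t => c • v t) (fun t => c • η t) where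
  cont_v := h.cont_v.const_smul c
  cont_eta := h.cont_eta.const_smul c
  int_v s t hs hst := by
    simp only [hamV_smul, map_smul]
    exact (h.int_v s t hs hst).smul c
  int_eta s t hs hst := by
    simp only [hamEta_smul, map_smul]
    exact (h.int_eta s t hs hst).smul c
  eq_v s t hs hst := by
    simp only [hamV_smul, map_smul, intervalIntegral.integral_smul]
    nth_rewrite 1 [h.eq_v s t hs hst]
    rw [smul_add]
  eq_eta s t hs hst := by
    simp only [hamEta_smul, map_smul, intervalIntegral.integral_smul]
    nth_rewrite 1 [h.eq_eta s t hs hst]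
    rw [smul_sub]

theorem isMildSolution_zero (G : ℝ → H →L[ℝ] H) (B : U →L[ℝ] H)
    (F₁ : H →L[ℝ] H) (F₂ : H →L[ℝ] U) (F₃ : U →L[ℝ] U) :
    IsMildSolution G B F₁ F₂ F₃ (fun _ => 0) (fun _ => 0) := by
  constructor <;> simp [hamV, hamEta, continuousOn_const]

/-- `L_b⁺`: all initial data in `H × H` of bounded solutions on `[0, ∞)`. -/
def stableSubspace (G : ℝ → H →L[ℝ] H) (B : U →L[ℝ] H)
    (F₁ : H →L[ℝ] H) (F₂ : H →L[ℝ] U) (F₃ : U →L[ℝ] U) : Submodule ℝ (WithLp 2 (H × H)) where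
  carrier := {z | ∃ v η : ℝ → H, IsMildSolution G B F₁ F₂ F₃ v η ∧
    v 0 = z.fst ∧ η 0 = z.snd ∧ ∃ C : ℝ, ∀ t : ℝ, 0 ≤ t → ‖v t‖ ≤ C ∧ ‖η t‖ ≤ C}
  add_mem' := by
    rintro z z' ⟨v, η, h, h1, h2, C, hC⟩ ⟨v', η', h', h1', h2', C', hC'⟩
    refine ⟨_, _, h.add h', by simp [h1, h1'], by simp [h2, h2'], C + C', fun t ht => ?_⟩
    exact ⟨(norm_add_le _ _).trans (add_le_add (hC t ht).1 (hC' t ht).1),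
      (norm_add_le _ _).trans (add_le_add (hC t ht).2 (hC' t ht).2)⟩
  zero_mem' := ⟨_, _, isMildSolution_zero G B F₁ F₂ F₃, by simp, by simp, 0, by simp⟩
  smul_mem' := by
    rintro c z ⟨v, η, h, h1, h2, C, hC⟩
    refine ⟨_, _, h.smul c, by simp [h1], by simp [h2], ‖c‖ * C, fun t ht => ?_⟩
    constructor
    · rw [norm_smul]; exact mul_le_mul_of_nonneg_left (hC t ht).1 (norm_nonneg c)
    · rw [norm_smul]; exact mul_le_mul_of_nonneg_left (hC t ht).2 (norm_nonneg c)

end Hamiltonian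

/-- The vertical subspace `L_η = {0} × H`. -/
def verticalSubspace (H : Type*) [NormedAddCommGroup H] [InnerProductSpace ℝ H] :
    Submodule ℝ (WithLp 2 (H × H)) where
  carrier := {z | z.fst = 0}
  add_mem' := by
    intro a b ha hb
    simp only [mem_ofPred_eq] at ha hb ⊢
    simp [ha, hb]
  zero_mem' := by simp
  smul_mem' := by
    intro c a ha
    simp only [mem_ofPred_eq] at ha ⊢
    simp [ha]

/-- The complex structure `J(v, η) = (-η, v)` on `H × H`. -/
def complexStructure (H : Type*) [NormedAddCommGroup H] [InnerProductSpace ℝ H] :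
    WithLp 2 (H × H) →ₗ[ℝ] WithLp 2 (H × H) where
  toFun z := WithLp.toLp 2 (-z.snd, z.fst)
  map_add' a b := by
    apply WithLp.ofLp_injective
    ext <;> simp [add_comm]
  map_smul' c a := by
    apply WithLp.ofLp_injective
    ext <;> simp

/-- Lagrange subspaces: `J L = L^⊥`. -/
def IsLagrange {H : Type*} [NormedAddCommGroup H] [InnerProductSpace ℝ H]
    (L : Submodule ℝ (WithLp 2 (H × H))) : Prop :=
  L.map (complexStructure H) = Lᗮ

/-- Fredholm pairs of closed subspaces: finite-dimensional intersection and closed sum of finite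
codimension. -/
structure IsFredholmPair {E : Type*} [NormedAddCommGroup E] [InnerProductSpace ℝ E]
    (L M : Submodule ℝ E) : Prop where
  closed_left : IsClosed (L : Set E)
  closed_right : IsClosed (M : Set E)
  finite_inter : FiniteDimensional ℝ ↥(L ⊓ M)
  closed_sum : IsClosed ((L ⊔ M : Submodule ℝ E) : Set E)
  finite_codim : FiniteDimensional ℝ (E ⧸ (L ⊔ M))

end

end FredPair

/-! Let E(t) be the group on the unstable subspace, extended by zero to the stable one, and let Γ(t)
be G(t) - E(t) for t ≥ 0 and -E(t) for t < 0. Since Γ decays exponentially, Γ * f is, for every f in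
L²(ℝ; H), a mild solution of v' = Av + f on the whole line that lies in L² and tends to zero at both
ends. Read through the Fourier transform, the frequency condition says that ∫ 𝓕(v, ξ) ≥ δ ∫ |ξ|²
whenever v = Γ * Bξ (`coercive_L2`). By Lax–Milgram the optimality system of this coercive
functional is solvable for any square-integrable terms added to the state and the costate, with
controls on the whole line or only on the half-line (`exists_control`). Eliminating the control ξ =
F₃⁻¹(B*η - F₂v) turns that system into the Hamiltonian one.

Two choices of the added terms suffice. On the line, Γ(t)p and -Γ(-t)*q jump by p and q at time
zero, so every (p, q) is the difference of the value at zero of a solution decaying at +∞ and that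
of a solution decaying at -∞ (`exists_jump_solution`). The symplectic form is constant along pairs
of solutions (`SolvesOn.symplectic_const`), so it vanishes on the data of each family, and also
between bounded and decaying solutions on the half-line. Isotropic pieces that together span the
space force the Lagrange property (`isLagrange_of_splitting`).

On the half-line, Γ(t)p and 0 give a decaying solution whose v(0) differs from p by an unstable
vector (`exists_halfline_solution`). Hence the unstable subspace, placed in the first component,
maps onto the quotient by the sum of the two subspaces, which bounds the codimension by j. As J
sends the intersection of two Lagrange subspaces into the orthogonal complement of their sum, the
intersection has dimension at most j as well. A finite-codimensional sum of closed subspaces of a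
Banach space is closed. -/

namespace FredPair

/-! ### Semigroups and their adjoints -/

section Semigroup

variable {H : Type*} [NormedAddCommGroup H] [InnerProductSpace ℝ H] [CompleteSpace H]
  {G : ℝ → H →L[ℝ] H}

theorem IsC0Semigroup.exists_bound (hG : IsC0Semigroup G) (T : ℝ) :
    ∃ M : ℝ, 0 < M ∧ ∀ t, 0 ≤ t → t ≤ T → ‖G t‖ ≤ M := by
  have := banach_steinhaus (g := fun t : Icc (0 : ℝ) T => G t) (fun x => by
    obtain ⟨C, hC⟩ := (isCompact_Icc (a := (0 : ℝ)) (b := T)).exists_bound_of_continuousOn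
      ((hG.strong_cont x).mono Icc_subset_Ici_self)
    exact ⟨C, fun t => hC t t.2⟩)
  obtain ⟨M, hM⟩ := this
  exact ⟨max M 1, by positivity, fun t h0 h1 => (hM ⟨t, h0, h1⟩).trans (le_max_left _ _)⟩

/-- Strong continuity becomes joint continuity because the norms are locally bounded. Time is
clamped by `max` since values at negative times are arbitrary. -/
theorem IsC0Semigroup.continuous_uncurry (hG : IsC0Semigroup G) :
    Continuous fun p : ℝ × H => G (max p.1 0) p.2 := by
  rw [continuous_iff_continuousAt]
  rintro ⟨t, x⟩
  obtain ⟨M, hM, hb⟩ := hG.exists_bound (max (t + 1) 0)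
  have h1 : Continuous fun s : ℝ => G (max s 0) x :=
    (hG.strong_cont x).comp_continuous (by fun_prop) (fun s => mem_Ici.2 (le_max_right _ _))
  have h2 : Tendsto (fun p : ℝ × H => G (max p.1 0) x) (𝓝 (t, x)) (𝓝 (G (max t 0) x)) :=
    (h1.comp continuous_fst).tendsto (t, x)
  have h3 : Tendsto (fun p : ℝ × H => G (max p.1 0) (p.2 - x)) (𝓝 (t, x)) (𝓝 0) := by
    have h4 : Tendsto (fun p : ℝ × H => M * ‖p.2 - x‖) (𝓝 (t, x)) (𝓝 0) := by
      have : Continuous fun p : ℝ × H => M * ‖p.2 - x‖ := by fun_prop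
      simpa using this.tendsto (t, x)
    refine squeeze_zero_norm' ?_ h4
    have : ∀ᶠ p : ℝ × H in 𝓝 (t, x), p.1 < t + 1 :=
      continuous_fst.continuousAt.eventually_lt continuousAt_const (by simp)
    filter_upwards [this] with p hp
    refine (ContinuousLinearMap.le_opNorm _ _).trans ?_
    gcongr
    exact hb _ (le_max_right _ _) (max_le_max hp.le le_rfl)
  have := h3.add h2
  simpa [ContinuousAt] using this

/-- Time averages of the semigroup are almost invariant under small time shifts. -/
theorem IsC0Semigroup.norm_integral_shift_le (hG : IsC0Semigroup G) {M r h : ℝ}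
    (hh : 0 ≤ h) (hr : 0 ≤ r) (hM : ∀ t, 0 ≤ t → t ≤ r + h → ‖G t‖ ≤ M) (y : H) :
    ‖(∫ s in 0..r, G s (G h y)) - ∫ s in 0..r, G s y‖ ≤ 2 * h * M * ‖y‖ := by
  have hc : Continuous fun s : ℝ => G (max s 0) y :=
    hG.continuous_uncurry.comp (continuous_id.prodMk continuous_const)
  have hi : ∀ a b : ℝ, IntervalIntegrable (fun s : ℝ => G (max s 0) y) volume a b :=
    fun a b => hc.intervalIntegrable a b
  have e1 : ∫ s in 0..r, G s (G h y) = ∫ s in h..(r + h), G (max s 0) y := by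
    have := intervalIntegral.integral_comp_add_right (a := 0) (b := r)
      (fun s => G (max s 0) y) h
    rw [zero_add] at this
    rw [← this]
    refine intervalIntegral.integral_congr fun s hs => ?_
    rw [uIcc_of_le hr] at hs
    rw [max_eq_left (by linarith [hs.1]), hG.map_add s h hs.1 hh]
    rfl
  have e2 : ∫ s in 0..r, G s y = ∫ s in 0..r, G (max s 0) y := by
    refine intervalIntegral.integral_congr fun s hs => ?_
    rw [uIcc_of_le hr] at hs
    rw [max_eq_left hs.1]
  -- The windows `[h, r + h]` and `[0, r]` differ by two end pieces of length `h`, each contributing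
  -- at most `h * M * ‖y‖`.
  rw [e1, e2, intervalIntegral.integral_interval_sub_interval_comm (hi _ _) (hi _ _) (hi _ _)]
  have b1 : ‖∫ s in h..0, G (max s 0) y‖ ≤ M * ‖y‖ * |0 - h| := by
    refine intervalIntegral.norm_integral_le_of_norm_le_const fun s hs => ?_
    rw [uIoc_of_ge hh] at hs
    rw [max_eq_left hs.1.le]
    exact ((G s).le_opNorm y).trans
      (mul_le_mul_of_nonneg_right (hM s hs.1.le (by linarith [hs.2])) (norm_nonneg _))
  have b2 : ‖∫ s in (r + h)..r, G (max s 0) y‖ ≤ M * ‖y‖ * |r - (r + h)| := by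
    refine intervalIntegral.norm_integral_le_of_norm_le_const fun s hs => ?_
    rw [uIoc_of_ge (by linarith)] at hs
    rw [max_eq_left (by linarith [hs.1])]
    exact ((G s).le_opNorm y).trans
      (mul_le_mul_of_nonneg_right (hM s (by linarith [hs.1]) hs.2) (norm_nonneg _))
  rw [show |0 - h| = h by simp [abs_of_nonneg hh]] at b1
  rw [show |r - (r + h)| = h by simp [abs_of_nonneg hh]] at b2
  refine (norm_sub_le _ _).trans ?_
  linarith

/-- The adjoint of a `C₀`-semigroup in a Hilbert space is a `C₀`-semigroup. -/
theorem IsC0Semigroup.adjoint (hG : IsC0Semigroup G) :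
    IsC0Semigroup fun t => (G t).adjoint := by
  have hadd : ∀ s t : ℝ, 0 ≤ s → 0 ≤ t →
      (G (s + t)).adjoint = (G s).adjoint.comp (G t).adjoint := fun s t hs ht => by
    rw [add_comm, hG.map_add t s ht hs, ContinuousLinearMap.adjoint_comp]
  obtain ⟨M, hM0, hM⟩ := hG.exists_bound 2
  have hnorm : ∀ t, ‖(G t).adjoint‖ = ‖G t‖ := fun t => LinearIsometryEquiv.norm_map _ _
  have hc : ∀ y : H, Continuous fun s : ℝ => G (max s 0) y := fun y =>
    hG.continuous_uncurry.comp (continuous_id.prodMk continuous_const)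
  have hiG : ∀ (y : H) (r : ℝ), 0 ≤ r → IntervalIntegrable (fun s => G s y) volume 0 r :=
    fun y r hr => ((hG.strong_cont y).mono (by
      rw [uIcc_of_le hr]; exact Icc_subset_Ici_self)).intervalIntegrable
  -- `D` consists of the vectors on which the adjoint semigroup is right continuous at zero. It is
  -- closed by local boundedness, and it remains to see that it is dense.
  let D : Submodule ℝ H :=
    { carrier := {x | Tendsto (fun h : ℝ => (G h).adjoint x) (𝓝[≥] 0) (𝓝 x)}
      add_mem' := fun {a b} ha hb => by
        simp only [mem_ofPred_eq] at *
        simpa only [_root_.map_add] using Tendsto.add ha hb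
      zero_mem' := by simp
      smul_mem' := fun c x hx => by
        simp only [mem_ofPred_eq] at *
        simpa only [map_smul] using Tendsto.const_smul hx c }
  have hDc : IsClosed (D : Set H) := by
    refine isClosed_of_closure_subset fun x hx => ?_
    rw [Metric.mem_closure_iff] at hx
    change Tendsto (fun h : ℝ => (G h).adjoint x) (𝓝[≥] 0) (𝓝 x)
    rw [Metric.tendsto_nhds]
    intro ε hε
    obtain ⟨y, hyD, hy⟩ := hx (ε / (2 * (M + 1))) (by positivity)
    have hy' : Tendsto (fun h : ℝ => (G h).adjoint y) (𝓝[≥] 0) (𝓝 y) := hyD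
    rw [Metric.tendsto_nhds] at hy'
    have h1 : ∀ᶠ h : ℝ in 𝓝[≥] 0, h ∈ Ico (0 : ℝ) 2 := Ico_mem_nhdsGE (by norm_num)
    filter_upwards [hy' (ε / 2) (by positivity), h1] with h h2 h3
    have e1 : dist ((G h).adjoint x) ((G h).adjoint y) ≤ M * dist x y := by
      rw [dist_eq_norm, dist_eq_norm, ← map_sub]
      refine ((G h).adjoint.le_opNorm _).trans ?_
      rw [hnorm]
      exact mul_le_mul_of_nonneg_right (hM h h3.1 h3.2.le) (norm_nonneg _)
    have e2 : (M + 1) * dist x y < ε / 2 := by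
      rw [lt_div_iff₀ (by positivity)] at hy
      linarith
    have := dist_triangle4 ((G h).adjoint x) ((G h).adjoint y) y x
    rw [dist_comm y x] at this
    linarith
  -- Let `S` be the time average of `G` over `[0, r]`. The range of its adjoint lies in `D`, so a
  -- vector `y` orthogonal to `D` satisfies `S y = 0` for all small `r`, which forces `y = 0`.
  have hD : D = ⊤ := by
    have : CompleteSpace D := hDc.completeSpace_coe
    rw [← Submodule.orthogonal_eq_bot_iff, Submodule.eq_bot_iff]
    intro y hy
    have key : ∀ r : ℝ, 0 < r → r ≤ 1 → ∫ s in 0..r, G s y = 0 := by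
      intro r hr hr1
      set S : H →L[ℝ] H := LinearMap.mkContinuous
        { toFun := fun y => ∫ s in 0..r, G s y
          map_add' := fun a b => by
            simp only [_root_.map_add]
            exact intervalIntegral.integral_add (hiG a r hr.le) (hiG b r hr.le)
          map_smul' := fun c a => by simp [intervalIntegral.integral_smul] } (M * |r - 0|) (fun y => by
            have : ‖∫ s in 0..r, G s y‖ ≤ M * ‖y‖ * |r - 0| := by
              refine intervalIntegral.norm_integral_le_of_norm_le_const fun s hs => ?_
              rw [uIoc_of_le hr.le] at hs
              exact ((G s).le_opNorm y).trans
                (mul_le_mul_of_nonneg_right (hM s hs.1.le (by linarith [hs.2])) (norm_nonneg _))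
            simpa [mul_right_comm] using this) with hS
      have hSa : ∀ y, S y = ∫ s in 0..r, G s y := fun y => rfl
      have hmem : ∀ x, S.adjoint x ∈ D := by
        intro x
        change Tendsto (fun h : ℝ => (G h).adjoint (S.adjoint x)) (𝓝[≥] 0) (𝓝 (S.adjoint x))
        rw [tendsto_iff_norm_sub_tendsto_zero]
        have hz : Tendsto (fun h : ℝ => 2 * h * M * ‖x‖) (𝓝[≥] 0) (𝓝 0) := by
          have : Continuous fun h : ℝ => 2 * h * M * ‖x‖ := by fun_prop
          simpa using (this.tendsto 0).mono_left nhdsWithin_le_nhds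
        refine squeeze_zero' (Eventually.of_forall fun _ => norm_nonneg _) ?_ hz
        have h1 : ∀ᶠ h : ℝ in 𝓝[≥] 0, h ∈ Ico (0 : ℝ) 1 := Ico_mem_nhdsGE (by norm_num)
        filter_upwards [h1] with h hh
        -- The almost invariance of averages holds in operator norm, so it survives passage to the
        -- adjoint.
        have hop : ‖S.comp (G h) - S‖ ≤ 2 * h * M := by
          refine ContinuousLinearMap.opNorm_le_bound _ (by have := hh.1; positivity) fun y => ?_
          exact hG.norm_integral_shift_le hh.1 hr.le
            (fun t h0 h1 => hM t h0 (by linarith [hh.2])) y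
        have : (G h).adjoint (S.adjoint x) - S.adjoint x = (S.comp (G h) - S).adjoint x := by
          rw [map_sub, ContinuousLinearMap.adjoint_comp]; rfl
        rw [this]
        refine (ContinuousLinearMap.le_opNorm _ _).trans ?_
        rw [LinearIsometryEquiv.norm_map]
        gcongr
      have h0 : S y = 0 := by
        refine ext_inner_left ℝ fun x => ?_
        rw [← ContinuousLinearMap.adjoint_inner_left, inner_zero_right]
        exact (Submodule.mem_orthogonal D y).1 hy _ (hmem x)
      rw [← hSa, h0]
    -- The right derivative of the averages at zero is `G 0 y = y`, while the averages vanish.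
    have hd : HasDerivWithinAt (fun r => ∫ s in 0..r, G (max s 0) y) (G (max 0 0) y) (Ioi 0) 0 :=
      (intervalIntegral.integral_hasDerivAt_right ((hc y).intervalIntegrable _ _)
        ((hc y).stronglyMeasurableAtFilter _ _) (hc y).continuousAt).hasDerivWithinAt
    have hd0 : HasDerivWithinAt (fun r => ∫ s in 0..r, G (max s 0) y) 0 (Ioi 0) 0 := by
      refine (hasDerivWithinAt_const (0 : ℝ) (Ioi 0) (0 : H)).congr_of_eventuallyEq ?_ (by simp)
      have h1 : ∀ᶠ h : ℝ in 𝓝[>] 0, h ∈ Ioc (0 : ℝ) 1 := Ioc_mem_nhdsGT (by norm_num)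
      filter_upwards [h1] with r hr
      rw [← key r hr.1 hr.2]
      refine intervalIntegral.integral_congr fun s hs => ?_
      rw [uIcc_of_le hr.1.le] at hs
      rw [max_eq_left hs.1]
    have := (uniqueDiffWithinAt_Ioi (0 : ℝ)).eq_deriv _ hd hd0
    simpa [hG.map_zero] using this
  refine ⟨by simp [hG.map_zero, ContinuousLinearMap.adjoint_id], hadd, fun x => ?_⟩
  have hx0 : Tendsto (fun h : ℝ => (G h).adjoint x) (𝓝[≥] 0) (𝓝 x) := by
    have : x ∈ D := by rw [hD]; trivial
    exact this
  rw [Metric.continuousOn_iff]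
  intro t ht ε hε
  rw [mem_Ici] at ht
  obtain ⟨M, hM0, hM⟩ := hG.exists_bound (t + 1)
  have h1 := Metric.tendsto_nhdsWithin_nhds.1 hx0 (ε / M) (by positivity)
  obtain ⟨δ, hδ, hδ'⟩ := h1
  -- Right continuity at zero yields continuity from both sides at `t`: the operator at the later
  -- time factors through the one at the earlier time, whose norm is at most `M`.
  have main : ∀ a b : ℝ, 0 ≤ a → a ≤ b → a ≤ t + 1 → b - a < δ →
      dist ((G b).adjoint x) ((G a).adjoint x) < ε := by
    intro a b ha hab hat hlt
    have e : (G b).adjoint x = (G a).adjoint ((G (b - a)).adjoint x) := by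
      have := hadd a (b - a) ha (by linarith)
      rw [add_sub_cancel] at this
      rw [this]; rfl
    rw [e, dist_eq_norm, ← map_sub]
    have h2 := hδ' (x := b - a) (by simpa using hab) (by
      rw [Real.dist_eq, sub_zero, abs_of_nonneg (by linarith)]; exact hlt)
    rw [dist_eq_norm, lt_div_iff₀ hM0] at h2
    refine ((G a).adjoint.le_opNorm _).trans_lt (lt_of_le_of_lt ?_ h2)
    rw [hnorm, mul_comm]
    exact mul_le_mul_of_nonneg_left (hM a ha hat) (norm_nonneg _)
  refine ⟨min δ 1, by positivity, fun s hs hst => ?_⟩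
  rw [mem_Ici] at hs
  rw [Real.dist_eq] at hst
  have hs1 := lt_of_lt_of_le hst (min_le_left _ _)
  have hs2 := lt_of_lt_of_le hst (min_le_right _ _)
  rw [abs_lt] at hs1 hs2
  rcases le_total s t with h | h
  · rw [dist_comm]
    exact main s t hs h (by linarith) (by linarith)
  · exact main t s ht h (by linarith) (by linarith)

/-- Scalar version of the Cauchy-Schwarz inequality for integrals. -/
theorem sq_integral_mul_le {α : Type*} [MeasurableSpace α] {μ : Measure α} {a b : α → ℝ}
    (ha : MemLp a 2 μ) (hb : MemLp b 2 μ) (ha0 : 0 ≤ a) (hb0 : 0 ≤ b) :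
    (∫ x, a x * b x ∂μ) ^ 2 ≤ (∫ x, a x ^ 2 ∂μ) * ∫ x, b x ^ 2 ∂μ := by
  have h := integral_mul_le_Lp_mul_Lq_of_nonneg (μ := μ) Real.HolderConjugate.two_two
    (f := a) (g := b) (Eventually.of_forall ha0) (Eventually.of_forall hb0) (by simpa using ha)
    (by simpa using hb)
  have h0 : 0 ≤ ∫ x, a x * b x ∂μ := integral_nonneg fun x => mul_nonneg (ha0 x) (hb0 x)
  have hA : 0 ≤ ∫ x, a x ^ 2 ∂μ := integral_nonneg fun x => sq_nonneg _
  have hB : 0 ≤ ∫ x, b x ^ 2 ∂μ := integral_nonneg fun x => sq_nonneg _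
  simp only [Real.rpow_two, ← Real.sqrt_eq_rpow] at h
  calc _ ≤ (√(∫ x, a x ^ 2 ∂μ) * √(∫ x, b x ^ 2 ∂μ)) ^ 2 := by gcongr
    _ = _ := by rw [mul_pow, Real.sq_sqrt hA, Real.sq_sqrt hB]

end Semigroup


/-! ### Convolution with exponentially decaying operator kernels -/

section Kernel

theorem integrable_exp_neg_mul_abs {ε : ℝ} (hε : 0 < ε) :
    Integrable fun t : ℝ => Real.exp (-ε * |t|) := by
  rw [← integrableOn_univ, ← Iic_union_Ioi (a := (0 : ℝ)), integrableOn_union]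
  constructor
  · refine (integrableOn_exp_mul_Iic hε 0).congr_fun (fun t ht => ?_) measurableSet_Iic
    simp [abs_of_nonpos (mem_Iic.1 ht)]
  · refine (exp_neg_integrableOn_Ioi 0 hε).congr_fun (fun t ht => ?_) measurableSet_Ioi
    simp [abs_of_pos (mem_Ioi.1 ht)]

theorem memLp_exp_neg_mul_abs {ε : ℝ} (hε : 0 < ε) :
    MemLp (fun t : ℝ => Real.exp (-ε * |t|)) 2 := by
  rw [memLp_two_iff_integrable_sq (by fun_prop)]
  refine (integrable_exp_neg_mul_abs (show 0 < 2 * ε by positivity)).congr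
    (Eventually.of_forall fun t => ?_)
  simp only [← Real.exp_nat_mul]
  push_cast
  ring_nf

theorem memLp_two_iff_norm_sq {H : Type*} [NormedAddCommGroup H] {f : ℝ → H} (hf : AEStronglyMeasurable f) :
    MemLp f 2 ↔ Integrable fun t => ‖f t‖ ^ 2 :=
  memLp_two_iff_integrable_sq_norm hf

variable {H : Type*} [NormedAddCommGroup H] [InnerProductSpace ℝ H]

/-- Operator kernels on the line with exponential decay, continuous up to a switch between two
strongly continuous branches. -/
structure IsExpKernel (k : ℝ → H →L[ℝ] H) (C ε : ℝ) : Prop where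
  pos : 0 < ε
  bound : ∀ t, ‖k t‖ ≤ C * Real.exp (-ε * |t|)
  branches : ∃ (S : Set ℝ) (a b : ℝ × H → H), MeasurableSet S ∧ Continuous a ∧ Continuous b ∧
    (∀ t ∈ S, ∀ x, k t x = a (t, x)) ∧ ∀ t ∉ S, ∀ x, k t x = b (t, x)

/-- The convolution of an operator kernel with a vector function. -/
noncomputable def kernelConv (k : ℝ → H →L[ℝ] H) (f : ℝ → H) (t : ℝ) : H :=
  ∫ s, k (t - s) (f s)

namespace IsExpKernel

variable {k : ℝ → H →L[ℝ] H} {C ε : ℝ}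

theorem const_nonneg (hk : IsExpKernel k C ε) : 0 ≤ C := by
  have := (norm_nonneg _).trans (hk.bound 0)
  simpa using this

theorem norm_apply_le (hk : IsExpKernel k C ε) (t : ℝ) (x : H) :
    ‖k t x‖ ≤ C * Real.exp (-ε * |t|) * ‖x‖ :=
  (k t).le_of_opNorm_le (hk.bound t) x

/-- The kernel need not be measurable in operator norm; measurability is drawn from the two jointly
continuous branches. -/
theorem aestronglyMeasurable (hk : IsExpKernel k C ε) {α : Type*} [MeasurableSpace α]
    {μ : Measure α} {τ : α → ℝ} {f : α → H} (hτ : Measurable τ) (hf : AEStronglyMeasurable f μ) :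
    AEStronglyMeasurable (fun x => k (τ x) (f x)) μ := by
  classical
  obtain ⟨S, a, b, hS, ha, hb, h1, h2⟩ := hk.branches
  have hp : AEStronglyMeasurable (fun x => (τ x, f x)) μ :=
    hτ.stronglyMeasurable.aestronglyMeasurable.prodMk hf
  have : (fun x => k (τ x) (f x)) =
      fun x => (τ ⁻¹' S).indicator (fun x => a (τ x, f x)) x +
        (τ ⁻¹' S)ᶜ.indicator (fun x => b (τ x, f x)) x := by
    funext x
    by_cases hx : τ x ∈ S
    · simp [hx, h1 _ hx]
    · simp [hx, h2 _ hx]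
  rw [this]
  exact ((ha.comp_aestronglyMeasurable hp).indicator (hτ hS)).add
    ((hb.comp_aestronglyMeasurable hp).indicator (hτ hS).compl)

theorem memLp_bound (hk : IsExpKernel k C ε) (t : ℝ) :
    MemLp (fun s => C * Real.exp (-ε * |t - s|)) 2 :=
  ((memLp_exp_neg_mul_abs hk.pos).const_mul C).comp_measurePreserving
    (Measure.measurePreserving_sub_left volume t)

theorem integrable_conv (hk : IsExpKernel k C ε) {f : ℝ → H} (hf : MemLp f 2) (t : ℝ) :
    Integrable fun s => k (t - s) (f s) := by
  have h1 : Integrable fun s => C * Real.exp (-ε * |t - s|) * ‖f s‖ :=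
    MemLp.integrable_mul (hk.memLp_bound t) hf.norm
  exact h1.mono' (hk.aestronglyMeasurable (by fun_prop) hf.aestronglyMeasurable)
    (Eventually.of_forall fun s => hk.norm_apply_le _ _)

/-- Cauchy–Schwarz bounds the supremum of the convolution by the L² norm of `f`. Thus L² density of
compactly supported continuous functions becomes uniform approximation of convolutions, which yields
their continuity and decay. -/
theorem norm_conv_sq_le (hk : IsExpKernel k C ε) {f : ℝ → H} (hf : MemLp f 2) (t : ℝ) :
    ‖kernelConv k f t‖ ^ 2 ≤
      (∫ s, (C * Real.exp (-ε * |s|)) ^ 2) * ∫ s, ‖f s‖ ^ 2 := by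
  have hC := hk.const_nonneg
  have h1 : Integrable fun s => C * Real.exp (-ε * |t - s|) * ‖f s‖ :=
    MemLp.integrable_mul (hk.memLp_bound t) hf.norm
  have h2 : ‖kernelConv k f t‖ ≤ ∫ s, C * Real.exp (-ε * |t - s|) * ‖f s‖ :=
    (norm_integral_le_integral_norm _).trans (integral_mono_of_nonneg
      (Eventually.of_forall fun s => norm_nonneg _) h1
      (Eventually.of_forall fun s => hk.norm_apply_le _ _))
  have h3 := sq_integral_mul_le (hk.memLp_bound t) hf.norm (fun s => by positivity)
    (fun s => norm_nonneg _)
  rw [integral_sub_left_eq_self (fun s => (C * Real.exp (-ε * |s|)) ^ 2) volume t] at h3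
  exact (pow_le_pow_left₀ (norm_nonneg _) h2 2).trans h3

theorem conv_sub (hk : IsExpKernel k C ε) {f g : ℝ → H} (hf : MemLp f 2) (hg : MemLp g 2)
    (t : ℝ) : kernelConv k (f - g) t = kernelConv k f t - kernelConv k g t := by
  simp only [kernelConv, Pi.sub_apply, map_sub]
  exact integral_sub (hk.integrable_conv hf t) (hk.integrable_conv hg t)

/-- Once the translation is moved onto `f`, the discontinuities of the kernel are harmless and
dominated convergence uses only the continuity of `f`. -/
theorem continuous_conv_of_hasCompactSupport (hk : IsExpKernel k C ε) {f : ℝ → H}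
    (hf : Continuous f) (hs : HasCompactSupport f) : Continuous (kernelConv k f) := by
  obtain ⟨D, hD⟩ := hs.exists_bound_of_continuous hf
  have hD0 : 0 ≤ D := (norm_nonneg _).trans (hD 0)
  have hC := hk.const_nonneg
  have e : kernelConv k f = fun t => ∫ s, k s (f (t - s)) := by
    funext t
    rw [kernelConv, ← integral_sub_left_eq_self (fun s => k s (f (t - s))) volume t]
    simp
  rw [e]
  refine continuous_of_dominated (bound := fun s => C * Real.exp (-ε * |s|) * D) (fun t => ?_)
    (fun t => Eventually.of_forall fun s => ?_)
    (((integrable_exp_neg_mul_abs hk.pos).const_mul C).mul_const D)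
    (Eventually.of_forall fun s => ?_)
  · exact hk.aestronglyMeasurable measurable_id (by
      exact (hf.comp (by fun_prop)).aestronglyMeasurable)
  · exact (hk.norm_apply_le _ _).trans (by gcongr; exact hD _)
  · fun_prop

/-- The triangle inequality gives e^{-ε|t-s|} ≤ e^{-ε|t|} e^{ε|s|}, and the growing weight is
harmless on a compact support. -/
theorem norm_conv_le_exp (hk : IsExpKernel k C ε) {f : ℝ → H}
    (hf : Continuous f) (hs : HasCompactSupport f) :
    ∃ D : ℝ, 0 ≤ D ∧ ∀ t, ‖kernelConv k f t‖ ≤ D * Real.exp (-ε * |t|) := by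
  have hC := hk.const_nonneg
  have hi : Integrable fun s => Real.exp (ε * |s|) * ‖f s‖ :=
    Continuous.integrable_of_hasCompactSupport (by fun_prop) (hs.norm.mul_left)
  refine ⟨C * ∫ s, Real.exp (ε * |s|) * ‖f s‖, by positivity, fun t => ?_⟩
  have h2 : ‖kernelConv k f t‖ ≤
      ∫ s, C * Real.exp (-ε * |t|) * (Real.exp (ε * |s|) * ‖f s‖) := by
    refine (norm_integral_le_integral_norm _).trans (integral_mono_of_nonneg
      (Eventually.of_forall fun s => norm_nonneg _) (hi.const_mul _)
      (Eventually.of_forall fun s => ?_))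
    refine (hk.norm_apply_le _ _).trans ?_
    have : Real.exp (-ε * |t - s|) ≤ Real.exp (-ε * |t|) * Real.exp (ε * |s|) := by
      rw [← Real.exp_add, Real.exp_le_exp]
      have := abs_sub_abs_le_abs_sub t s
      nlinarith [hk.pos]
    calc _ ≤ C * (Real.exp (-ε * |t|) * Real.exp (ε * |s|)) * ‖f s‖ := by gcongr
      _ = _ := by ring
  rw [integral_const_mul] at h2
  linarith

theorem tendsto_exp_neg_mul_abs_cocompact {ε : ℝ} (hε : 0 < ε) (D : ℝ) :
    Tendsto (fun t : ℝ => D * Real.exp (-ε * |t|)) (cocompact ℝ) (𝓝 0) := by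
  have h1 : Tendsto (fun t : ℝ => ε * |t|) (cocompact ℝ) atTop :=
    (tendsto_norm_cocompact_atTop (E := ℝ)).const_mul_atTop hε
  have := (Real.tendsto_exp_neg_atTop_nhds_zero.comp h1).const_mul D
  simpa [Function.comp_def] using this

theorem exists_approx {f : ℝ → H} (hf : MemLp f 2) {ε : ℝ} (hε : 0 < ε) :
    ∃ g : ℝ → H, HasCompactSupport g ∧ Continuous g ∧ MemLp g 2 ∧ ∫ t, ‖(f - g) t‖ ^ 2 ≤ ε := by
  have h2 : ENNReal.ofReal 2 = 2 := by simp
  obtain ⟨g, h1, h3, h4, h5⟩ := MemLp.exists_hasCompactSupport_integral_rpow_sub_le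
    (p := 2) (by norm_num) (by rwa [h2]) hε
  exact ⟨g, h1, h4, by rwa [h2] at h5, by simpa using h3⟩

/-- Uniform approximation of convolutions by convolutions of compactly supported functions. -/
theorem exists_conv_approx (hk : IsExpKernel k C ε) {f : ℝ → H} (hf : MemLp f 2) {δ : ℝ}
    (hδ : 0 < δ) : ∃ g : ℝ → H, HasCompactSupport g ∧ Continuous g ∧
      ∀ t, ‖kernelConv k f t - kernelConv k g t‖ < δ := by
  set c := ∫ s, (C * Real.exp (-ε * |s|)) ^ 2 with hc
  have hc0 : 0 ≤ c := integral_nonneg fun s => sq_nonneg _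
  -- The tolerance keeps its product with `c` below `(δ / 2) ^ 2`; the `+ 1` covers `c = 0`.
  obtain ⟨g, h1, h2, h3, h4⟩ := exists_approx hf (ε := (δ / 2) ^ 2 / (c + 1)) (by positivity)
  refine ⟨g, h1, h2, fun t => ?_⟩
  rw [← hk.conv_sub hf h3]
  have h5 := hk.norm_conv_sq_le (hf.sub h3) t
  have h6 : c * ∫ s, ‖(f - g) s‖ ^ 2 ≤ (δ / 2) ^ 2 := by
    calc _ ≤ c * ((δ / 2) ^ 2 / (c + 1)) := by gcongr
      _ = (δ / 2) ^ 2 * (c / (c + 1)) := by ring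
      _ ≤ (δ / 2) ^ 2 * 1 := by
        gcongr
        rw [div_le_one (by positivity)]
        linarith
      _ = _ := mul_one _
  have := abs_le_of_sq_le_sq (h5.trans h6) (by positivity)
  rw [abs_norm] at this
  linarith

theorem continuous_conv (hk : IsExpKernel k C ε) {f : ℝ → H} (hf : MemLp f 2) :
    Continuous (kernelConv k f) := by
  have h := fun n : ℕ => hk.exists_conv_approx hf (δ := 1 / ((n : ℝ) + 1)) (by positivity)
  choose g h1 h2 h3 using h
  have hu : TendstoUniformly (fun n => kernelConv k (g n)) (kernelConv k f) atTop := by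
    rw [Metric.tendstoUniformly_iff]
    intro δ hδ
    obtain ⟨n, hn⟩ := exists_nat_one_div_lt hδ
    filter_upwards [eventually_ge_atTop n] with m hm t
    rw [dist_eq_norm]
    refine (h3 m t).trans (lt_of_le_of_lt ?_ hn)
    gcongr
  exact hu.continuous (Frequently.of_forall fun n =>
    hk.continuous_conv_of_hasCompactSupport (h2 n) (h1 n))

theorem tendsto_conv (hk : IsExpKernel k C ε) {f : ℝ → H} (hf : MemLp f 2) :
    Tendsto (kernelConv k f) (cocompact ℝ) (𝓝 0) := by
  rw [Metric.tendsto_nhds]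
  intro δ hδ
  obtain ⟨g, h1, h2, h3⟩ := hk.exists_conv_approx hf (half_pos hδ)
  obtain ⟨D, hD0, hD⟩ := hk.norm_conv_le_exp h2 h1
  filter_upwards [(tendsto_exp_neg_mul_abs_cocompact hk.pos D).eventually
    (gt_mem_nhds (half_pos hδ))] with t ht
  rw [dist_zero_right]
  have e : kernelConv k f t = (kernelConv k f t - kernelConv k g t) + kernelConv k g t := by abel
  rw [e]
  refine (norm_add_le _ _).trans_lt ?_
  linarith [h3 t, hD t]

/-- Young's inequality for exponentially decaying kernels. -/
theorem conv_sq_integrable_and_le (hk : IsExpKernel k C ε) {f : ℝ → H} (hf : MemLp f 2) :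
    MemLp (kernelConv k f) 2 ∧ ∫ t, ‖kernelConv k f t‖ ^ 2 ≤
      (∫ s, C * Real.exp (-ε * |s|)) ^ 2 * ∫ s, ‖f s‖ ^ 2 := by
  have hC := hk.const_nonneg
  set κ : ℝ → ℝ := fun s => C * Real.exp (-ε * |s|) with hκ
  have hκ0 : ∀ s, 0 ≤ κ s := fun s => by positivity
  have hκi : Integrable κ := (integrable_exp_neg_mul_abs hk.pos).const_mul C
  have hfi : Integrable fun t => ‖f t‖ ^ 2 := (memLp_two_iff_norm_sq hf.aestronglyMeasurable).1 hf
  have hpt : ∀ᵐ t, ‖kernelConv k f t‖ ^ 2 ≤ (∫ s, κ s) * ∫ s, ‖f s‖ ^ 2 * κ (t - s) := by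
    have hex := hfi.ae_convolution_exists (ContinuousLinearMap.mul ℝ ℝ) hκi
    filter_upwards [hex] with t ht
    have ht' : Integrable fun s => ‖f s‖ ^ 2 * κ (t - s) := ht
    have h1 : Integrable fun s => κ (t - s) * ‖f s‖ :=
      MemLp.integrable_mul (hk.memLp_bound t) hf.norm
    have h2 : ‖kernelConv k f t‖ ≤ ∫ s, κ (t - s) * ‖f s‖ :=
      (norm_integral_le_integral_norm _).trans (integral_mono_of_nonneg
        (Eventually.of_forall fun s => norm_nonneg _) h1
        (Eventually.of_forall fun s => hk.norm_apply_le _ _))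
    -- Cauchy–Schwarz is applied to the splitting κ‖f‖ = √κ · (√κ‖f‖), so that one factor integrates
    -- to the total mass of κ.
    have hm1 : MemLp (fun s => √(κ (t - s))) 2 := by
      rw [memLp_two_iff_integrable_sq (by fun_prop)]
      simpa only [Real.sq_sqrt (hκ0 _)] using hκi.comp_sub_left t
    have hm2 : MemLp (fun s => √(κ (t - s)) * ‖f s‖) 2 := by
      have hae : AEStronglyMeasurable (fun s => √(κ (t - s)) * ‖f s‖) :=
        AEStronglyMeasurable.mul (by fun_prop) hf.aestronglyMeasurable.norm
      rw [memLp_two_iff_integrable_sq hae]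
      refine ht'.congr (Eventually.of_forall fun s => ?_)
      simp only [mul_pow, Real.sq_sqrt (hκ0 _)]
      ring
    have h3 := sq_integral_mul_le hm1 hm2 (fun s => Real.sqrt_nonneg _)
      (fun s => by positivity)
    simp only [mul_pow, ← mul_assoc, Real.mul_self_sqrt (hκ0 _), Real.sq_sqrt (hκ0 _)] at h3
    rw [integral_sub_left_eq_self κ volume t] at h3
    simp only [mul_comm (κ _) (‖f _‖ ^ 2)] at h3
    exact (pow_le_pow_left₀ (norm_nonneg _) h2 2).trans h3
  have hci : Integrable fun t => ∫ s, ‖f s‖ ^ 2 * κ (t - s) :=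
    hfi.integrable_convolution (ContinuousLinearMap.mul ℝ ℝ) hκi
  have hcv : ∫ t, ∫ s, ‖f s‖ ^ 2 * κ (t - s) = (∫ s, ‖f s‖ ^ 2) * ∫ s, κ s :=
    integral_convolution (ContinuousLinearMap.mul ℝ ℝ) hfi hκi
  have hm : AEStronglyMeasurable (kernelConv k f) := (hk.continuous_conv hf).aestronglyMeasurable
  constructor
  · rw [memLp_two_iff_norm_sq hm]
    refine (hci.const_mul (∫ s, κ s)).mono' (hm.norm.pow 2) ?_
    filter_upwards [hpt] with t ht
    rwa [Real.norm_of_nonneg (by positivity)]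
  · refine (integral_mono_of_nonneg (Eventually.of_forall fun s => by positivity)
      (hci.const_mul (∫ s, κ s)) hpt).trans_eq ?_
    rw [integral_const_mul, hcv]
    ring

/-- Convolution with a kernel and with the reversed adjoint kernel are adjoint to each other. -/
theorem integral_inner_conv [CompleteSpace H] (hk : IsExpKernel k C ε)
    {k' : ℝ → H →L[ℝ] H} (hk' : IsExpKernel k' C ε) (hkk : ∀ t, k' t = (k (-t)).adjoint)
    {f g : ℝ → H} (hf : MemLp f 2) (hg : MemLp g 2) :
    ∫ t, inner ℝ (kernelConv k f t) (g t) = ∫ s, inner ℝ (f s) (kernelConv k' g s) := by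
  have hC := hk.const_nonneg
  have hκi : Integrable fun s => C * Real.exp (-ε * |s|) :=
    (integrable_exp_neg_mul_abs hk.pos).const_mul C
  have hfi : Integrable fun t => ‖f t‖ ^ 2 := (memLp_two_iff_norm_sq hf.aestronglyMeasurable).1 hf
  have hgi : Integrable fun t => ‖g t‖ ^ 2 := (memLp_two_iff_norm_sq hg.aestronglyMeasurable).1 hg
  -- Fubini needs a majorant on the plane. From ‖f‖‖g‖ ≤ ‖f‖² + ‖g‖² it is a sum of two scalar
  -- convolution integrands, the second with the variables exchanged.
  have h1 := hfi.convolution_integrand (ContinuousLinearMap.mul ℝ ℝ) hκi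
  have h2 := (hgi.convolution_integrand (ContinuousLinearMap.mul ℝ ℝ) hκi).swap
  have hint : Integrable (fun p : ℝ × ℝ => inner ℝ (k (p.1 - p.2) (f p.2)) (g p.1))
      (volume.prod volume) := by
    refine (h1.add h2).mono' ?_ (Eventually.of_forall fun p => ?_)
    · exact (hk.aestronglyMeasurable (by fun_prop) hf.aestronglyMeasurable.comp_snd).inner
        hg.aestronglyMeasurable.comp_fst
    · simp only [Pi.add_apply, Function.comp_apply, Prod.fst_swap, Prod.snd_swap,
        ContinuousLinearMap.mul_apply']
      rw [abs_sub_comm p.2 p.1]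
      have e1 := norm_inner_le_norm (𝕜 := ℝ) (k (p.1 - p.2) (f p.2)) (g p.1)
      have e2 := hk.norm_apply_le (p.1 - p.2) (f p.2)
      have e3 : 0 ≤ C * Real.exp (-ε * |p.1 - p.2|) := by positivity
      have e4 : ‖f p.2‖ * ‖g p.1‖ ≤ ‖f p.2‖ ^ 2 + ‖g p.1‖ ^ 2 := by
        nlinarith [sq_nonneg (‖f p.2‖ - ‖g p.1‖), sq_nonneg (‖f p.2‖), sq_nonneg (‖g p.1‖)]
      calc _ ≤ ‖k (p.1 - p.2) (f p.2)‖ * ‖g p.1‖ := e1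
        _ ≤ C * Real.exp (-ε * |p.1 - p.2|) * ‖f p.2‖ * ‖g p.1‖ := by gcongr
        _ = C * Real.exp (-ε * |p.1 - p.2|) * (‖f p.2‖ * ‖g p.1‖) := by ring
        _ ≤ C * Real.exp (-ε * |p.1 - p.2|) * (‖f p.2‖ ^ 2 + ‖g p.1‖ ^ 2) := by gcongr
        _ = _ := by ring
  calc ∫ t, inner ℝ (kernelConv k f t) (g t)
      = ∫ t, ∫ s, inner ℝ (k (t - s) (f s)) (g t) := by
        refine integral_congr_ae (Eventually.of_forall fun t => ?_)
        simp only [kernelConv, real_inner_comm (g t)]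
        exact (integral_inner (hk.integrable_conv hf t) (g t)).symm
    _ = ∫ s, ∫ t, inner ℝ (k (t - s) (f s)) (g t) := integral_integral_swap hint
    _ = ∫ s, inner ℝ (f s) (kernelConv k' g s) := by
        refine integral_congr_ae (Eventually.of_forall fun s => ?_)
        simp only [kernelConv]
        rw [← integral_inner (hk'.integrable_conv hg s) (f s)]
        refine integral_congr_ae (Eventually.of_forall fun t => ?_)
        simp only
        rw [hkk, ContinuousLinearMap.adjoint_inner_right]
        simp

end IsExpKernel

end Kernel


/-! ### Green's function of the exponential dichotomy -/

section Green

variable {H : Type*} [NormedAddCommGroup H] [InnerProductSpace ℝ H]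

theorem kernelConv_congr {k : ℝ → H →L[ℝ] H} {f g : ℝ → H} (h : f =ᵐ[volume] g) (t : ℝ) :
    kernelConv k f t = kernelConv k g t :=
  integral_congr_ae (h.mono fun s hs => by simp only [hs])

namespace IsExpKernel

variable {k k' : ℝ → H →L[ℝ] H} {C ε : ℝ}

theorem neg (hk : IsExpKernel k C ε) : IsExpKernel (fun t => k (-t)) C ε where
  pos := hk.pos
  bound t := by simpa using hk.bound (-t)
  branches := by
    obtain ⟨S, a, b, hS, ha, hb, h1, h2⟩ := hk.branches
    refine ⟨(fun t => -t) ⁻¹' S, fun p => a (-p.1, p.2), fun p => b (-p.1, p.2),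
      measurable_neg hS, by fun_prop, by fun_prop, fun t ht => h1 _ ht, fun t ht => h2 _ ht⟩

theorem memLp_apply (hk : IsExpKernel k C ε) (x : H) : MemLp (fun t => k t x) 2 := by
  have h1 : MemLp (fun t : ℝ => C * Real.exp (-ε * |t|) * ‖x‖) 2 :=
    ((memLp_exp_neg_mul_abs hk.pos).const_mul C).mul_const _
  exact h1.mono' (hk.aestronglyMeasurable measurable_id aestronglyMeasurable_const)
    (Eventually.of_forall fun t => hk.norm_apply_le t x)

/-- Convolution with an exponentially decaying kernel as an operator in `L²(ℝ; H)`. -/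
noncomputable def convL2 (hk : IsExpKernel k C ε) : Lp H 2 (volume : Measure ℝ) →L[ℝ] Lp H 2
    (volume : Measure ℝ) :=
  LinearMap.mkContinuous
    { toFun := fun f => (hk.conv_sq_integrable_and_le (Lp.memLp f)).1.toLp (kernelConv k f)
      map_add' := fun f g => by
        rw [← MemLp.toLp_add]
        refine MemLp.toLp_congr _ _ (Eventually.of_forall fun t => ?_)
        rw [kernelConv_congr (Lp.coeFn_add f g)]
        simp only [kernelConv, Pi.add_apply, map_add]
        exact integral_add (hk.integrable_conv (Lp.memLp f) t) (hk.integrable_conv (Lp.memLp g) t)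
      map_smul' := fun c f => by
        rw [RingHom.id_apply, ← MemLp.toLp_const_smul]
        refine MemLp.toLp_congr _ _ (Eventually.of_forall fun t => ?_)
        rw [kernelConv_congr (Lp.coeFn_smul c f)]
        simp only [kernelConv, Pi.smul_apply, map_smul]
        exact integral_smul _ _ }
    (∫ s, C * Real.exp (-ε * |s|)) (fun f => by
      have h0 : 0 ≤ ∫ s, C * Real.exp (-ε * |s|) := by
        have := hk.const_nonneg
        positivity
      have hsq : ∀ g : Lp H 2 (volume : Measure ℝ), ‖g‖ ^ 2 = ∫ t, ‖g t‖ ^ 2 := fun g => by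
        rw [← real_inner_self_eq_norm_sq, L2.inner_def]
        simp
      refine abs_le_of_sq_le_sq' ?_ (by positivity) |>.2
      rw [mul_pow, hsq, hsq f]
      refine le_trans (le_of_eq ?_) (hk.conv_sq_integrable_and_le (Lp.memLp f)).2
      refine integral_congr_ae ?_
      filter_upwards [MemLp.coeFn_toLp (hk.conv_sq_integrable_and_le (Lp.memLp f)).1] with t ht
      simp only [LinearMap.coe_mk, AddHom.coe_mk, ht])

theorem coeFn_convL2 (hk : IsExpKernel k C ε) (f : Lp H 2 (volume : Measure ℝ)) :
    hk.convL2 f =ᵐ[volume] kernelConv k f :=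
  MemLp.coeFn_toLp (hk.conv_sq_integrable_and_le (Lp.memLp f)).1

theorem inner_convL2 [CompleteSpace H] (hk : IsExpKernel k C ε) (hk' : IsExpKernel k' C ε)
    (hkk : ∀ t, k' t = (k (-t)).adjoint) (f g : Lp H 2 (volume : Measure ℝ)) :
    inner ℝ (hk.convL2 f) g = inner ℝ f (hk'.convL2 g) := by
  rw [L2.inner_def, L2.inner_def]
  have h := hk.integral_inner_conv hk' hkk (Lp.memLp f) (Lp.memLp g)
  refine (integral_congr_ae ?_).trans (h.trans (integral_congr_ae ?_))
  · filter_upwards [hk.coeFn_convL2 f] with t ht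
    rw [ht]
  · filter_upwards [hk'.coeFn_convL2 g] with t ht
    rw [ht]

end IsExpKernel

/-- `E` is the group on the unstable subspace of an exponential dichotomy of the semigroup `G`,
extended by zero to the stable subspace. -/
structure IsUnstableFlow (G E : ℝ → H →L[ℝ] H) (C ε : ℝ) : Prop where
  pos : 0 < ε
  left : ∀ t h : ℝ, 0 ≤ h → (G h).comp (E t) = E (t + h)
  right : ∀ t h : ℝ, 0 ≤ h → (E t).comp (G h) = E (t + h)
  bound_neg : ∀ t : ℝ, t ≤ 0 → ‖E t‖ ≤ C * Real.exp (ε * t)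
  bound_pos : ∀ t : ℝ, 0 ≤ t → ‖G t - E t‖ ≤ C * Real.exp (-ε * t)

/-- Green's operator function of a semigroup with exponential dichotomy. -/
noncomputable def green (G E : ℝ → H →L[ℝ] H) (t : ℝ) : H →L[ℝ] H :=
  (if 0 ≤ t then G t else 0) - E t

theorem green_of_nonneg {G E : ℝ → H →L[ℝ] H} {t : ℝ} (ht : 0 ≤ t) :
    green G E t = G t - E t := by simp [green, ht]

theorem green_of_neg {G E : ℝ → H →L[ℝ] H} {t : ℝ} (ht : t < 0) :
    green G E t = - E t := by simp [green, not_le.2 ht]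

/-- Green's function of the adjoint semigroup in reversed time. -/
noncomputable def greenRev [CompleteSpace H] (G E : ℝ → H →L[ℝ] H) (t : ℝ) : H →L[ℝ] H :=
  (green G E (-t)).adjoint

namespace IsUnstableFlow

variable {G E : ℝ → H →L[ℝ] H} {C ε : ℝ}

theorem adjoint [CompleteSpace H] (hE : IsUnstableFlow G E C ε) :
    IsUnstableFlow (fun t => (G t).adjoint) (fun t => (E t).adjoint) C ε where
  pos := hE.pos
  left t h hh := by rw [← ContinuousLinearMap.adjoint_comp, hE.right t h hh]
  right t h hh := by rw [← ContinuousLinearMap.adjoint_comp, hE.left t h hh]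
  bound_neg t ht := by rw [LinearIsometryEquiv.norm_map]; exact hE.bound_neg t ht
  bound_pos t ht := by
    rw [← map_sub, LinearIsometryEquiv.norm_map]; exact hE.bound_pos t ht

theorem green_adjoint [CompleteSpace H] (G E : ℝ → H →L[ℝ] H) (t : ℝ) :
    green (fun t => (G t).adjoint) (fun t => (E t).adjoint) t = (green G E t).adjoint := by
  by_cases ht : 0 ≤ t
  · rw [green_of_nonneg ht, green_of_nonneg ht, map_sub]
  · rw [green_of_neg (not_le.1 ht), green_of_neg (not_le.1 ht), map_neg]

variable [CompleteSpace H]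

/-- Near time t one has E(s) = E(t - 1) G(s - t + 1), which reduces the claim to the joint
continuity of the semigroup. -/
theorem continuous_uncurry (hE : IsUnstableFlow G E C ε) (hG : IsC0Semigroup G) :
    Continuous fun p : ℝ × H => E p.1 p.2 := by
  rw [continuous_iff_continuousAt]
  rintro ⟨t, x⟩
  have h1 : Continuous fun p : ℝ × H => E (t - 1) (G (max (p.1 - (t - 1)) 0) p.2) :=
    (E (t - 1)).continuous.comp (hG.continuous_uncurry.comp
      (((continuous_fst.sub continuous_const)).prodMk continuous_snd))
  refine h1.continuousAt.congr ?_
  have : ∀ᶠ p : ℝ × H in 𝓝 (t, x), t - 1 < p.1 :=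
    continuousAt_const.eventually_lt continuous_fst.continuousAt (by simp)
  filter_upwards [this] with p hp
  have h0 : 0 ≤ p.1 - (t - 1) := by linarith
  rw [max_eq_left h0, ← ContinuousLinearMap.comp_apply, hE.right _ _ h0]
  congr 2
  ring

theorem isExpKernel_green (hE : IsUnstableFlow G E C ε) (hG : IsC0Semigroup G) :
    IsExpKernel (green G E) C ε where
  pos := hE.pos
  bound t := by
    rcases le_or_gt 0 t with ht | ht
    · rw [green_of_nonneg ht, abs_of_nonneg ht]
      exact hE.bound_pos t ht
    · rw [green_of_neg ht, norm_neg, abs_of_neg ht]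
      simpa using hE.bound_neg t ht.le
  branches := by
    have h1 := hE.continuous_uncurry hG
    refine ⟨Ici 0, fun p => G (max p.1 0) p.2 - E p.1 p.2, fun p => - E p.1 p.2,
      measurableSet_Ici, hG.continuous_uncurry.sub h1, h1.neg, fun t ht x => ?_, fun t ht x => ?_⟩
    · rw [mem_Ici] at ht
      simp [green_of_nonneg ht, max_eq_left ht]
    · rw [mem_Ici, not_le] at ht
      simp [green_of_neg ht]

theorem isExpKernel_greenRev (hE : IsUnstableFlow G E C ε) (hG : IsC0Semigroup G) :
    IsExpKernel (greenRev G E) C ε := by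
  have := (hE.adjoint.isExpKernel_green hG.adjoint).neg
  simp only [green_adjoint] at this
  exact this

omit [CompleteSpace H] in
-- The `E` terms cancel by the flow law, so only the times at which exactly one of the two semigroup
-- branches is active remain. The interval is open at `s` because `green` takes the forward branch
-- at zero.
theorem green_sub (hE : IsUnstableFlow G E C ε) (hG : IsC0Semigroup G) {s t : ℝ} (hst : s ≤ t)
    (θ : ℝ) (x : H) : green G E (t - θ) x - G (t - s) (green G E (s - θ) x) =
      (Ioc s t).indicator (fun θ => G (t - θ) x) θ := by
  have hEl : G (t - s) (E (s - θ) x) = E (t - θ) x := by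
    rw [← ContinuousLinearMap.comp_apply, hE.left _ _ (by linarith)]
    congr 2; ring
  by_cases h1 : s < θ
  · rw [green_of_neg (by linarith : s - θ < 0)]
    by_cases h2 : θ ≤ t
    · rw [green_of_nonneg (by linarith), indicator_of_mem (by exact ⟨h1, h2⟩)]
      simp [hEl]
    · rw [green_of_neg (by linarith), indicator_of_notMem (fun h => h2 h.2)]
      simp [hEl]
  · rw [not_lt] at h1
    have hGl : G (t - s) (G (s - θ) x) = G (t - θ) x := by
      rw [← ContinuousLinearMap.comp_apply, ← hG.map_add _ _ (by linarith) (by linarith)]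
      congr 2; ring
    rw [green_of_nonneg (by linarith), green_of_nonneg (by linarith),
      indicator_of_notMem (fun h => absurd h.1 (not_lt.2 h1))]
    simp [hEl, hGl]

/-- Convolution with Green's function gives mild solutions. -/
theorem conv_green_mild (hE : IsUnstableFlow G E C ε) (hG : IsC0Semigroup G) {f : ℝ → H}
    (hf : MemLp f 2) {s t : ℝ} (hst : s ≤ t) :
    IntervalIntegrable (fun θ => G (t - θ) (f θ)) volume s t ∧
    kernelConv (green G E) f t =
      G (t - s) (kernelConv (green G E) f s) + ∫ θ in s..t, G (t - θ) (f θ) := by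
  have hk := hE.isExpKernel_green hG
  have h1 := hk.integrable_conv hf t
  have h2 := (G (t - s)).integrable_comp (hk.integrable_conv hf s)
  have e : ∀ θ, green G E (t - θ) (f θ) - G (t - s) (green G E (s - θ) (f θ)) =
      (Ioc s t).indicator (fun θ => G (t - θ) (f θ)) θ := fun θ => by
    rw [hE.green_sub hG hst θ (f θ)]
    by_cases h : θ ∈ Ioc s t <;> simp [h]
  have h3 := h1.sub h2
  have h4 : Integrable ((Ioc s t).indicator fun θ => G (t - θ) (f θ)) :=
    h3.congr (Eventually.of_forall e)
  refine ⟨(intervalIntegrable_iff_integrableOn_Ioc_of_le hst).2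
    ((integrable_indicator_iff measurableSet_Ioc).1 h4), ?_⟩
  rw [intervalIntegral.integral_of_le hst, ← integral_indicator measurableSet_Ioc]
  simp only [kernelConv]
  rw [← ContinuousLinearMap.integral_comp_comm _ (hk.integrable_conv hf s), ← sub_eq_iff_eq_add',
    ← integral_sub h1 h2]
  exact integral_congr_ae (Eventually.of_forall e)

/-- The forward identity for the adjoint semigroup, with time reversed; the reversal exchanges the
open and the closed end. -/
theorem greenRev_sub (hE : IsUnstableFlow G E C ε) (hG : IsC0Semigroup G) {s t : ℝ} (hst : s ≤ t)
    (θ : ℝ) (x : H) :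
    greenRev G E (s - θ) x - (G (t - s)).adjoint (greenRev G E (t - θ) x) =
      (Ico s t).indicator (fun θ => (G (θ - s)).adjoint x) θ := by
  have h := hE.adjoint.green_sub hG.adjoint (s := -t) (t := -s) (by linarith) (-θ) x
  simp only [green_adjoint] at h
  rw [greenRev, greenRev, show -(s - θ) = -s - -θ by ring, show -(t - θ) = -t - -θ by ring]
  rw [show -s - -t = t - s by ring] at h
  rw [h]
  have hm : -θ ∈ Ioc (-t) (-s) ↔ θ ∈ Ico s t := by
    simp only [mem_Ioc, mem_Ico, neg_lt_neg_iff, neg_le_neg_iff]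
    exact and_comm
  by_cases hθ : θ ∈ Ico s t
  · rw [indicator_of_mem (hm.2 hθ), indicator_of_mem hθ]
    congr 3; ring
  · rw [indicator_of_notMem (fun h => hθ (hm.1 h)), indicator_of_notMem hθ]

theorem conv_greenRev_mild (hE : IsUnstableFlow G E C ε) (hG : IsC0Semigroup G) {f : ℝ → H}
    (hf : MemLp f 2) {s t : ℝ} (hst : s ≤ t) :
    IntervalIntegrable (fun θ => (G (θ - s)).adjoint (f θ)) volume s t ∧
    kernelConv (greenRev G E) f s = (G (t - s)).adjoint (kernelConv (greenRev G E) f t) +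
      ∫ θ in s..t, (G (θ - s)).adjoint (f θ) := by
  have hk := hE.isExpKernel_greenRev hG
  have h1 := hk.integrable_conv hf s
  have h2 := (G (t - s)).adjoint.integrable_comp (hk.integrable_conv hf t)
  have e : ∀ θ, greenRev G E (s - θ) (f θ) - (G (t - s)).adjoint (greenRev G E (t - θ) (f θ)) =
      (Ico s t).indicator (fun θ => (G (θ - s)).adjoint (f θ)) θ := fun θ => by
    rw [hE.greenRev_sub hG hst θ (f θ)]
    by_cases h : θ ∈ Ico s t <;> simp [h]
  have h3 := h1.sub h2
  have h4 : Integrable ((Ico s t).indicator fun θ => (G (θ - s)).adjoint (f θ)) :=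
    h3.congr (Eventually.of_forall e)
  have h5 := (integrable_indicator_iff measurableSet_Ico).1 h4
  refine ⟨(intervalIntegrable_iff_integrableOn_Ioc_of_le hst).2
    (h5.congr_set_ae Ico_ae_eq_Ioc.symm), ?_⟩
  rw [intervalIntegral.integral_of_le hst, ← integral_Ico_eq_integral_Ioc,
    ← integral_indicator measurableSet_Ico]
  simp only [kernelConv]
  rw [← ContinuousLinearMap.integral_comp_comm _ (hk.integrable_conv hf t), ← sub_eq_iff_eq_add',
    ← integral_sub h1 h2]
  exact integral_congr_ae (Eventually.of_forall e)

end IsUnstableFlow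

/-- The flow is G(t)P for t ≥ 0, with P the projection onto the unstable subspace along the stable
one; for t < 0 the inverse of G(-t) on the unstable subspace is composed with P. -/
theorem HasExpDichotomy.exists_unstableFlow [CompleteSpace H] {G : ℝ → H →L[ℝ] H} {j : ℕ}
    (hd : HasExpDichotomy G j) (hG : IsC0Semigroup G) :
    ∃ (E : ℝ → H →L[ℝ] H) (C ε : ℝ) (Hu : Submodule ℝ H), FiniteDimensional ℝ Hu ∧
      Module.finrank ℝ Hu = j ∧ IsUnstableFlow G E C ε ∧ ∀ t x, E t x ∈ Hu := by
  obtain ⟨Hs, Hu, hs, hu, hc, hfd, hj, hinv, hbij, M, ε, hM, hε, hbs, hbu⟩ := hd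
  set π : H →L[ℝ] Hu := Hu.projectionOntoL Hs
    (Submodule.IsCompl.isTopCompl_of_isClosed hc.symm hu hs) with hπ
  set P : H →L[ℝ] H := Hu.subtypeL.comp π with hP
  have hPu : ∀ x ∈ Hu, P x = x := fun x hx => by
    have := Submodule.projectionOntoL_apply_left
      (Submodule.IsCompl.isTopCompl_of_isClosed hc.symm hu hs) ⟨x, hx⟩
    simp only [hP, hπ, ContinuousLinearMap.comp_apply, Submodule.subtypeL_apply]
    exact congrArg Subtype.val this
  have hPs : ∀ x ∈ Hs, P x = 0 := fun x hx => by
    have := (Submodule.projectionOntoL_apply_eq_zero_iff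
      (Submodule.IsCompl.isTopCompl_of_isClosed hc.symm hu hs) (x := x)).2 hx
    simp only [hP, hπ, ContinuousLinearMap.comp_apply, Submodule.subtypeL_apply]
    exact congrArg Subtype.val this
  have hPm : ∀ x, P x ∈ Hu := fun x => (π x).2
  have hdec : ∀ x, x - P x ∈ Hs := fun x => by
    obtain ⟨y, hy, z, hz, rfl⟩ := Submodule.mem_sup.1
      (show x ∈ Hs ⊔ Hu by rw [hc.sup_eq_top]; trivial)
    rw [map_add, hPs y hy, hPu z hz]
    simpa using hy
  have hcomm : ∀ t, 0 ≤ t → ∀ x, P (G t x) = G t (P x) := fun t ht x => by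
    have : G t x = G t (x - P x) + G t (P x) := by rw [← map_add]; simp
    rw [this, map_add, hPs _ (hinv t ht (hdec x)), hPu _ ((hbij t ht).mapsTo (hPm x)), zero_add]
  have hex : ∀ t : ℝ, ∃ R : H →L[ℝ] H, (∀ x, R x ∈ Hu) ∧
      ∀ x, ∀ τ, 0 ≤ τ → 0 ≤ t + τ → G τ (R x) = G (t + τ) (P x) := by
    intro t
    rcases le_total 0 t with ht | ht
    · refine ⟨(G t).comp P, fun x => (hbij t ht).mapsTo (hPm x), fun x τ hτ _ => ?_⟩
      rw [add_comm, hG.map_add τ t hτ ht]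
      rfl
    · have ht' : 0 ≤ -t := by linarith
      let g : Hu →ₗ[ℝ] Hu := (G (-t)).toLinearMap.restrict (hbij (-t) ht').mapsTo
      have hg : ∀ x : Hu, (g x : H) = G (-t) x := fun x => rfl
      have hgb : Function.Bijective g := by
        constructor
        · intro x y hxy
          exact Subtype.ext ((hbij (-t) ht').injOn x.2 y.2 (by rw [← hg, ← hg, hxy]))
        · intro y
          obtain ⟨x, hx, hxy⟩ := (hbij (-t) ht').surjOn y.2
          exact ⟨⟨x, hx⟩, Subtype.ext hxy⟩
      let e := LinearEquiv.ofBijective g hgb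
      have he : ∀ y : Hu, G (-t) (e.symm y : H) = y := fun y => by
        rw [← hg]
        exact congrArg Subtype.val (e.apply_symm_apply y)
      refine ⟨Hu.subtypeL.comp (e.symm.toLinearMap.toContinuousLinearMap.comp π),
        fun x => (e.symm (π x)).2, fun x τ hτ hτt => ?_⟩
      have hτ' : τ = (t + τ) + (-t) := by ring
      rw [hτ', hG.map_add (t + τ) (-t) hτt ht']
      have : t + (t + τ + -t) = t + τ := by ring
      rw [this]
      exact congrArg (G (t + τ)) (he (π x))
  choose E hEm hE using hex
  have hinj : ∀ τ, 0 ≤ τ → ∀ x ∈ Hu, ∀ y ∈ Hu, G τ x = G τ y → x = y :=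
    fun τ hτ x hx y hy h => (hbij τ hτ).injOn hx hy h
  refine ⟨E, M * ‖P‖ + M * ‖ContinuousLinearMap.id ℝ H - P‖, ε, Hu, hfd, hj, ⟨hε, ?_, ?_, ?_, ?_⟩,
    hEm⟩
  · intro t h hh
    ext x
    -- The flow law is checked after applying G(τ), with τ so large that all times involved are
    -- nonnegative.
    have hτ : 0 ≤ |t| + |t + h| := by positivity
    have hτ1 : 0 ≤ t + h + (|t| + |t + h|) := by
      have := neg_abs_le (t + h); have := abs_nonneg t; linarith
    refine hinj (|t| + |t + h|) hτ _ ((hbij h hh).mapsTo (hEm t x)) _ (hEm (t + h) x) ?_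
    rw [hE (t + h) x _ hτ hτ1, ← ContinuousLinearMap.comp_apply, ← hG.map_add _ _ hτ hh,
      hE t x _ (by linarith) (by linarith)]
    congr 2; ring
  · intro t h hh
    ext x
    have hτ : 0 ≤ |t| := abs_nonneg t
    have hτ1 : 0 ≤ t + |t| := by have := neg_abs_le t; linarith
    refine hinj |t| hτ _ (hEm t _) _ (hEm (t + h) x) ?_
    change G |t| (E t (G h x)) = _
    rw [hE t _ _ hτ hτ1, hE (t + h) x _ hτ (by linarith),
      hcomm h hh, ← ContinuousLinearMap.comp_apply, ← hG.map_add _ _ hτ1 hh]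
    congr 2; ring
  · intro t ht
    refine ContinuousLinearMap.opNorm_le_bound _ (by positivity) fun x => ?_
    have h1 := hbu (-t) (by linarith) _ (hEm t x)
    rw [hE t x (-t) (by linarith) (by linarith), add_neg_cancel, hG.map_zero] at h1
    have h2 : ‖(ContinuousLinearMap.id ℝ H) (P x)‖ ≤ ‖P‖ * ‖x‖ := P.le_opNorm x
    calc _ ≤ M * Real.exp (ε * t) * (‖P‖ * ‖x‖) := by
          refine (h1.trans_eq (by ring_nf)).trans (mul_le_mul_of_nonneg_left h2 (by positivity))
      _ = M * ‖P‖ * Real.exp (ε * t) * ‖x‖ := by ring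
      _ ≤ _ := by
        gcongr
        have : 0 ≤ M * ‖ContinuousLinearMap.id ℝ H - P‖ := by positivity
        linarith
  · intro t ht
    refine ContinuousLinearMap.opNorm_le_bound _ (by positivity) fun x => ?_
    have h1 := hbs t ht _ (hdec x)
    have h0 := hE t x 0 le_rfl (by linarith)
    rw [hG.map_zero, add_zero, ContinuousLinearMap.id_apply] at h0
    have h2 : ‖x - P x‖ ≤ ‖ContinuousLinearMap.id ℝ H - P‖ * ‖x‖ :=
      (ContinuousLinearMap.id ℝ H - P).le_opNorm x
    calc ‖(G t - E t) x‖ = ‖G t (x - P x)‖ := by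
          rw [sub_apply, h0, map_sub]
      _ ≤ M * Real.exp (-ε * t) * (‖ContinuousLinearMap.id ℝ H - P‖ * ‖x‖) :=
          h1.trans (mul_le_mul_of_nonneg_left h2 (by positivity))
      _ = M * ‖ContinuousLinearMap.id ℝ H - P‖ * Real.exp (-ε * t) * ‖x‖ := by ring
      _ ≤ _ := by
        gcongr
        have : 0 ≤ M * ‖P‖ := by positivity
        linarith

end Green


/-! ### From positivity in frequency to positivity in time -/

section Positivity

theorem integral_gaussian_mul_cos (τ : ℝ) :
    ∫ ω : ℝ, Real.exp (-ω ^ 2) * Real.cos (ω * τ) = √Real.pi * Real.exp (-τ ^ 2 / 4) := by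
  have h := fourierIntegral_gaussian (b := 1) (by simp) (τ : ℂ)
  have e : ∀ x : ℝ, Complex.exp (Complex.I * τ * x) * Complex.exp (-1 * (x : ℂ) ^ 2) =
      ((Real.exp (-x ^ 2) * Real.cos (x * τ) : ℝ) : ℂ) +
        ((Real.exp (-x ^ 2) * Real.sin (x * τ) : ℝ) : ℂ) * Complex.I := fun x => by
    rw [show Complex.I * τ * x = ((x * τ : ℝ) : ℂ) * Complex.I by push_cast; ring,
      Complex.exp_mul_I, show -1 * (x : ℂ) ^ 2 = ((-x ^ 2 : ℝ) : ℂ) by push_cast; ring]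
    push_cast
    ring
  have hint : Integrable fun x : ℝ => Real.exp (-x ^ 2) := by
    simpa using integrable_exp_neg_mul_sq (b := 1) one_pos
  have h1 : Integrable fun x : ℝ => Real.exp (-x ^ 2) * Real.cos (x * τ) :=
    hint.mono' (by fun_prop) (Eventually.of_forall fun x => by
      rw [norm_mul, Real.norm_of_nonneg (Real.exp_nonneg _)]
      exact mul_le_of_le_one_right (Real.exp_nonneg _) (Real.abs_cos_le_one _))
  have h2 : Integrable fun x : ℝ => Real.exp (-x ^ 2) * Real.sin (x * τ) :=
    hint.mono' (by fun_prop) (Eventually.of_forall fun x => by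
      rw [norm_mul, Real.norm_of_nonneg (Real.exp_nonneg _)]
      exact mul_le_of_le_one_right (Real.exp_nonneg _) (Real.abs_sin_le_one _))
  simp_rw [e] at h
  rw [integral_add h1.ofReal (h2.ofReal.mul_const _), integral_mul_const, integral_complex_ofReal,
    integral_complex_ofReal] at h
  have h3 : ((Real.pi : ℂ) / 1) ^ (1 / 2 : ℂ) * Complex.exp (-(τ : ℂ) ^ 2 / (4 * 1)) =
      ((√Real.pi * Real.exp (-τ ^ 2 / 4) : ℝ) : ℂ) := by
    rw [div_one, Real.sqrt_eq_rpow]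
    push_cast
    rw [Complex.ofReal_cpow Real.pi_pos.le]
    push_cast
    norm_num
  rw [h3] at h
  have := congrArg Complex.re h
  rwa [Complex.add_re, Complex.re_ofReal_mul, Complex.I_re, mul_zero, add_zero,
    Complex.ofReal_re, Complex.ofReal_re] at this

variable {E : Type*} [NormedAddCommGroup E] [NormedSpace ℝ E]

/-- The sum |t + τ| + |t| dominates both |t| and |τ|; half of it is spent on each, which yields a
majorant integrable in both variables. -/
theorem exp_neg_abs_add_le {ε : ℝ} (hε : 0 < ε) (t τ : ℝ) :
    Real.exp (-ε * |t + τ|) * Real.exp (-ε * |t|) ≤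
      Real.exp (-(ε / 2) * |t|) * Real.exp (-(ε / 2) * |τ|) := by
  rw [← Real.exp_add, ← Real.exp_add, Real.exp_le_exp]
  have h1 : |τ| ≤ |t + τ| + |t| := by
    have := abs_sub (t + τ) t
    simpa using this
  have h2 := abs_nonneg (t + τ)
  nlinarith

/-- A quadratic form that is nonnegative on all values of the Fourier transform of `z` has
nonnegative integral along `z`. -/
theorem integral_quadratic_nonneg [CompleteSpace E] (b : E →L[ℝ] E →L[ℝ] ℝ) {z : ℝ → E}
    (hz : Continuous z) {D ε : ℝ} (hε : 0 < ε) (hD : ∀ t, ‖z t‖ ≤ D * Real.exp (-ε * |t|))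
    (hb : ∀ ω : ℝ, 0 ≤ b (∫ t, Real.cos (ω * t) • z t) (∫ t, Real.cos (ω * t) • z t) +
      b (∫ t, Real.sin (ω * t) • z t) (∫ t, Real.sin (ω * t) • z t)) :
    0 ≤ ∫ t, b (z t) (z t) := by
  have hD0 : 0 ≤ D := by simpa using (norm_nonneg _).trans (hD 0)
  have hbz : ∀ t τ, ‖b (z (t + τ)) (z t)‖ ≤
      ‖b‖ * D ^ 2 * (Real.exp (-(ε / 2) * |t|) * Real.exp (-(ε / 2) * |τ|)) := fun t τ => by
    calc _ ≤ ‖b‖ * ‖z (t + τ)‖ * ‖z t‖ := b.le_opNorm₂ _ _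
      _ ≤ ‖b‖ * (D * Real.exp (-ε * |t + τ|)) * (D * Real.exp (-ε * |t|)) := by
        gcongr
        · exact hD _
        · exact hD _
      _ = ‖b‖ * D ^ 2 * (Real.exp (-ε * |t + τ|) * Real.exp (-ε * |t|)) := by ring
      _ ≤ _ := mul_le_mul_of_nonneg_left (exp_neg_abs_add_le hε t τ) (by positivity)
  have hε2 : Integrable fun t : ℝ => Real.exp (-(ε / 2) * |t|) :=
    integrable_exp_neg_mul_abs (half_pos hε)
  have hbc : Continuous fun p : ℝ × ℝ => b (z (p.1 + p.2)) (z p.1) := by fun_prop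
  -- The autocorrelation of `z`. Its value at zero is the integral in question, and by the addition
  -- formula the hypothesis says that its cosine transform is nonnegative. No Plancherel theorem for
  -- `z` is needed.
  set φ : ℝ → ℝ := fun τ => ∫ t, b (z (t + τ)) (z t) with hφ
  have hφc : Continuous φ := by
    refine continuous_of_dominated (bound := fun t => ‖b‖ * D ^ 2 * Real.exp (-(ε / 2) * |t|))
      (fun τ => ?_) (fun τ => Eventually.of_forall fun t => ?_) (hε2.const_mul _)
      (Eventually.of_forall fun t => ?_)
    · exact (hbc.comp (continuous_id.prodMk continuous_const)).aestronglyMeasurable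
    · refine (hbz t τ).trans ?_
      gcongr
      refine mul_le_of_le_one_right (Real.exp_nonneg _) (Real.exp_le_one_iff.2 ?_)
      have := abs_nonneg τ
      nlinarith
    · exact hbc.comp (continuous_const.prodMk continuous_id)
  set c := ∫ t : ℝ, Real.exp (-(ε / 2) * |t|) with hc
  have hφb : ∀ τ, ‖φ τ‖ ≤ ‖b‖ * D ^ 2 * c * Real.exp (-(ε / 2) * |τ|) := fun τ => by
    refine (norm_integral_le_integral_norm _).trans ?_
    refine (integral_mono_of_nonneg (Eventually.of_forall fun s => norm_nonneg _)
      ((hε2.mul_const _).const_mul _) (Eventually.of_forall fun t => hbz t τ)).trans_eq ?_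
    rw [integral_const_mul, integral_mul_const]
    ring
  have hφi : Integrable φ := (hε2.const_mul _).mono' hφc.aestronglyMeasurable
    (Eventually.of_forall hφb)
  have hzi : ∀ ψ : ℝ → ℝ, Continuous ψ → (∀ t, |ψ t| ≤ 1) → Integrable fun t => ψ t • z t :=
    fun ψ hψ h1 => ((integrable_exp_neg_mul_abs hε).const_mul D).mono'
      (hψ.smul hz).aestronglyMeasurable (Eventually.of_forall fun t => by
        rw [norm_smul]
        exact (mul_le_of_le_one_left (norm_nonneg _) (h1 t)).trans (hD t))
  have hsq : ∀ ψ : ℝ → ℝ, Continuous ψ → (∀ t, |ψ t| ≤ 1) →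
      b (∫ t, ψ t • z t) (∫ t, ψ t • z t) = ∫ t, ∫ s, ψ s * ψ t * b (z s) (z t) := by
    intro ψ hψ h1
    have hi := hzi ψ hψ h1
    rw [← ContinuousLinearMap.integral_comp_comm _ hi]
    refine integral_congr_ae (Eventually.of_forall fun t => ?_)
    have := (b.flip (ψ t • z t)).integral_comp_comm hi
    simp only [ContinuousLinearMap.flip_apply] at this
    simp only
    rw [← this]
    refine integral_congr_ae (Eventually.of_forall fun s => ?_)
    simp only [map_smul, smul_apply, smul_eq_mul]
    ring
  have hX : ∀ ω : ℝ, 0 ≤ ∫ τ, Real.cos (ω * τ) * φ τ := by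
    intro ω
    refine (hb ω).trans_eq ?_
    have hcos : ∀ t : ℝ, |Real.cos (ω * t)| ≤ 1 := fun t => Real.abs_cos_le_one _
    have hsin : ∀ t : ℝ, |Real.sin (ω * t)| ≤ 1 := fun t => Real.abs_sin_le_one _
    rw [hsq _ (by fun_prop) hcos, hsq _ (by fun_prop) hsin]
    have hI : ∀ ψ : ℝ → ℝ, Continuous ψ → (∀ t, |ψ t| ≤ 1) →
        Integrable (fun p : ℝ × ℝ => ψ (p.1 + p.2) * ψ p.1 * b (z (p.1 + p.2)) (z p.1))
          (volume.prod volume) := fun ψ hψ h1 => by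
      refine ((hε2.mul_prod hε2).const_mul (‖b‖ * D ^ 2)).mono' ?_
        (Eventually.of_forall fun p => ?_)
      · exact (Continuous.mul (by fun_prop) hbc).aestronglyMeasurable
      · rw [norm_mul, norm_mul]
        refine (mul_le_of_le_one_left (norm_nonneg _) ?_).trans (hbz p.1 p.2)
        exact mul_le_one₀ (h1 _) (norm_nonneg _) (h1 _)
    have hshift : ∀ ψ : ℝ → ℝ, ∫ t, ∫ s, ψ s * ψ t * b (z s) (z t) =
        ∫ t, ∫ τ, ψ (t + τ) * ψ t * b (z (t + τ)) (z t) := fun ψ => by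
      refine integral_congr_ae (Eventually.of_forall fun t => ?_)
      exact (integral_add_left_eq_self (fun s => ψ s * ψ t * b (z s) (z t)) t).symm
    have hsw : ∀ ψ : ℝ → ℝ, Continuous ψ → (∀ t, |ψ t| ≤ 1) →
        ∫ t, ∫ s, ψ s * ψ t * b (z s) (z t) =
          ∫ τ, ∫ t, ψ (t + τ) * ψ t * b (z (t + τ)) (z t) := fun ψ hψ h1 => by
      rw [hshift]
      exact integral_integral_swap (hI ψ hψ h1)
    rw [hsw _ (by fun_prop) hcos, hsw _ (by fun_prop) hsin,
      ← integral_add (hI _ (by fun_prop) hcos).integral_prod_right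
        (hI _ (by fun_prop) hsin).integral_prod_right]
    refine integral_congr_ae ?_
    filter_upwards [(hI _ (by fun_prop) hcos).prod_left_ae, (hI _ (by fun_prop) hsin).prod_left_ae]
      with τ h1 h2
    rw [← integral_add h1 h2, hφ, ← integral_const_mul]
    refine integral_congr_ae (Eventually.of_forall fun t => ?_)
    simp only
    have : Real.cos (ω * τ) = Real.cos (ω * (t + τ)) * Real.cos (ω * t) +
        Real.sin (ω * (t + τ)) * Real.sin (ω * t) := by
      rw [← Real.cos_sub]; congr 1; ring
    rw [this]
    ring
  have hgi : Integrable fun x : ℝ => Real.exp (-x ^ 2) := by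
    simpa using integrable_exp_neg_mul_sq (b := 1) one_pos
  -- The cosine transform at frequency `n * ω` is integrated against e^{-ω²}; after Fubini, `φ` is
  -- tested against a Gaussian of width of order 1/n.
  have hk : ∀ n : ℝ, 0 ≤ ∫ τ, φ τ * (√Real.pi * Real.exp (-(n * τ) ^ 2 / 4)) := by
    intro n
    have h1 : 0 ≤ ∫ ω : ℝ, ∫ τ, Real.exp (-ω ^ 2) * (Real.cos (n * ω * τ) * φ τ) := by
      refine integral_nonneg fun ω => ?_
      simp only [Pi.zero_apply]
      rw [integral_const_mul]
      exact mul_nonneg (Real.exp_nonneg _) (hX _)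
    rw [integral_integral_swap] at h1
    · refine h1.trans_eq (integral_congr_ae (Eventually.of_forall fun τ => ?_))
      simp only
      rw [← integral_gaussian_mul_cos, ← integral_const_mul]
      refine integral_congr_ae (Eventually.of_forall fun ω => ?_)
      simp only
      rw [show n * ω * τ = ω * (n * τ) by ring]
      ring
    · refine (hgi.mul_prod hφi.norm).mono' ?_ (Eventually.of_forall fun p => ?_)
      · exact Continuous.aestronglyMeasurable (by fun_prop)
      · simp only [Function.uncurry]
        rw [norm_mul, norm_mul, Real.norm_of_nonneg (Real.exp_nonneg _)]
        gcongr
        exact mul_le_of_le_one_left (norm_nonneg _) (Real.abs_cos_le_one _)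
  have hk2 : ∀ n : ℕ, 0 ≤ ∫ τ, φ ((n + 1 : ℝ)⁻¹ * τ) * (√Real.pi * Real.exp (-τ ^ 2 / 4)) := by
    intro n
    have hn : (0 : ℝ) < n + 1 := by positivity
    have := Measure.integral_comp_mul_left
      (fun τ => φ ((n + 1 : ℝ)⁻¹ * τ) * (√Real.pi * Real.exp (-τ ^ 2 / 4))) (n + 1 : ℝ)
    simp only [inv_mul_cancel_left₀ hn.ne'] at this
    have h2 := hk (n + 1)
    rw [this, smul_eq_mul, abs_of_pos (by positivity)] at h2
    exact nonneg_of_mul_nonneg_right h2 (by positivity)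
  have hgi4 : Integrable fun x : ℝ => √Real.pi * Real.exp (-x ^ 2 / 4) := by
    refine ((integrable_exp_neg_mul_sq (b := 1 / 4) (by norm_num)).const_mul √Real.pi).congr
      (Eventually.of_forall fun x => ?_)
    simp only
    congr 2
    ring
  -- Rescaled, the Gaussians concentrate `φ` at zero, so the limit is φ(0) times a positive
  -- constant.
  have hlim : Tendsto (fun n : ℕ => ∫ τ, φ ((n + 1 : ℝ)⁻¹ * τ) *
      (√Real.pi * Real.exp (-τ ^ 2 / 4))) atTop
      (𝓝 (∫ τ : ℝ, φ 0 * (√Real.pi * Real.exp (-τ ^ 2 / 4)))) := by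
    refine tendsto_integral_of_dominated_convergence
      (fun τ => ‖b‖ * D ^ 2 * c * (√Real.pi * Real.exp (-τ ^ 2 / 4))) (fun n => ?_)
      (hgi4.const_mul _) (fun n => Eventually.of_forall fun τ => ?_)
      (Eventually.of_forall fun τ => ?_)
    · exact Continuous.aestronglyMeasurable (by fun_prop)
    · rw [norm_mul, Real.norm_of_nonneg (show 0 ≤ √Real.pi * Real.exp (-τ ^ 2 / 4) by positivity)]
      gcongr
      refine (hφb _).trans (mul_le_of_le_one_right ?_ (Real.exp_le_one_iff.2 ?_))
      · have : 0 ≤ c := integral_nonneg fun t => Real.exp_nonneg _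
        positivity
      · have := abs_nonneg ((n + 1 : ℝ)⁻¹ * τ)
        nlinarith
    · refine Tendsto.mul_const _ ?_
      have h1 : Tendsto (fun n : ℕ => (n + 1 : ℝ)⁻¹ * τ) atTop (𝓝 (0 * τ)) := by
        refine Tendsto.mul_const _ ?_
        simpa only [one_div] using tendsto_one_div_add_atTop_nhds_zero_nat (𝕜 := ℝ)
      rw [zero_mul] at h1
      exact (hφc.tendsto 0).comp h1
  have h0 := ge_of_tendsto' hlim hk2
  rw [integral_const_mul] at h0
  have hpos : 0 < ∫ τ : ℝ, √Real.pi * Real.exp (-τ ^ 2 / 4) := by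
    rw [integral_pos_iff_support_of_nonneg (fun t => by positivity) hgi4]
    have : Function.support (fun τ : ℝ => √Real.pi * Real.exp (-τ ^ 2 / 4)) = univ := by
      refine Set.eq_univ_of_forall fun τ => ?_
      rw [Function.mem_support]
      have := Real.pi_pos
      positivity
    rw [this]
    simp
  have h1 := nonneg_of_mul_nonneg_left h0 hpos
  simpa [hφ] using h1

end Positivity


/-! ### The frequency condition and processes on the line -/

section Frequency

variable {H U : Type*} [NormedAddCommGroup H] [InnerProductSpace ℝ H] [CompleteSpace H]
  [NormedAddCommGroup U] [InnerProductSpace ℝ U] [CompleteSpace U]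

/-- Here t + h - θ and θ - t both stay in [0, h], so the joint continuity of (s, θ) ↦ G(s) f(θ) at
(0, t) keeps the integrand near f(t). -/
theorem IsC0Semigroup.tendsto_average {G : ℝ → H →L[ℝ] H} (hG : IsC0Semigroup G) {f : ℝ → H}
    (hf : Continuous f) (t : ℝ) :
    Tendsto (fun h : ℝ => h⁻¹ • ∫ θ in t..t + h, G (t + h - θ) (f θ)) (𝓝[>] 0) (𝓝 (f t)) := by
  have hq : Continuous fun p : ℝ × ℝ => G (max p.1 0) (f p.2) :=
    hG.continuous_uncurry.comp (continuous_fst.prodMk (hf.comp continuous_snd))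
  rw [Metric.tendsto_nhds]
  intro ε hε
  have h0 := Metric.tendsto_nhds.1 (hq.tendsto (0, t)) (ε / 2) (half_pos hε)
  obtain ⟨δ, hδ, hδ'⟩ := Metric.eventually_nhds_iff.1 h0
  filter_upwards [Ioo_mem_nhdsGT hδ] with h hh
  have hc : Continuous fun θ => G (max (t + h - θ) 0) (f θ) :=
    hq.comp ((continuous_const.sub continuous_id).prodMk continuous_id)
  have e1 : ∫ θ in t..t + h, G (t + h - θ) (f θ) = ∫ θ in t..t + h, G (max (t + h - θ) 0) (f θ) := by
    refine intervalIntegral.integral_congr fun θ hθ => ?_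
    rw [uIcc_of_le (by linarith [hh.1])] at hθ
    rw [max_eq_left (by linarith [hθ.2])]
  have e2 : h⁻¹ • (∫ θ in t..t + h, G (t + h - θ) (f θ)) - f t =
      h⁻¹ • ∫ θ in t..t + h, (G (max (t + h - θ) 0) (f θ) - f t) := by
    rw [intervalIntegral.integral_sub (hc.intervalIntegrable _ _) (by simp), e1, smul_sub]
    simp [smul_smul, inv_mul_cancel₀ hh.1.ne']
  rw [dist_eq_norm, e2, norm_smul, norm_inv, Real.norm_of_nonneg hh.1.le]
  have b1 : ‖∫ θ in t..t + h, (G (max (t + h - θ) 0) (f θ) - f t)‖ ≤ ε / 2 * |t + h - t| := by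
    refine intervalIntegral.norm_integral_le_of_norm_le_const fun θ hθ => ?_
    rw [uIoc_of_le (by linarith [hh.1])] at hθ
    have := hδ' (y := (t + h - θ, θ)) (by
      rw [Prod.dist_eq, max_lt_iff]
      constructor
      · simp only
        rw [Real.dist_eq, sub_zero, abs_of_nonneg (by linarith [hθ.2])]
        linarith [hθ.1, hh.2]
      · simp only
        rw [Real.dist_eq, abs_of_nonneg (by linarith [hθ.1])]
        linarith [hθ.2, hh.2])
    simp only [max_self, hG.map_zero, ContinuousLinearMap.id_apply] at this
    rw [dist_eq_norm] at this
    exact this.le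
  rw [add_sub_cancel_left, abs_of_pos hh.1] at b1
  calc _ ≤ h⁻¹ * (ε / 2 * h) := mul_le_mul_of_nonneg_left b1 (inv_nonneg.2 hh.1.le)
    _ = ε / 2 := by field_simp [hh.1.ne']
    _ < ε := by linarith

/-- Weighted time integrals of an integrable mild solution lie in the domain of the generator. -/
theorem IsGenerator.integral_mem_graph {A : H →ₗ.[ℝ] H} {G : ℝ → H →L[ℝ] H}
    (hA : IsGenerator A G) (hG : IsC0Semigroup G) {v f : ℝ → H} (hv : Continuous v)
    (hvi : Integrable v) (hf : Continuous f) (hfs : HasCompactSupport f)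
    (hmild : ∀ s t, s ≤ t → v t = G (t - s) (v s) + ∫ θ in s..t, G (t - θ) (f θ))
    {ψ ψ' : ℝ → ℝ} {c : ℝ} (hψ : ∀ t, HasDerivAt ψ (ψ' t) t) (hψ1 : ∀ t, |ψ t| ≤ 1)
    (hψc : ∀ t, |ψ' t| ≤ c) :
    ((∫ t, ψ t • v t), -(∫ t, ψ' t • v t) - ∫ t, ψ t • f t) ∈ A.graph := by
  rw [hA]
  have hψcont : Continuous ψ := continuous_iff_continuousAt.2 fun t => (hψ t).continuousAt
  have hlip : ∀ s t, |ψ s - ψ t| ≤ c * |s - t| := fun s t => by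
    have := convex_univ.norm_image_sub_le_of_norm_hasDerivWithin_le (f := ψ) (f' := ψ') (C := c)
      (fun x _ => (hψ x).hasDerivWithinAt) (fun x _ => hψc x) (mem_univ t) (mem_univ s)
    simpa using this
  -- By the mild formula G(h)v(t) = v(t + h) - r(h, t). In the difference quotient of ∫ ψv the shift
  -- then moves onto ψ, an integration by parts in which v need not be differentiable.
  set r : ℝ → ℝ → H := fun h t => ∫ θ in t..t + h, G (t + h - θ) (f θ) with hr
  have hrv : ∀ h, 0 ≤ h → ∀ t, r h t = v (t + h) - G h (v t) := fun h hh t => by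
    have := hmild t (t + h) (by linarith)
    rw [this, hr]
    simp
  have hsm : ∀ w : ℝ → H, Integrable w → Integrable fun t => ψ t • w t := fun w hw =>
    hw.norm.mono' (hψcont.aestronglyMeasurable.smul hw.aestronglyMeasurable)
      (Eventually.of_forall fun t => by
        rw [norm_smul]
        exact mul_le_of_le_one_left (norm_nonneg _) (hψ1 t))
  have key : ∀ h : ℝ, 0 < h → h⁻¹ • (G h (∫ t, ψ t • v t) - ∫ t, ψ t • v t) =
      (∫ t, (h⁻¹ * (ψ (t - h) - ψ t)) • v t) - ∫ t, ψ t • (h⁻¹ • r h t) := by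
    intro h hh
    have i1 : Integrable fun t => ψ t • v (t + h) := hsm _ (hvi.comp_add_right h)
    have i2 : Integrable fun t => ψ t • G h (v t) := hsm _ ((G h).integrable_comp hvi)
    have i3 : Integrable fun t => ψ (t - h) • v t := by
      simpa using i1.comp_sub_right h
    have e1 : G h (∫ t, ψ t • v t) = ∫ t, ψ t • G h (v t) := by
      rw [← ContinuousLinearMap.integral_comp_comm _ (hsm v hvi)]
      simp
    have e2 : ∫ t, ψ t • (h⁻¹ • r h t) =
        h⁻¹ • ((∫ t, ψ t • v (t + h)) - ∫ t, ψ t • G h (v t)) := by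
      rw [← integral_sub i1 i2, ← integral_smul]
      refine integral_congr_ae (Eventually.of_forall fun t => ?_)
      simp only
      rw [hrv h hh.le, ← smul_sub, smul_comm]
    have e3 : ∫ t, (h⁻¹ * (ψ (t - h) - ψ t)) • v t =
        h⁻¹ • ((∫ t, ψ (t - h) • v t) - ∫ t, ψ t • v t) := by
      rw [← integral_sub i3 (hsm v hvi), ← integral_smul]
      refine integral_congr_ae (Eventually.of_forall fun t => ?_)
      simp only
      rw [← sub_smul, smul_smul]
    have e4 : ∫ t, ψ (t - h) • v t = ∫ t, ψ t • v (t + h) := by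
      rw [← integral_sub_right_eq_self (fun t => ψ t • v (t + h)) h]
      simp
    rw [e1, e2, e3, e4, ← smul_sub]
    congr 1
    abel
  have l1 : Tendsto (fun h : ℝ => ∫ t, (h⁻¹ * (ψ (t - h) - ψ t)) • v t) (𝓝[>] 0)
      (𝓝 (∫ t, (-ψ' t) • v t)) := by
    refine tendsto_integral_filter_of_dominated_convergence (fun t => c * ‖v t‖)
      (Eventually.of_forall fun h => ?_) ?_ (hvi.norm.const_mul c) (Eventually.of_forall fun t => ?_)
    · exact Continuous.aestronglyMeasurable (by fun_prop)
    · filter_upwards [self_mem_nhdsWithin] with h (hh : 0 < h)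
      refine Eventually.of_forall fun t => ?_
      rw [norm_smul]
      gcongr
      rw [norm_mul, norm_inv, Real.norm_of_nonneg hh.le, Real.norm_eq_abs, inv_mul_le_iff₀ hh]
      have := hlip (t - h) t
      rw [show t - h - t = -h by ring, abs_neg, abs_of_pos hh] at this
      linarith
    · refine Tendsto.smul_const ?_ _
      have h1 : HasDerivAt (fun h : ℝ => ψ (t - h)) (-ψ' t) 0 := by
        have h2 : HasDerivAt ψ (ψ' t) (t - 0) := by simpa using hψ t
        exact h2.comp_const_sub t 0
      have h3 := hasDerivAt_iff_tendsto_slope_zero.1 h1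
      refine (h3.mono_left (nhdsWithin_mono 0 fun x hx => ne_of_gt hx)).congr fun h => ?_
      simp
  obtain ⟨D, hD⟩ := hfs.exists_bound_of_continuous hf
  obtain ⟨R, hR⟩ := hfs.isCompact.isBounded.subset_closedBall 0
  have hfR : ∀ θ, R < |θ| → f θ = 0 := fun θ hθ => by
    by_contra h
    have := hR (subset_tsupport f h)
    rw [mem_closedBall_zero_iff, Real.norm_eq_abs] at this
    linarith
  obtain ⟨M, hM0, hM⟩ := hG.exists_bound 1
  have hD0 : 0 ≤ D := (norm_nonneg _).trans (hD 0)
  have l2 : Tendsto (fun h : ℝ => ∫ t, ψ t • (h⁻¹ • r h t)) (𝓝[>] 0) (𝓝 (∫ t, ψ t • f t)) := by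
    refine tendsto_integral_filter_of_dominated_convergence
      -- For h < 1 the remainder at `t` sees `f` only on [t, t + 1], hence the interval enlarged by
      -- 1 on the left.
      ((Icc (-R - 1) R).indicator fun _ => M * D) ?_ ?_ ?_ (Eventually.of_forall fun t => ?_)
    · filter_upwards [self_mem_nhdsWithin] with h (hh : 0 < h)
      have : Continuous (r h) := by
        rw [show r h = fun t => v (t + h) - G h (v t) from funext (hrv h hh.le)]
        fun_prop
      exact Continuous.aestronglyMeasurable (by fun_prop)
    · filter_upwards [Ioo_mem_nhdsGT one_pos] with h hh
      refine Eventually.of_forall fun t => ?_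
      rw [norm_smul]
      refine (mul_le_of_le_one_left (norm_nonneg _) (hψ1 t)).trans ?_
      by_cases ht : t ∈ Icc (-R - 1) R
      · rw [indicator_of_mem ht, norm_smul, norm_inv, Real.norm_of_nonneg hh.1.le,
          inv_mul_le_iff₀ hh.1]
        have : ‖r h t‖ ≤ M * D * |t + h - t| := by
          refine intervalIntegral.norm_integral_le_of_norm_le_const fun θ hθ => ?_
          rw [uIoc_of_le (by linarith [hh.1])] at hθ
          refine ((G _).le_opNorm _).trans ?_
          gcongr
          · exact hM _ (by linarith [hθ.2]) (by linarith [hθ.1, hh.2])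
          · exact hD θ
        rw [add_sub_cancel_left, abs_of_pos hh.1] at this
        linarith
      · rw [indicator_of_notMem ht]
        have : r h t = ∫ θ in t..t + h, (0 : H) := by
          refine intervalIntegral.integral_congr fun θ hθ => ?_
          rw [uIcc_of_le (by linarith [hh.1])] at hθ
          rw [hfR θ, map_zero]
          by_contra hcon
          rw [not_lt, abs_le] at hcon
          exact ht ⟨by linarith [hcon.1, hθ.2, hh.2], by linarith [hcon.2, hθ.1]⟩
        rw [this]
        simp
    · exact (integrable_indicator_iff measurableSet_Icc).2 (integrableOn_const (by simp))
    · exact (hG.tendsto_average hf t).const_smul _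
  have l3 := l1.sub l2
  simp only [neg_smul, integral_neg] at l3
  refine l3.congr' ?_
  filter_upwards [self_mem_nhdsWithin] with h (hh : 0 < h)
  exact (key h hh).symm

/-- The bilinear form of `𝓕(v, ξ) - δ ‖ξ‖²`. -/
noncomputable def shiftedForm (F₁ : H →L[ℝ] H) (F₂ : H →L[ℝ] U) (F₃ : U →L[ℝ] U) (δ : ℝ) :
    (H × U) →L[ℝ] (H × U) →L[ℝ] ℝ :=
  LinearMap.mkContinuous₂
    -- Only diagonal values matter, so the cross term is left unsymmetrized.
    (LinearMap.mk₂ ℝ (fun x y : H × U => inner ℝ (F₁ x.1) y.1 + 2 * inner ℝ (F₂ x.1) y.2 +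
        inner ℝ (F₃ x.2) y.2 - δ * inner ℝ x.2 y.2)
      (fun x x' y => by simp only [Prod.fst_add, Prod.snd_add, map_add, inner_add_left]; ring)
      (fun c x y => by
        simp only [Prod.smul_fst, Prod.smul_snd, map_smul, real_inner_smul_left, smul_eq_mul]; ring)
      (fun x y y' => by simp only [Prod.fst_add, Prod.snd_add, inner_add_right]; ring)
      (fun c x y => by
        simp only [Prod.smul_fst, Prod.smul_snd, real_inner_smul_right, smul_eq_mul]; ring))
    (‖F₁‖ + 2 * ‖F₂‖ + ‖F₃‖ + |δ|) (fun x y => by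
      have hx1 := norm_fst_le x
      have hx2 := norm_snd_le x
      have hy1 := norm_fst_le y
      have hy2 := norm_snd_le y
      have h1 : |inner ℝ (F₁ x.1) y.1| ≤ ‖F₁‖ * ‖x‖ * ‖y‖ :=
        (abs_real_inner_le_norm _ _).trans (by
          gcongr; exact (F₁.le_opNorm _).trans (by gcongr))
      have h2 : |inner ℝ (F₂ x.1) y.2| ≤ ‖F₂‖ * ‖x‖ * ‖y‖ :=
        (abs_real_inner_le_norm _ _).trans (by
          gcongr; exact (F₂.le_opNorm _).trans (by gcongr))
      have h3 : |inner ℝ (F₃ x.2) y.2| ≤ ‖F₃‖ * ‖x‖ * ‖y‖ :=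
        (abs_real_inner_le_norm _ _).trans (by
          gcongr; exact (F₃.le_opNorm _).trans (by gcongr))
      have h4 : |δ * inner ℝ x.2 y.2| ≤ |δ| * ‖x‖ * ‖y‖ := by
        rw [abs_mul, mul_assoc]
        gcongr
        exact (abs_real_inner_le_norm _ _).trans (by gcongr)
      simp only [LinearMap.mk₂_apply]
      rw [Real.norm_eq_abs]
      have h5 : |2 * inner ℝ (F₂ x.1) y.2| = 2 * |inner ℝ (F₂ x.1) y.2| := by
        rw [abs_mul]; simp
      refine (abs_sub _ _).trans ?_
      have h6 := abs_add_le (inner ℝ (F₁ x.1) y.1 + 2 * inner ℝ (F₂ x.1) y.2) (inner ℝ (F₃ x.2) y.2)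
      have h7 := abs_add_le (inner ℝ (F₁ x.1) y.1) (2 * inner ℝ (F₂ x.1) y.2)
      rw [h5] at h7
      linarith)

omit [CompleteSpace H] [CompleteSpace U] in
theorem shiftedForm_apply (F₁ : H →L[ℝ] H) (F₂ : H →L[ℝ] U) (F₃ : U →L[ℝ] U) (δ : ℝ)
    (x y : H × U) : shiftedForm F₁ F₂ F₃ δ x y = inner ℝ (F₁ x.1) y.1 + 2 * inner ℝ (F₂ x.1) y.2 +
        inner ℝ (F₃ x.2) y.2 - δ * inner ℝ x.2 y.2 := rfl

/-- The frequency condition gives coercivity of the quadratic functional on processes with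
compactly supported controls. -/
theorem integral_shiftedForm_nonneg {A : H →ₗ.[ℝ] H} {G E : ℝ → H →L[ℝ] H} {C ε : ℝ}
    (hA : IsGenerator A G) (hG : IsC0Semigroup G) (hE : IsUnstableFlow G E C ε)
    (B : U →L[ℝ] H) (F₁ : H →L[ℝ] H) (F₂ : H →L[ℝ] U) (F₃ : U →L[ℝ] U) {δ : ℝ}
    (hfreq : ∀ (ω : ℝ) (ξ : Cx U) (w : Cx H),
      CxGraph A w (cxSmul (Complex.I * (ω : ℂ)) w + cxMap B ξ) →
        δ * ‖ξ‖ ^ 2 ≤ quadFormC F₁ F₂ F₃ (-w) ξ)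
    {ξ : ℝ → U} (hξ : Continuous ξ) (hξs : HasCompactSupport ξ) :
    0 ≤ ∫ t, shiftedForm F₁ F₂ F₃ δ (kernelConv (green G E) (fun t => B (ξ t)) t, ξ t)
      (kernelConv (green G E) (fun t => B (ξ t)) t, ξ t) := by
  have hk := hE.isExpKernel_green hG
  set f : ℝ → H := fun t => B (ξ t) with hfdef
  have hf : Continuous f := by fun_prop
  have hfs : HasCompactSupport f := hξs.comp_left (map_zero B)
  have hfm : MemLp f 2 := hf.memLp_of_hasCompactSupport hfs
  set v := kernelConv (green G E) f with hvdef
  have hv : Continuous v := hk.continuous_conv hfm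
  obtain ⟨D, hD0, hD⟩ := hk.norm_conv_le_exp hf hfs
  have hvi : Integrable v := ((integrable_exp_neg_mul_abs hk.pos).const_mul D).mono'
    hv.aestronglyMeasurable (Eventually.of_forall hD)
  have hξi : Integrable ξ := hξ.integrable_of_hasCompactSupport hξs
  have hmild : ∀ s t, s ≤ t → v t = G (t - s) (v s) + ∫ θ in s..t, G (t - θ) (f θ) :=
    fun s t hst => (hE.conv_green_mild hG hfm hst).2
  obtain ⟨D', hD'⟩ : ∃ D', ∀ t, ‖ξ t‖ ≤ D' * Real.exp (-ε * |t|) := by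
    obtain ⟨D', hD'⟩ := (hξs.norm.mul_left (f := fun t : ℝ => Real.exp (ε * |t|))
      ).exists_bound_of_continuous (by fun_prop)
    refine ⟨D', fun t => ?_⟩
    have := hD' t
    simp only [Pi.mul_apply] at this
    rw [norm_mul, Real.norm_of_nonneg (Real.exp_nonneg _), norm_norm] at this
    rw [neg_mul, Real.exp_neg, ← div_eq_mul_inv, le_div_iff₀ (Real.exp_pos _)]
    linarith
  refine integral_quadratic_nonneg (shiftedForm F₁ F₂ F₃ δ) (z := fun t => (v t, ξ t))
    (hv.prodMk hξ) hk.pos (D := max D D') (fun t => ?_) (fun ω => ?_)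
  · rw [Prod.norm_def, max_le_iff]
    constructor
    · exact (hD t).trans (by gcongr; exact le_max_left _ _)
    · exact (hD' t).trans (by gcongr; exact le_max_right _ _)
  · have hpair : ∀ ψ : ℝ → ℝ, Continuous ψ → (∀ t, |ψ t| ≤ 1) →
        ∫ t, ψ t • (v t, ξ t) = (∫ t, ψ t • v t, ∫ t, ψ t • ξ t) := fun ψ hψ h1 => by
      have i1 : Integrable fun t => ψ t • v t := hvi.norm.mono' (by fun_prop)
        (Eventually.of_forall fun t => by
          rw [norm_smul]; exact mul_le_of_le_one_left (norm_nonneg _) (h1 t))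
      have i2 : Integrable fun t => ψ t • ξ t := hξi.norm.mono' (by fun_prop)
        (Eventually.of_forall fun t => by
          rw [norm_smul]; exact mul_le_of_le_one_left (norm_nonneg _) (h1 t))
      exact integral_pair i1 i2
    have hcos : ∀ t : ℝ, |Real.cos (ω * t)| ≤ 1 := fun t => Real.abs_cos_le_one _
    have hsin : ∀ t : ℝ, |Real.sin (ω * t)| ≤ 1 := fun t => Real.abs_sin_le_one _
    have hBi : ∀ ψ : ℝ → ℝ, Continuous ψ → (∀ t, |ψ t| ≤ 1) →
        ∫ t, ψ t • f t = B (∫ t, ψ t • ξ t) := fun ψ hψ h1 => by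
      have i2 : Integrable fun t => ψ t • ξ t := hξi.norm.mono' (by fun_prop)
        (Eventually.of_forall fun t => by
          rw [norm_smul]; exact mul_le_of_le_one_left (norm_nonneg _) (h1 t))
      rw [← ContinuousLinearMap.integral_comp_comm _ i2]
      simp [hfdef]
    have dcos : ∀ t : ℝ, HasDerivAt (fun t => Real.cos (ω * t)) (-ω * Real.sin (ω * t)) t :=
      fun t => by
        have := ((hasDerivAt_id t).const_mul ω).cos
        simpa [mul_comm] using this
    have dsin : ∀ t : ℝ, HasDerivAt (fun t => Real.sin (ω * t)) (ω * Real.cos (ω * t)) t :=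
      fun t => by
        have := ((hasDerivAt_id t).const_mul ω).sin
        simpa [mul_comm] using this
    have g1 := hA.integral_mem_graph hG hv hvi hf hfs hmild dcos hcos (c := |ω|) (fun t => by
      rw [abs_mul, abs_neg]; exact mul_le_of_le_one_right (abs_nonneg _) (hsin t))
    have g2 := hA.integral_mem_graph hG hv hvi hf hfs hmild dsin hsin (c := |ω|) (fun t => by
      rw [abs_mul]; exact mul_le_of_le_one_right (abs_nonneg _) (hcos t))
    rw [hBi _ (by fun_prop) hcos] at g1
    rw [hBi _ (by fun_prop) hsin] at g2
    simp only [mul_smul, integral_smul] at g1 g2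
    rw [hpair _ (by fun_prop) hcos, hpair _ (by fun_prop) hsin]
    set Cv := ∫ t, Real.cos (ω * t) • v t
    set Sv := ∫ t, Real.sin (ω * t) • v t
    set Cξ := ∫ t, Real.cos (ω * t) • ξ t
    set Sξ := ∫ t, Real.sin (ω * t) • ξ t
    -- With the transform ∫ e^{-iωt}(·) dt, one has ξ̂ = Cξ - iSξ and v̂ = Cv - iSv, and `g1`, `g2`
    -- say that A v̂ = iω v̂ - B ξ̂. So w = -v̂ is the vector in the frequency condition.
    have hh := hfreq ω (WithLp.toLp 2 (Cξ, -Sξ)) (WithLp.toLp 2 (-Cv, Sv)) (by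
      constructor
      · have := A.graph.neg_mem g1
        simpa [cxSmul, cxMap, add_comm, sub_eq_add_neg] using this
      · simpa [cxSmul, cxMap, sub_eq_add_neg] using g2)
    rw [WithLp.prod_norm_sq_eq_of_L2] at hh
    simp only [quadFormC, quadForm, WithLp.neg_fst, WithLp.neg_snd, WithLp.toLp_fst,
      WithLp.toLp_snd, neg_neg, map_neg, inner_neg_left, inner_neg_right, norm_neg] at hh
    simp only [shiftedForm_apply, real_inner_self_eq_norm_sq]
    linarith

end Frequency


/-! ### Coercivity in L² and solution of the optimality system -/

section Solve

/-- Solvability of the optimality system of a coercive linear-quadratic problem with controls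
constrained to the range of an orthogonal projection. -/
theorem exists_optimal_control {X Y : Type*} [NormedAddCommGroup X] [InnerProductSpace ℝ X]
    [CompleteSpace X] [NormedAddCommGroup Y] [InnerProductSpace ℝ Y] [CompleteSpace Y]
    (L : Y →L[ℝ] Y) (B : X →L[ℝ] Y) (F₁ : Y →L[ℝ] Y) (F₂ : Y →L[ℝ] X) (F₃ : X →L[ℝ] X)
    (P : X →L[ℝ] X) (hP : ∀ x, P (P x) = P x) (hPs : ∀ x y, inner ℝ (P x) y = inner ℝ x (P y))
    {δ : ℝ} (hδ : 0 < δ)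
    (hco : ∀ ξ, δ * ‖ξ‖ ^ 2 ≤ inner ℝ (F₁ (L (B ξ))) (L (B ξ)) + 2 * inner ℝ (F₂ (L (B ξ))) ξ +
      inner ℝ (F₃ ξ) ξ) (v₀ η₀ : Y) :
    ∃ ξ : X, P ξ = ξ ∧ P (F₂ (v₀ + L (B ξ)) + F₃ ξ -
      B.adjoint (η₀ - L.adjoint (F₁ (v₀ + L (B ξ)) + F₂.adjoint ξ))) = 0 := by
  -- The linear part of the optimality equation in ξ. The cross term of ⟨Nξ, ξ⟩ appears once through
  -- `F₂` and once through its adjoint, which reproduces the factor 2.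
  set N : X →L[ℝ] X := F₂.comp (L.comp B) + F₃ +
    B.adjoint.comp (L.adjoint.comp (F₁.comp (L.comp B) + F₂.adjoint)) with hN
  have hNa : ∀ ξ, N ξ = F₂ (L (B ξ)) + F₃ ξ +
      B.adjoint (L.adjoint (F₁ (L (B ξ)) + F₂.adjoint ξ)) := fun ξ => rfl
  have hNc : ∀ ξ, δ * ‖ξ‖ ^ 2 ≤ inner ℝ (N ξ) ξ := fun ξ => by
    refine (hco ξ).trans_eq ?_
    rw [hNa, inner_add_left, inner_add_left, ContinuousLinearMap.adjoint_inner_left,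
      ContinuousLinearMap.adjoint_inner_left, inner_add_left,
      ContinuousLinearMap.adjoint_inner_left, real_inner_comm (F₂ _) ξ]
    ring
  -- Adding the complementary projection makes the compressed operator coercive on all of `X`, with
  -- constant `min δ 1`.
  set T : X →L[ℝ] X := P.comp (N.comp P) + (ContinuousLinearMap.id ℝ X - P) with hT
  have hTa : ∀ ξ, T ξ = P (N (P ξ)) + (ξ - P ξ) := fun ξ => rfl
  have hc0 : 0 < min δ 1 := by positivity
  have hTu : IsUnit T := by
    refine ContinuousLinearMap.isUnit_of_forall_le_norm_inner_map T (c := ⟨min δ 1, hc0.le⟩) hc0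
      fun ξ => ?_
    have h1 : inner ℝ (ξ - P ξ) ξ = ‖ξ - P ξ‖ ^ 2 := by
      rw [← real_inner_self_eq_norm_sq]
      have : inner ℝ (ξ - P ξ) (P ξ) = 0 := by rw [← hPs, map_sub, hP, sub_self, inner_zero_left]
      rw [inner_sub_right (ξ - P ξ) ξ, this, sub_zero]
    have h2 : ‖ξ‖ ^ 2 = ‖P ξ‖ ^ 2 + ‖ξ - P ξ‖ ^ 2 := by
      have : inner ℝ (P ξ) (ξ - P ξ) = 0 := by rw [hPs, map_sub, hP, sub_self, inner_zero_right]
      have h3 := norm_add_sq_real (P ξ) (ξ - P ξ)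
      rw [add_sub_cancel, this] at h3
      linarith
    have h4 : inner ℝ (T ξ) ξ = inner ℝ (N (P ξ)) (P ξ) + ‖ξ - P ξ‖ ^ 2 := by
      rw [hTa, inner_add_left, h1, hPs]
    have h5 := hNc (P ξ)
    refine le_trans ?_ (le_abs_self _)
    rw [h4, h2]
    change (‖P ξ‖ ^ 2 + ‖ξ - P ξ‖ ^ 2) * min δ 1 ≤ _
    nlinarith [min_le_left δ 1, min_le_right δ 1, sq_nonneg ‖P ξ‖, sq_nonneg ‖ξ - P ξ‖]
  obtain ⟨ξ, hξ⟩ := ((ContinuousLinearMap.isUnit_iff_bijective).1 hTu).surjective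
    (P (B.adjoint (η₀ - L.adjoint (F₁ v₀)) - F₂ v₀))
  -- The right-hand side lies in the range of `P`, so the complementary component of the solution
  -- vanishes.
  have hfix : P ξ = ξ := by
    have h1 : P (T ξ) = P (P (B.adjoint (η₀ - L.adjoint (F₁ v₀)) - F₂ v₀)) := by rw [hξ]
    rw [hP, hTa, map_add, hP, map_sub, hP, sub_self, add_zero, ← hξ, hTa] at h1
    have h2 : ξ - P ξ = 0 := left_eq_add.1 h1
    exact (sub_eq_zero.1 h2).symm
  refine ⟨ξ, hfix, ?_⟩
  rw [hTa, hfix, sub_self, add_zero, hNa] at hξ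
  rw [← sub_eq_zero, ← map_sub] at hξ
  rw [← hξ]
  congr 1
  simp only [map_add, map_sub]
  abel

/-- The product of an `L²`-function with the indicator function of a measurable set. -/
noncomputable def indicatorLp {U : Type*} [NormedAddCommGroup U] {S : Set ℝ}
    (hS : MeasurableSet S) (f : Lp U 2 (volume : Measure ℝ)) : Lp U 2 (volume : Measure ℝ) :=
  ((Lp.memLp f).indicator hS).toLp (S.indicator f)

theorem coeFn_indicatorLp {U : Type*} [NormedAddCommGroup U] {S : Set ℝ}
    (hS : MeasurableSet S) (f : Lp U 2 (volume : Measure ℝ)) :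
    indicatorLp hS f =ᵐ[volume] S.indicator (f : ℝ → U) := by
  have hg : MemLp (S.indicator (f : ℝ → U)) 2 volume := (Lp.memLp f).indicator hS
  have h : indicatorLp hS f = hg.toLp _ := rfl
  rw [h]
  exact hg.coeFn_toLp

theorem norm_indicatorLp_le {U : Type*} [NormedAddCommGroup U] {S : Set ℝ}
    (hS : MeasurableSet S) (f : Lp U 2 (volume : Measure ℝ)) : ‖indicatorLp hS f‖ ≤ ‖f‖ := by
  rw [indicatorLp, Lp.norm_toLp, Lp.norm_def]
  exact ENNReal.toReal_mono (Lp.eLpNorm_ne_top f) (eLpNorm_indicator_le _)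

/-- Multiplication by the indicator function of a measurable set in `L²`. -/
noncomputable def indicatorL2 {U : Type*} [NormedAddCommGroup U] [InnerProductSpace ℝ U]
    {S : Set ℝ} (hS : MeasurableSet S) :
    Lp U 2 (volume : Measure ℝ) →L[ℝ] Lp U 2 (volume : Measure ℝ) :=
  LinearMap.mkContinuous
    { toFun := indicatorLp hS
      map_add' := fun f g => by
        refine Lp.ext ?_
        filter_upwards [Lp.coeFn_add f g, Lp.coeFn_add (indicatorLp hS f) (indicatorLp hS g),
          coeFn_indicatorLp hS f, coeFn_indicatorLp hS g, coeFn_indicatorLp hS (f + g)]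
          with t h1 h2 h3 h4 h5
        rw [h2, Pi.add_apply, h3, h4, h5]
        by_cases h : t ∈ S
        · simp only [indicator_of_mem h, h1, Pi.add_apply]
        · simp only [indicator_of_notMem h, add_zero]
      map_smul' := fun c f => by
        refine Lp.ext ?_
        filter_upwards [Lp.coeFn_smul c f, Lp.coeFn_smul c (indicatorLp hS f),
          coeFn_indicatorLp hS f, coeFn_indicatorLp hS (c • f)] with t h1 h2 h3 h4
        rw [RingHom.id_apply, h2, Pi.smul_apply, h3, h4]
        by_cases h : t ∈ S
        · simp only [indicator_of_mem h, h1, Pi.smul_apply]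
        · simp only [indicator_of_notMem h, smul_zero] }
    1 (fun f => (norm_indicatorLp_le hS f).trans_eq (one_mul _).symm)

variable {H U : Type*} [NormedAddCommGroup H] [InnerProductSpace ℝ H]
  [NormedAddCommGroup U] [InnerProductSpace ℝ U]

theorem coeFn_indicatorL2 {S : Set ℝ} (hS : MeasurableSet S) (f : Lp U 2 (volume : Measure ℝ)) :
    indicatorL2 hS f =ᵐ[volume] S.indicator (f : ℝ → U) :=
  coeFn_indicatorLp hS f

variable [CompleteSpace H] [CompleteSpace U]

theorem inner_compLpL (B : U →L[ℝ] H) (f : Lp U 2 (volume : Measure ℝ))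
    (g : Lp H 2 (volume : Measure ℝ)) :
    inner ℝ (B.compLpL 2 volume f) g = inner ℝ f (B.adjoint.compLpL 2 volume g) := by
  rw [L2.inner_def, L2.inner_def]
  refine integral_congr_ae ?_
  filter_upwards [B.coeFn_compLpL f, B.adjoint.coeFn_compLpL g] with t h1 h2
  rw [h1, h2, ContinuousLinearMap.adjoint_inner_right]

theorem adjoint_compLpL (B : U →L[ℝ] H) :
    (B.compLpL 2 (volume : Measure ℝ)).adjoint = B.adjoint.compLpL 2 volume :=
  ((ContinuousLinearMap.eq_adjoint_iff _ _).2 fun x y => by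
    rw [real_inner_comm, ← inner_compLpL, real_inner_comm]).symm

/-- The frequency condition gives coercivity of the quadratic functional in `L²`. -/
theorem coercive_L2 {A : H →ₗ.[ℝ] H} {G E : ℝ → H →L[ℝ] H} {C ε : ℝ}
    (hA : IsGenerator A G) (hG : IsC0Semigroup G) (hE : IsUnstableFlow G E C ε)
    (B : U →L[ℝ] H) (F₁ : H →L[ℝ] H) (F₂ : H →L[ℝ] U) (F₃ : U →L[ℝ] U) {δ : ℝ}
    (hfreq : ∀ (ω : ℝ) (ξ : Cx U) (w : Cx H),
      CxGraph A w (cxSmul (Complex.I * (ω : ℂ)) w + cxMap B ξ) →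
        δ * ‖ξ‖ ^ 2 ≤ quadFormC F₁ F₂ F₃ (-w) ξ) (ξ : Lp U 2 (volume : Measure ℝ)) :
    δ * ‖ξ‖ ^ 2 ≤
      inner ℝ (F₁.compLpL 2 volume ((hE.isExpKernel_green hG).convL2 (B.compLpL 2 volume ξ)))
        ((hE.isExpKernel_green hG).convL2 (B.compLpL 2 volume ξ)) +
      2 * inner ℝ (F₂.compLpL 2 volume ((hE.isExpKernel_green hG).convL2 (B.compLpL 2 volume ξ))) ξ
      + inner ℝ (F₃.compLpL 2 volume ξ) ξ := by
  set L := (hE.isExpKernel_green hG).convL2 with hL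
  have hclosed : IsClosed {ξ : Lp U 2 (volume : Measure ℝ) | δ * ‖ξ‖ ^ 2 ≤
      inner ℝ (F₁.compLpL 2 volume (L (B.compLpL 2 volume ξ))) (L (B.compLpL 2 volume ξ)) +
      2 * inner ℝ (F₂.compLpL 2 volume (L (B.compLpL 2 volume ξ))) ξ
      + inner ℝ (F₃.compLpL 2 volume ξ) ξ} := by
    refine isClosed_le ?_ ?_
    · fun_prop
    · fun_prop
  -- Both sides are continuous in the control, so the inequality extends from the dense set of
  -- compactly supported continuous controls.
  refine closure_minimal
    (s := {ξ : Lp U 2 (volume : Measure ℝ) | ∃ g : ℝ → U, Continuous g ∧ HasCompactSupport g ∧ ξ =ᵐ[volume] g}) ?_ hclosed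
    (a := ξ) ?_
  · rintro ξ ⟨g, hg, hgs, hξ⟩
    have h := integral_shiftedForm_nonneg hA hG hE B F₁ F₂ F₃ hfreq hg hgs
    set v := L (B.compLpL 2 volume ξ) with hv
    have hBξ : B.compLpL 2 volume ξ =ᵐ[volume] fun t => B (g t) := by
      filter_upwards [B.coeFn_compLpL ξ, hξ] with t h1 h2
      rw [h1, h2]
    have hvt : v =ᵐ[volume] kernelConv (green G E) (fun t => B (g t)) := by
      filter_upwards [(hE.isExpKernel_green hG).coeFn_convL2 (B.compLpL 2 volume ξ)] with t h1
      rw [hv, hL, h1, kernelConv_congr hBξ]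
    rw [mem_ofPred_eq, ← real_inner_self_eq_norm_sq, L2.inner_def, L2.inner_def, L2.inner_def,
      L2.inner_def, ← integral_const_mul, ← integral_const_mul,
      ← integral_add (L2.integrable_inner _ _) ((L2.integrable_inner _ _).const_mul _),
      ← integral_add ((L2.integrable_inner _ _).add ((L2.integrable_inner _ _).const_mul _))
        (L2.integrable_inner _ _), ← sub_nonneg, ← integral_sub
        (((L2.integrable_inner _ _).add ((L2.integrable_inner _ _).const_mul _)).add
        (L2.integrable_inner _ _)) ((L2.integrable_inner _ _).const_mul _)]
    refine h.trans_eq (integral_congr_ae ?_)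
    filter_upwards [hvt, hξ, F₁.coeFn_compLpL v, F₂.coeFn_compLpL v, F₃.coeFn_compLpL ξ]
      with t h1 h2 h3 h4 h5
    rw [shiftedForm_apply, h3, h4, h5, h1, h2]
  · rw [Metric.mem_closure_iff]
    intro e he
    obtain ⟨g, hgs, hge, hg, hgm⟩ := (Lp.memLp ξ).exists_hasCompactSupport_eLpNorm_sub_le
      ENNReal.ofNat_ne_top (ε := ENNReal.ofReal (e / 2)) (by simpa using half_pos he)
    refine ⟨hgm.toLp g, ⟨g, hg, hgs, hgm.coeFn_toLp⟩, ?_⟩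
    have h1 : dist ξ (hgm.toLp g) = (eLpNorm ((ξ : ℝ → U) - g) 2 volume).toReal := by
      rw [Lp.dist_def]
      congr 1
      refine eLpNorm_congr_ae ?_
      filter_upwards [hgm.coeFn_toLp] with t ht
      simp [ht]
    rw [h1]
    have := ENNReal.toReal_mono ENNReal.ofReal_ne_top hge
    rw [ENNReal.toReal_ofReal (by positivity)] at this
    linarith

/-- Controls on the whole line solving the optimality system on the set `S` and vanishing
outside of it. -/
theorem exists_control {A : H →ₗ.[ℝ] H} {G E : ℝ → H →L[ℝ] H} {C ε : ℝ}
    (hA : IsGenerator A G) (hG : IsC0Semigroup G) (hE : IsUnstableFlow G E C ε)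
    (B : U →L[ℝ] H) (F₁ : H →L[ℝ] H) (F₂ : H →L[ℝ] U) (F₃ : U →L[ℝ] U)
    (hfreq : FrequencyCondition A B F₁ F₂ F₃) {S : Set ℝ} (hS : MeasurableSet S) {v₀ η₀ : ℝ → H}
    (hv₀ : MemLp v₀ 2) (hη₀ : MemLp η₀ 2) :
    ∃ f g : ℝ → H, MemLp f 2 ∧ MemLp g 2 ∧ (∀ᵐ t, t ∉ S → f t = 0) ∧
      ∀ᵐ t, t ∈ S → ∃ ξ : U, f t = B ξ ∧
        g t = F₁ (v₀ t + kernelConv (green G E) f t) + F₂.adjoint ξ ∧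
        F₂ (v₀ t + kernelConv (green G E) f t) + F₃ ξ =
          B.adjoint (η₀ t - kernelConv (greenRev G E) g t) := by
  obtain ⟨δ, hδ, hfr⟩ := hfreq
  have hk := hE.isExpKernel_green hG
  have hk' := hE.isExpKernel_greenRev hG
  have hLadj : hk.convL2.adjoint = hk'.convL2 :=
    ((ContinuousLinearMap.eq_adjoint_iff _ _).2 fun x y => by
      rw [real_inner_comm, ← hk.inner_convL2 hk' (fun t => rfl), real_inner_comm]).symm
  obtain ⟨ξ, h1, h2⟩ := exists_optimal_control hk.convL2 (B.compLpL 2 volume)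
    (F₁.compLpL 2 volume) (F₂.compLpL 2 volume) (F₃.compLpL 2 volume) (indicatorL2 hS)
    (fun x => by
      refine Lp.ext ?_
      filter_upwards [coeFn_indicatorL2 hS x, coeFn_indicatorL2 hS (indicatorL2 hS x)] with t h1 h2
      rw [h2, h1]
      by_cases h : t ∈ S <;> simp [h, h1])
    (fun x y => by
      rw [L2.inner_def, L2.inner_def]
      refine integral_congr_ae ?_
      filter_upwards [coeFn_indicatorL2 hS x, coeFn_indicatorL2 hS y] with t h1 h2
      rw [h2, h1]
      by_cases h : t ∈ S <;> simp [h])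
    hδ (coercive_L2 hA hG hE B F₁ F₂ F₃ hfr) (hv₀.toLp v₀) (hη₀.toLp η₀)
  rw [hLadj, adjoint_compLpL, adjoint_compLpL] at h2
  set fL := B.compLpL 2 volume ξ with hfL
  set vL := hv₀.toLp v₀ + hk.convL2 fL with hvL
  set gL := F₁.compLpL 2 volume vL + F₂.adjoint.compLpL 2 volume ξ with hgL
  set ηL := hη₀.toLp η₀ - hk'.convL2 gL with hηL
  have efL := B.coeFn_compLpL ξ
  have evL : vL =ᵐ[volume] fun t => v₀ t + kernelConv (green G E) fL t := by
    filter_upwards [Lp.coeFn_add (hv₀.toLp v₀) (hk.convL2 fL), hv₀.coeFn_toLp,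
      hk.coeFn_convL2 fL] with t a1 a2 a3
    rw [a1, Pi.add_apply, a2, a3]
  have eηL : ηL =ᵐ[volume] fun t => η₀ t - kernelConv (greenRev G E) gL t := by
    filter_upwards [Lp.coeFn_sub (hη₀.toLp η₀) (hk'.convL2 gL), hη₀.coeFn_toLp,
      hk'.coeFn_convL2 gL] with t a1 a2 a3
    rw [a1, Pi.sub_apply, a2, a3]
  refine ⟨fL, gL, Lp.memLp fL, Lp.memLp gL, ?_, ?_⟩
  -- The fixed-point equation `h1` says that the control vanishes off `S`; the projected equation
  -- `h2` is the optimality equation on `S`.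
  · have := coeFn_indicatorL2 hS ξ
    rw [h1] at this
    filter_upwards [this, efL] with t a1 a2 ht
    rw [hfL, a2, a1, indicator_of_notMem ht, map_zero]
  · have e0 := coeFn_indicatorL2 hS (F₂.compLpL 2 volume vL + F₃.compLpL 2 volume ξ -
      B.adjoint.compLpL 2 volume ηL)
    rw [h2] at e0
    filter_upwards [e0, efL, evL, eηL, Lp.coeFn_zero U 2 volume,
      Lp.coeFn_sub (F₂.compLpL 2 volume vL + F₃.compLpL 2 volume ξ) (B.adjoint.compLpL 2 volume ηL),
      Lp.coeFn_add (F₂.compLpL 2 volume vL) (F₃.compLpL 2 volume ξ), F₂.coeFn_compLpL vL,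
      F₃.coeFn_compLpL ξ, B.adjoint.coeFn_compLpL ηL,
      Lp.coeFn_add (F₁.compLpL 2 volume vL) (F₂.adjoint.compLpL 2 volume ξ),
      F₁.coeFn_compLpL vL, F₂.adjoint.coeFn_compLpL ξ]
      with t a0 a1 a2 a3 a4 a5 a6 a7 a8 a9 a10 a11 a12 ht
    refine ⟨ξ t, a1, ?_, ?_⟩
    · rw [hgL, a10, Pi.add_apply, a11, a12, a2]
    · rw [a4, indicator_of_mem ht, a5, Pi.sub_apply, a6, Pi.add_apply, a7, a8, a9, a2, a3] at a0
      exact (sub_eq_zero.1 a0.symm)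

end Solve


/-! ### Decaying solutions of the Hamiltonian system -/

section Solutions

variable {H U : Type*} [NormedAddCommGroup H] [InnerProductSpace ℝ H] [CompleteSpace H]
  [NormedAddCommGroup U] [InnerProductSpace ℝ U] [CompleteSpace U]

/-- Mild solutions of the Hamiltonian system on a set of times. -/
structure SolvesOn (G : ℝ → H →L[ℝ] H) (B : U →L[ℝ] H)
    (F₁ : H →L[ℝ] H) (F₂ : H →L[ℝ] U) (F₃ : U →L[ℝ] U) (I : Set ℝ) (v η : ℝ → H) : Prop where
  cont_v : ContinuousOn v I
  cont_eta : ContinuousOn η I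
  int_v : ∀ s ∈ I, ∀ t ∈ I, s ≤ t →
    IntervalIntegrable (fun θ => G (t - θ) (hamV B F₂ F₃ (v θ) (η θ))) volume s t
  int_eta : ∀ s ∈ I, ∀ t ∈ I, s ≤ t →
    IntervalIntegrable
      (fun θ => (G (θ - s)).adjoint (hamEta B F₁ F₂ F₃ (v θ) (η θ))) volume s t
  eq_v : ∀ s ∈ I, ∀ t ∈ I, s ≤ t →
    v t = G (t - s) (v s) + ∫ θ in s..t, G (t - θ) (hamV B F₂ F₃ (v θ) (η θ))
  eq_eta : ∀ s ∈ I, ∀ t ∈ I, s ≤ t →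
    η s = (G (t - s)).adjoint (η t) -
      ∫ θ in s..t, (G (θ - s)).adjoint (hamEta B F₁ F₂ F₃ (v θ) (η θ))

theorem isMildSolution_iff {G : ℝ → H →L[ℝ] H} {B : U →L[ℝ] H}
    {F₁ : H →L[ℝ] H} {F₂ : H →L[ℝ] U} {F₃ : U →L[ℝ] U} {v η : ℝ → H} :
    IsMildSolution G B F₁ F₂ F₃ v η ↔ SolvesOn G B F₁ F₂ F₃ (Ici 0) v η := by
  constructor
  · intro h
    exact ⟨h.cont_v, h.cont_eta, fun s hs t _ hst => h.int_v s t hs hst,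
      fun s hs t _ hst => h.int_eta s t hs hst, fun s hs t _ hst => h.eq_v s t hs hst,
      fun s hs t _ hst => h.eq_eta s t hs hst⟩
  · intro h
    exact ⟨h.cont_v, h.cont_eta, fun s t hs hst => h.int_v s hs t (hs.trans hst) hst,
      fun s t hs hst => h.int_eta s hs t (hs.trans hst) hst,
      fun s t hs hst => h.eq_v s hs t (hs.trans hst) hst,
      fun s t hs hst => h.eq_eta s hs t (hs.trans hst) hst⟩

theorem adjoint_ringInverse {F₃ : U →L[ℝ] U} (hF₃ : IsSelfAdjoint F₃) :
    (Ring.inverse F₃).adjoint = Ring.inverse F₃ := by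
  rw [← ContinuousLinearMap.star_eq_adjoint]
  by_cases h : IsUnit F₃
  · obtain ⟨u, rfl⟩ := h
    rw [Ring.inverse_unit]
    have hu : star u = u := Units.ext hF₃
    rw [← Units.coe_star_inv, hu]
  · rw [Ring.inverse_non_unit _ h, star_zero]

omit [CompleteSpace U] in
theorem ringInverse_apply {F₃ : U →L[ℝ] U} (hF₃ : IsUnit F₃) (x : U) :
    Ring.inverse F₃ (F₃ x) = x := by
  change (Ring.inverse F₃ * F₃) x = x
  rw [Ring.inverse_mul_cancel _ hF₃]
  rfl

/-- The stationarity equation is solved by ξ = F₃⁻¹(B*η - F₂v), so the Hamiltonian system is the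
optimality system with the control eliminated. -/
theorem hamV_of_control {F₃ : U →L[ℝ] U} (hF₃ : IsUnit F₃) (B : U →L[ℝ] H) (F₂ : H →L[ℝ] U)
    {v η : H} {ξ : U} (h : F₂ v + F₃ ξ = B.adjoint η) : hamV B F₂ F₃ v η = B ξ := by
  rw [hamV, ← h, map_add, ringInverse_apply hF₃, map_add]
  abel

theorem hamEta_of_control {F₃ : U →L[ℝ] U} (hF₃ : IsUnit F₃) (hF₃s : IsSelfAdjoint F₃)
    (B : U →L[ℝ] H) (F₁ : H →L[ℝ] H) (F₂ : H →L[ℝ] U)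
    {v η : H} {ξ : U} (h : F₂ v + F₃ ξ = B.adjoint η) :
    hamEta B F₁ F₂ F₃ v η = F₁ v + F₂.adjoint ξ := by
  rw [hamEta, ContinuousLinearMap.adjoint_comp, ContinuousLinearMap.adjoint_comp,
    adjoint_ringInverse hF₃s, ContinuousLinearMap.comp_apply, ContinuousLinearMap.comp_apply, ← h,
    map_add, ringInverse_apply hF₃, map_add]
  abel

variable {G E : ℝ → H →L[ℝ] H} {C ε : ℝ} {B : U →L[ℝ] H} {F₁ : H →L[ℝ] H} {F₂ : H →L[ℝ] U}
  {F₃ : U →L[ℝ] U}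

/-- Sums of homogeneous solutions and Green convolutions solve the Hamiltonian system as soon as
the forcing terms agree with the bounded part of the Hamiltonian. -/
theorem solvesOn_of_conv (hG : IsC0Semigroup G) (hE : IsUnstableFlow G E C ε) {I : Set ℝ}
    (hI : I.OrdConnected) {a b f g : ℝ → H} (hf : MemLp f 2) (hg : MemLp g 2)
    (ha : ContinuousOn a I) (hb : ContinuousOn b I)
    (ha' : ∀ s ∈ I, ∀ t ∈ I, s ≤ t → a t = G (t - s) (a s))
    (hb' : ∀ s ∈ I, ∀ t ∈ I, s ≤ t → b s = (G (t - s)).adjoint (b t))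
    (hfv : ∀ᵐ t, t ∈ I → hamV B F₂ F₃ (a t + kernelConv (green G E) f t)
      (b t - kernelConv (greenRev G E) g t) = f t)
    (hgv : ∀ᵐ t, t ∈ I → hamEta B F₁ F₂ F₃ (a t + kernelConv (green G E) f t)
      (b t - kernelConv (greenRev G E) g t) = g t) :
    SolvesOn G B F₁ F₂ F₃ I (fun t => a t + kernelConv (green G E) f t)
      (fun t => b t - kernelConv (greenRev G E) g t) := by
  have e1 : ∀ s ∈ I, ∀ t ∈ I, s ≤ t → ∀ᵐ θ, θ ∈ uIoc s t →
      G (t - θ) (f θ) = G (t - θ) (hamV B F₂ F₃ (a θ + kernelConv (green G E) f θ)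
      (b θ - kernelConv (greenRev G E) g θ)) := fun s hs t ht hst => by
    filter_upwards [hfv] with θ h1 h2
    rw [uIoc_of_le hst] at h2
    rw [h1 (hI.out hs ht (Ioc_subset_Icc_self h2))]
  have e2 : ∀ s ∈ I, ∀ t ∈ I, s ≤ t → ∀ᵐ θ, θ ∈ uIoc s t →
      (G (θ - s)).adjoint (g θ) =
      (G (θ - s)).adjoint (hamEta B F₁ F₂ F₃ (a θ + kernelConv (green G E) f θ)
      (b θ - kernelConv (greenRev G E) g θ)) := fun s hs t ht hst => by
    filter_upwards [hgv] with θ h1 h2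
    rw [uIoc_of_le hst] at h2
    rw [h1 (hI.out hs ht (Ioc_subset_Icc_self h2))]
  refine ⟨ha.add ((hE.isExpKernel_green hG).continuous_conv hf).continuousOn,
    hb.sub ((hE.isExpKernel_greenRev hG).continuous_conv hg).continuousOn,
    fun s hs t ht hst => ?_, fun s hs t ht hst => ?_, fun s hs t ht hst => ?_,
    fun s hs t ht hst => ?_⟩
  · exact (hE.conv_green_mild hG hf hst).1.congr_ae
      ((ae_restrict_iff' measurableSet_uIoc).2 (e1 s hs t ht hst))
  · exact (hE.conv_greenRev_mild hG hg hst).1.congr_ae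
      ((ae_restrict_iff' measurableSet_uIoc).2 (e2 s hs t ht hst))
  · rw [← intervalIntegral.integral_congr_ae (e1 s hs t ht hst),
      (hE.conv_green_mild hG hf hst).2, ha' s hs t ht hst, map_add]
    abel
  · rw [← intervalIntegral.integral_congr_ae (e2 s hs t ht hst),
      (hE.conv_greenRev_mild hG hg hst).2, hb' s hs t ht hst, map_sub]
    abel

omit [CompleteSpace H] in
theorem tendsto_exp_neg_apply_atTop {k : ℝ → H →L[ℝ] H} (hε : 0 < ε)
    (hk : ∀ t, 0 ≤ t → ‖k t‖ ≤ C * Real.exp (-ε * t)) (x : H) :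
    Tendsto (fun t => k t x) atTop (𝓝 0) := by
  have h1 : Tendsto (fun t : ℝ => C * Real.exp (-ε * |t|) * ‖x‖) atTop (𝓝 0) := by
    simpa using ((IsExpKernel.tendsto_exp_neg_mul_abs_cocompact hε C).mono_left
      atTop_le_cocompact).mul_const ‖x‖
  refine squeeze_zero_norm' ?_ h1
  filter_upwards [eventually_ge_atTop 0] with t ht
  rw [abs_of_nonneg ht]
  exact (k t).le_of_opNorm_le (hk t ht) x

namespace IsUnstableFlow

omit [CompleteSpace H] in
/-- The stable part of the semigroup as a homogeneous solution. -/
theorem sub_apply_apply (hE : IsUnstableFlow G E C ε) (hG : IsC0Semigroup G) {s h : ℝ}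
    (hs : 0 ≤ s) (hh : 0 ≤ h) (x : H) : G h (G s x - E s x) = G (s + h) x - E (s + h) x := by
  rw [map_sub, ← ContinuousLinearMap.comp_apply, ← ContinuousLinearMap.comp_apply,
    ← hG.map_add h s hh hs, hE.left s h hh, add_comm h s]

theorem continuousOn_sub (hE : IsUnstableFlow G E C ε) (hG : IsC0Semigroup G) (x : H) :
    ContinuousOn (fun t => G t x - E t x) (Ici 0) :=
  (hG.strong_cont x).sub
    ((hE.continuous_uncurry hG).comp (continuous_id.prodMk continuous_const)).continuousOn

theorem continuous_apply (hE : IsUnstableFlow G E C ε) (hG : IsC0Semigroup G) (x : H) :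
    Continuous fun t => E t x :=
  (hE.continuous_uncurry hG).comp (continuous_id.prodMk continuous_const)

omit [CompleteSpace H] in
theorem tendsto_sub_atTop (hE : IsUnstableFlow G E C ε) (x : H) :
    Tendsto (fun t => G t x - E t x) atTop (𝓝 0) :=
  tendsto_exp_neg_apply_atTop (k := fun t => G t - E t) hE.pos hE.bound_pos x

omit [CompleteSpace H] in
theorem tendsto_neg_atTop (hE : IsUnstableFlow G E C ε) (x : H) :
    Tendsto (fun t => E (-t) x) atTop (𝓝 0) :=
  tendsto_exp_neg_apply_atTop (k := fun t => E (-t)) hE.pos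
    (fun t ht => by simpa using hE.bound_neg (-t) (by linarith)) x

end IsUnstableFlow

/-- Every vector of the phase space is the jump at zero of a solution decaying at both ends of the
time axis. -/
theorem exists_jump_solution {A : H →ₗ.[ℝ] H} (hA : IsGenerator A G) (hG : IsC0Semigroup G)
    (hE : IsUnstableFlow G E C ε) (hF₃ : IsUnit F₃) (hF₃s : IsSelfAdjoint F₃)
    (hfreq : FrequencyCondition A B F₁ F₂ F₃) (p q : H) :
    ∃ v η v' η' : ℝ → H, SolvesOn G B F₁ F₂ F₃ (Ici 0) v η ∧ Tendsto v atTop (𝓝 0) ∧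
      Tendsto η atTop (𝓝 0) ∧ SolvesOn G B F₁ F₂ F₃ (Iic 0) v' η' ∧ Tendsto v' atBot (𝓝 0) ∧
      Tendsto η' atBot (𝓝 0) ∧ v 0 - v' 0 = p ∧ η 0 - η' 0 = q := by
  have hk := hE.isExpKernel_green hG
  have hk' := hE.isExpKernel_greenRev hG
  have hGa := hG.adjoint
  have hEa := hE.adjoint
  -- The added terms are Γ(t)p and -Γ(-t)*q. The convolutions are continuous, so the only jumps at
  -- zero are p and q.
  obtain ⟨f, g, hf, hg, -, hfg⟩ := exists_control hA hG hE B F₁ F₂ F₃ hfreq MeasurableSet.univ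
    (hk.memLp_apply p) (hk'.memLp_apply q).neg
  have key : ∀ᵐ t, hamV B F₂ F₃ (green G E t p + kernelConv (green G E) f t)
      (-greenRev G E t q - kernelConv (greenRev G E) g t) = f t ∧
      hamEta B F₁ F₂ F₃ (green G E t p + kernelConv (green G E) f t)
      (-greenRev G E t q - kernelConv (greenRev G E) g t) = g t := by
    filter_upwards [hfg] with t ht
    obtain ⟨ξ, h1, h2, h3⟩ := ht (mem_univ t)
    simp only [Pi.neg_apply] at h3
    rw [hamV_of_control hF₃ B F₂ h3, hamEta_of_control hF₃ hF₃s B F₁ F₂ h3, h1, h2]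
    exact ⟨rfl, rfl⟩
  -- At zero itself the chosen branches of Γ(t) and Γ(-t)* belong to opposite half-lines; this null
  -- set is discarded.
  have hne : ∀ᵐ t : ℝ, t ≠ 0 := by simp [ae_iff]
  have hV := hk.tendsto_conv hf
  have hW := hk'.tendsto_conv hg
  refine ⟨fun t => (G t p - E t p) + kernelConv (green G E) f t,
    fun t => (E (-t)).adjoint q - kernelConv (greenRev G E) g t,
    fun t => -E t p + kernelConv (green G E) f t,
    fun t => -((G (-t)).adjoint q - (E (-t)).adjoint q) - kernelConv (greenRev G E) g t,
    ?_, ?_, ?_, ?_, ?_, ?_, ?_, ?_⟩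
  · refine solvesOn_of_conv hG hE ordConnected_Ici hf hg (hE.continuousOn_sub hG p)
      ((hEa.continuous_apply hGa q).comp continuous_neg).continuousOn
      (fun s hs t ht hst => ?_) (fun s hs t ht hst => ?_) ?_ ?_
    · rw [hE.sub_apply_apply hG hs (sub_nonneg.2 hst), add_sub_cancel]
    · rw [← ContinuousLinearMap.comp_apply, hEa.left (-t) (t - s) (sub_nonneg.2 hst)]
      congr 3; ring
    · filter_upwards [key, hne] with t h1 h2 h3
      rw [mem_Ici] at h3
      have h4 : -t < 0 := by have := lt_of_le_of_ne h3 h2.symm; linarith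
      rw [green_of_nonneg h3, greenRev, green_of_neg h4, map_neg] at h1
      simpa using h1.1
    · filter_upwards [key, hne] with t h1 h2 h3
      rw [mem_Ici] at h3
      have h4 : -t < 0 := by have := lt_of_le_of_ne h3 h2.symm; linarith
      rw [green_of_nonneg h3, greenRev, green_of_neg h4, map_neg] at h1
      simpa using h1.2
  · simpa using (hE.tendsto_sub_atTop p).add (hV.mono_left atTop_le_cocompact)
  · simpa using (hEa.tendsto_neg_atTop q).sub (hW.mono_left atTop_le_cocompact)
  · have hneg : ContinuousOn (fun t : ℝ => (G (-t)).adjoint q - (E (-t)).adjoint q) (Iic 0) :=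
      (hEa.continuousOn_sub hGa q).comp continuous_neg.continuousOn
        (fun t ht => by simpa using ht)
    refine solvesOn_of_conv hG hE ordConnected_Iic hf hg
      (hE.continuous_apply hG p).neg.continuousOn hneg.neg
      (fun s hs t ht hst => ?_) (fun s hs t ht hst => ?_) ?_ ?_
    · rw [map_neg, ← ContinuousLinearMap.comp_apply, hE.left s (t - s) (sub_nonneg.2 hst),
        add_sub_cancel]
    · rw [map_neg]
      rw [hEa.sub_apply_apply hGa (by simpa using ht) (sub_nonneg.2 hst)]
      rw [show -t + (t - s) = -s by ring]
    · filter_upwards [key, hne] with t h1 h2 h3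
      rw [mem_Iic] at h3
      have h4 : t < 0 := lt_of_le_of_ne h3 h2
      rw [green_of_neg h4, greenRev, green_of_nonneg (by linarith), map_sub] at h1
      simpa using h1.1
    · filter_upwards [key, hne] with t h1 h2 h3
      rw [mem_Iic] at h3
      have h4 : t < 0 := lt_of_le_of_ne h3 h2
      rw [green_of_neg h4, greenRev, green_of_nonneg (by linarith), map_sub] at h1
      simpa using h1.2
  · have := ((hE.tendsto_neg_atTop p).comp tendsto_neg_atBot_atTop).neg.add
      (hV.mono_left atBot_le_cocompact)
    simpa [Function.comp_def] using this
  · have := ((hEa.tendsto_sub_atTop q).comp tendsto_neg_atBot_atTop).neg.sub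
      (hW.mono_left atBot_le_cocompact)
    simpa [Function.comp_def] using this
  · simp [hG.map_zero]
  · simp [hG.map_zero, ContinuousLinearMap.adjoint_id]

/-- Up to a vector of the unstable subspace, every initial state starts a decaying solution. -/
theorem exists_halfline_solution {A : H →ₗ.[ℝ] H} (hA : IsGenerator A G) (hG : IsC0Semigroup G)
    (hE : IsUnstableFlow G E C ε) {Hu : Submodule ℝ H} [FiniteDimensional ℝ Hu]
    (hHu : ∀ t x, E t x ∈ Hu)
    (hF₃ : IsUnit F₃) (hF₃s : IsSelfAdjoint F₃)
    (hfreq : FrequencyCondition A B F₁ F₂ F₃) (p : H) :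
    ∃ v η : ℝ → H, SolvesOn G B F₁ F₂ F₃ (Ici 0) v η ∧ Tendsto v atTop (𝓝 0) ∧
      Tendsto η atTop (𝓝 0) ∧ p - v 0 ∈ Hu := by
  have hk := hE.isExpKernel_green hG
  have hk' := hE.isExpKernel_greenRev hG
  -- The control is confined to [0, ∞) and no term is added to the costate. This leaves the value of
  -- the state at zero prescribed up to unstable vectors.
  obtain ⟨f, g, hf, hg, hf0, hfg⟩ := exists_control hA hG hE B F₁ F₂ F₃ hfreq
    (measurableSet_Ici (a := (0 : ℝ))) (hk.memLp_apply p) (MemLp.zero (ε := H))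
  have key : ∀ᵐ t, t ∈ Ici (0 : ℝ) → hamV B F₂ F₃ ((G t p - E t p) + kernelConv (green G E) f t)
      (0 - kernelConv (greenRev G E) g t) = f t ∧
      hamEta B F₁ F₂ F₃ ((G t p - E t p) + kernelConv (green G E) f t)
      (0 - kernelConv (greenRev G E) g t) = g t := by
    filter_upwards [hfg] with t ht ht0
    obtain ⟨ξ, h1, h2, h3⟩ := ht ht0
    rw [green_of_nonneg ht0] at h2 h3
    simp only [Pi.zero_apply] at h3
    rw [← sub_apply, hamV_of_control hF₃ B F₂ h3,
      hamEta_of_control hF₃ hF₃s B F₁ F₂ h3, h1, h2]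
    exact ⟨rfl, rfl⟩
  refine ⟨fun t => (G t p - E t p) + kernelConv (green G E) f t,
    fun t => 0 - kernelConv (greenRev G E) g t, ?_, ?_, ?_, ?_⟩
  · refine solvesOn_of_conv hG hE ordConnected_Ici hf hg (hE.continuousOn_sub hG p)
      continuousOn_const (fun s hs t ht hst => ?_) (fun s hs t ht hst => ?_) ?_ ?_
    · rw [hE.sub_apply_apply hG hs (sub_nonneg.2 hst), add_sub_cancel]
    · simp
    · filter_upwards [key] with t h1 h2 using (h1 h2).1
    · filter_upwards [key] with t h1 h2 using (h1 h2).2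
  · simpa using (hE.tendsto_sub_atTop p).add ((hk.tendsto_conv hf).mono_left atTop_le_cocompact)
  · simpa using ((hk'.tendsto_conv hg).mono_left atTop_le_cocompact).const_sub 0
  -- As `f` vanishes at negative times, the convolution at zero is -∫ E(-s) f(s) ds over s > 0. The
  -- integral is kept in `Hu` by testing it against the orthogonal complement.
  · have h1 : kernelConv (green G E) f 0 ∈ Hu := by
      have hne : ∀ᵐ t : ℝ, t ≠ 0 := by simp [ae_iff]
      rw [← Submodule.orthogonal_orthogonal Hu, Submodule.mem_orthogonal]
      intro w hw
      rw [kernelConv, ← integral_inner (hk.integrable_conv hf 0) w]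
      refine integral_eq_zero_of_ae ?_
      filter_upwards [hf0, hne] with s h1 h2
      rw [Pi.zero_apply, real_inner_comm]
      refine (Submodule.mem_orthogonal Hu w).1 hw _ ?_
      by_cases h3 : s ∈ Ici (0 : ℝ)
      · have h4 : 0 - s < 0 := by have := lt_of_le_of_ne h3 h2.symm; linarith
        rw [green_of_neg h4]
        exact Hu.neg_mem (hHu _ _)
      · rw [h1 h3, map_zero]
        exact Hu.zero_mem
    have h2 : p - ((G 0 p - E 0 p) + kernelConv (green G E) f 0) =
        E 0 p - kernelConv (green G E) f 0 := by
      rw [hG.map_zero, ContinuousLinearMap.id_apply]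
      abel
    simp only [h2]
    exact Hu.sub_mem (hHu 0 p) h1

end Solutions


/-! ### Conservation of the symplectic form -/

section Symplectic

variable {H U : Type*} [NormedAddCommGroup H] [InnerProductSpace ℝ H] [CompleteSpace H]
  [NormedAddCommGroup U] [InnerProductSpace ℝ U] [CompleteSpace U]

/-- The form of averaging met in the backward Cauchy formula. The integrand does not depend on the
upper limit, so the fundamental theorem of calculus applies directly. -/
theorem IsC0Semigroup.tendsto_average_left {G : ℝ → H →L[ℝ] H} (hG : IsC0Semigroup G) {f : ℝ → H}
    (hf : Continuous f) (t : ℝ) :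
    Tendsto (fun y : ℝ => (y - t)⁻¹ • ∫ θ in t..y, G (θ - t) (f θ)) (𝓝[>] t) (𝓝 (f t)) := by
  have hc : Continuous fun θ => G (max (θ - t) 0) (f θ) :=
    hG.continuous_uncurry.comp ((continuous_id.sub continuous_const).prodMk hf)
  have hd : HasDerivWithinAt (fun y => ∫ θ in t..y, G (max (θ - t) 0) (f θ))
      (G (max (t - t) 0) (f t)) (Ioi t) t :=
    (intervalIntegral.integral_hasDerivAt_right (hc.intervalIntegrable _ _)
      (hc.stronglyMeasurableAtFilter _ _) hc.continuousAt).hasDerivWithinAt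
  rw [hasDerivWithinAt_iff_tendsto_slope' (by simp)] at hd
  simp only [sub_self, max_self, hG.map_zero, ContinuousLinearMap.id_apply] at hd
  refine hd.congr' ?_
  filter_upwards [self_mem_nhdsWithin] with y (hy : t < y)
  rw [slope_def_module, intervalIntegral.integral_same, sub_zero]
  congr 1
  refine intervalIntegral.integral_congr fun θ hθ => ?_
  rw [uIcc_of_le hy.le] at hθ
  rw [max_eq_left (by linarith [hθ.1])]

/-- Product rule for the pairing of a forward and a backward mild solution. -/
theorem IsC0Semigroup.hasDerivWithinAt_inner {G : ℝ → H →L[ℝ] H} (hG : IsC0Semigroup G)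
    {a b : ℝ} {v η f g : ℝ → H} (hf : Continuous f) (hg : Continuous g)
    (hη : ContinuousOn η (Icc a b))
    (hv : ∀ s ∈ Icc a b, ∀ t ∈ Icc a b, s ≤ t →
      v t = G (t - s) (v s) + ∫ θ in s..t, G (t - θ) (f θ))
    (hη' : ∀ s ∈ Icc a b, ∀ t ∈ Icc a b, s ≤ t →
      η s = (G (t - s)).adjoint (η t) - ∫ θ in s..t, (G (θ - s)).adjoint (g θ))
    {t : ℝ} (ht : t ∈ Ico a b) :
    HasDerivWithinAt (fun t => inner ℝ (v t) (η t)) (inner ℝ (f t) (η t) + inner ℝ (v t) (g t))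
      (Ici t) t := by
  have hta : t ∈ Icc a b := Ico_subset_Icc_self ht
  rw [← hasDerivWithinAt_Ioi_iff_Ici, hasDerivWithinAt_iff_tendsto_slope' (by simp)]
  have hsub : Tendsto (fun y => y - t) (𝓝[>] t) (𝓝[>] 0) := by
    refine tendsto_nhdsWithin_iff.2 ⟨?_, ?_⟩
    · have : Continuous fun y : ℝ => y - t := by fun_prop
      simpa using (this.tendsto t).mono_left nhdsWithin_le_nhds
    · filter_upwards [self_mem_nhdsWithin] with y (hy : t < y)
      exact sub_pos.2 hy
  have l1 : Tendsto (fun y : ℝ => (y - t)⁻¹ • ∫ θ in t..y, G (y - θ) (f θ)) (𝓝[>] t) (𝓝 (f t)) := by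
    simpa [Function.comp_def] using (hG.tendsto_average hf t).comp hsub
  have l2 := hG.adjoint.tendsto_average_left hg t
  have l3 : Tendsto η (𝓝[>] t) (𝓝 (η t)) := by
    refine (hη t hta).mono_left ?_
    rw [← nhdsWithin_Ioc_eq_nhdsGT ht.2]
    exact nhdsWithin_mono _ fun y hy => ⟨ht.1.trans hy.1.le, hy.2⟩
  -- The increment of the pairing is ⟨v(y) - G(y-t)v(t), η(y)⟩ + ⟨v(t), G(y-t)*η(y) - η(t)⟩. The
  -- semigroup terms cancel, so neither function has to lie in the domain of a generator.
  have l4 := (Tendsto.inner (𝕜 := ℝ) l1 l3).add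
    (Tendsto.inner (𝕜 := ℝ) (tendsto_const_nhds (x := v t)) l2)
  refine l4.congr' ?_
  filter_upwards [Ioc_mem_nhdsGT ht.2] with y hy
  have hyI : y ∈ Icc a b := ⟨ht.1.trans hy.1.le, hy.2⟩
  have e1 := hv t hta y hyI hy.1.le
  have e2 := hη' t hta y hyI hy.1.le
  have e3 : ∫ θ in t..y, (G (θ - t)).adjoint (g θ) = (G (y - t)).adjoint (η y) - η t := by
    rw [e2]; abel
  have e4 : ∫ θ in t..y, G (y - θ) (f θ) = v y - G (y - t) (v t) := by
    rw [e1]; abel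
  rw [slope_def_module, e3, e4, real_inner_smul_left, real_inner_smul_right, smul_eq_mul,
    inner_sub_left, inner_sub_right, ContinuousLinearMap.adjoint_inner_right]
  ring

variable {G : ℝ → H →L[ℝ] H} {B : U →L[ℝ] H} {F₁ : H →L[ℝ] H} {F₂ : H →L[ℝ] U}
  {F₃ : U →L[ℝ] U}

/-- The infinitesimal form of symplectic invariance: the blocks F₁ - F₂*F₃⁻¹F₂ and BF₃⁻¹B* are
self-adjoint, and the diagonal blocks -BF₃⁻¹F₂ and (BF₃⁻¹F₂)* are negative adjoints of each other.
-/
theorem ham_symmetric (hF₁ : IsSelfAdjoint F₁) (hF₃ : IsSelfAdjoint F₃) (v η v' η' : H) :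
    inner ℝ (hamV B F₂ F₃ v η) η' + inner ℝ v (hamEta B F₁ F₂ F₃ v' η') =
      inner ℝ (hamV B F₂ F₃ v' η') η + inner ℝ v' (hamEta B F₁ F₂ F₃ v η) := by
  have h3 := adjoint_ringInverse hF₃
  have s3 : ∀ x y : U, inner ℝ (Ring.inverse F₃ x) y = inner ℝ (Ring.inverse F₃ y) x :=
    fun x y => by
      rw [← ContinuousLinearMap.adjoint_inner_right, h3, real_inner_comm]
  have s1 : ∀ x y : H, inner ℝ x (F₁ y) = inner ℝ y (F₁ x) := fun x y => by
    have := ContinuousLinearMap.adjoint_inner_left F₁ x y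
    rw [← ContinuousLinearMap.star_eq_adjoint, hF₁.star_eq] at this
    rw [← this, real_inner_comm]
  simp only [hamV, hamEta, inner_add_left, inner_add_right, inner_sub_right, inner_neg_left,
    ContinuousLinearMap.adjoint_inner_right, ContinuousLinearMap.comp_apply]
  have r1 : ∀ (u : U) (y : H), inner ℝ (B u) y = inner ℝ u (B.adjoint y) := fun u y =>
    (ContinuousLinearMap.adjoint_inner_right B u y).symm
  simp only [r1]
  rw [s1 v v', s3 (B.adjoint η) (B.adjoint η'), real_inner_comm _ (F₂ v),
    s3 (F₂ v') (F₂ v), real_inner_comm _ (F₂ v')]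
  ring

theorem continuous_hamV {v η : ℝ → H} (hv : Continuous v) (hη : Continuous η) :
    Continuous fun t => hamV B F₂ F₃ (v t) (η t) :=
  have hR : Continuous ((Ring.inverse F₃ : U →L[ℝ] U)) := ContinuousLinearMap.continuous _
  (B.continuous.comp (hR.comp (F₂.continuous.comp hv))).neg.add
    (B.continuous.comp (hR.comp (B.adjoint.continuous.comp hη)))

theorem continuous_hamEta {v η : ℝ → H} (hv : Continuous v) (hη : Continuous η) :
    Continuous fun t => hamEta B F₁ F₂ F₃ (v t) (η t) :=
  have hR : Continuous ((Ring.inverse F₃ : U →L[ℝ] U)) := ContinuousLinearMap.continuous _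
  ((F₁.continuous.comp hv).sub
    (F₂.adjoint.continuous.comp (hR.comp (F₂.continuous.comp hv)))).add
    ((B.comp ((Ring.inverse F₃).comp F₂)).adjoint.continuous.comp hη)

/-- The symplectic form is constant along pairs of solutions of the Hamiltonian system. -/
theorem SolvesOn.symplectic_const (hG : IsC0Semigroup G) (hF₁ : IsSelfAdjoint F₁)
    (hF₃ : IsSelfAdjoint F₃) {I : Set ℝ} {v η v' η' : ℝ → H}
    (h : SolvesOn G B F₁ F₂ F₃ I v η) (h' : SolvesOn G B F₁ F₂ F₃ I v' η') {a b : ℝ}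
    (hab : a ≤ b) (hI : Icc a b ⊆ I) :
    inner ℝ (v b) (η' b) - inner ℝ (v' b) (η b) = inner ℝ (v a) (η' a) - inner ℝ (v' a) (η a) := by
  -- The product rule asks for forcing terms continuous on the whole line, so the solutions are
  -- frozen outside `[a, b]`.
  have hproj : ∀ w : ℝ → H, ContinuousOn w I → Continuous fun t => w (projIcc a b hab t) :=
    fun w hw => (hw.mono hI).comp_continuous (by fun_prop) fun t => (projIcc a b hab t).2
  have hpe : ∀ t ∈ Icc a b, (projIcc a b hab t : ℝ) = t := fun t ht => by
    rw [projIcc_of_mem hab ht]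
  have key : ∀ v η v' η' : ℝ → H, SolvesOn G B F₁ F₂ F₃ I v η → SolvesOn G B F₁ F₂ F₃ I v' η' →
      ∀ t ∈ Ico a b, HasDerivWithinAt (fun t => inner ℝ (v t) (η' t))
        (inner ℝ (hamV B F₂ F₃ (v t) (η t)) (η' t) +
          inner ℝ (v t) (hamEta B F₁ F₂ F₃ (v' t) (η' t))) (Ici t) t := by
    intro v η v' η' h h' t ht
    have c1 := hproj v h.cont_v
    have c2 := hproj η h.cont_eta
    have c3 := hproj v' h'.cont_v
    have c4 := hproj η' h'.cont_eta
    have hf : Continuous fun t => hamV B F₂ F₃ (v (projIcc a b hab t)) (η (projIcc a b hab t)) :=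
      continuous_hamV c1 c2
    have hg : Continuous fun t =>
        hamEta B F₁ F₂ F₃ (v' (projIcc a b hab t)) (η' (projIcc a b hab t)) :=
      continuous_hamEta c3 c4
    have := hG.hasDerivWithinAt_inner (a := a) (b := b) (v := v) (η := η') hf hg
      (h'.cont_eta.mono hI) (fun s hs t ht hst => ?_) (fun s hs t ht hst => ?_) ht
    · simpa only [hpe t (Ico_subset_Icc_self ht)] using this
    · rw [h.eq_v s (hI hs) t (hI ht) hst]
      congr 1
      refine intervalIntegral.integral_congr fun θ hθ => ?_
      rw [uIcc_of_le hst] at hθ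
      rw [hpe θ ⟨hs.1.trans hθ.1, hθ.2.trans ht.2⟩]
    · rw [h'.eq_eta s (hI hs) t (hI ht) hst]
      congr 1
      refine intervalIntegral.integral_congr fun θ hθ => ?_
      rw [uIcc_of_le hst] at hθ
      rw [hpe θ ⟨hs.1.trans hθ.1, hθ.2.trans ht.2⟩]
  have := constant_of_has_deriv_right_zero (a := a) (b := b)
    (f := fun t => inner ℝ (v t) (η' t) - inner ℝ (v' t) (η t))
    ((((h.cont_v.mono hI).inner (h'.cont_eta.mono hI))).sub
      ((h'.cont_v.mono hI).inner (h.cont_eta.mono hI)))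
    (fun t ht => by
      have d := (key v η v' η' h h' t ht).sub (key v' η' v η h' h t ht)
      rwa [ham_symmetric hF₁ hF₃, sub_self] at d)
  exact this b ⟨hab, le_rfl⟩

omit [CompleteSpace H] in
-- Only one of the two solutions has to decay, so solutions that are merely bounded can be tested
-- against decaying ones.
theorem tendsto_symplectic {l : Filter ℝ} {v η v' η' : ℝ → H} {C : ℝ}
    (hC : ∀ᶠ t in l, ‖v t‖ ≤ C ∧ ‖η t‖ ≤ C) (hv' : Tendsto v' l (𝓝 0)) (hη' : Tendsto η' l (𝓝 0)) :
    Tendsto (fun t => inner ℝ (v t) (η' t) - inner ℝ (v' t) (η t)) l (𝓝 0) := by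
  have h1 : Tendsto (fun t => C * ‖η' t‖ + ‖v' t‖ * C) l (𝓝 0) := by
    simpa using (hη'.norm.const_mul C).add (hv'.norm.mul_const C)
  refine squeeze_zero_norm' ?_ h1
  filter_upwards [hC] with t ht
  refine (norm_sub_le _ _).trans (add_le_add ?_ ?_)
  · exact (norm_inner_le_norm _ _).trans (mul_le_mul_of_nonneg_right ht.1 (norm_nonneg _))
  · exact (norm_inner_le_norm _ _).trans (mul_le_mul_of_nonneg_left ht.2 (norm_nonneg _))

theorem SolvesOn.symplectic_eq_zero_atTop (hG : IsC0Semigroup G) (hF₁ : IsSelfAdjoint F₁)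
    (hF₃ : IsSelfAdjoint F₃) {v η v' η' : ℝ → H}
    (h : SolvesOn G B F₁ F₂ F₃ (Ici 0) v η) (h' : SolvesOn G B F₁ F₂ F₃ (Ici 0) v' η') {C : ℝ}
    (hC : ∀ t, 0 ≤ t → ‖v t‖ ≤ C ∧ ‖η t‖ ≤ C) (hv' : Tendsto v' atTop (𝓝 0))
    (hη' : Tendsto η' atTop (𝓝 0)) : inner ℝ (v 0) (η' 0) - inner ℝ (v' 0) (η 0) = 0 := by
  have h1 := tendsto_symplectic ((eventually_ge_atTop 0).mono hC) hv' hη'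
  refine tendsto_nhds_unique (tendsto_const_nhds.congr' ?_) h1
  filter_upwards [eventually_ge_atTop 0] with t ht
  exact (h.symplectic_const hG hF₁ hF₃ h' ht Icc_subset_Ici_self).symm

theorem SolvesOn.symplectic_eq_zero_atBot (hG : IsC0Semigroup G) (hF₁ : IsSelfAdjoint F₁)
    (hF₃ : IsSelfAdjoint F₃) {v η v' η' : ℝ → H}
    (h : SolvesOn G B F₁ F₂ F₃ (Iic 0) v η) (h' : SolvesOn G B F₁ F₂ F₃ (Iic 0) v' η')
    (hv : Tendsto v atBot (𝓝 0)) (hη : Tendsto η atBot (𝓝 0)) (hv' : Tendsto v' atBot (𝓝 0))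
    (hη' : Tendsto η' atBot (𝓝 0)) : inner ℝ (v 0) (η' 0) - inner ℝ (v' 0) (η 0) = 0 := by
  have hb : ∀ w : ℝ → H, Tendsto w atBot (𝓝 0) → ∀ᶠ t in atBot, ‖w t‖ ≤ 1 := fun w hw => by
    have := hw.norm.eventually (gt_mem_nhds (show ‖(0 : H)‖ < 1 by simp))
    exact this.mono fun t ht => ht.le
  have h1 := tendsto_symplectic ((hb v hv).and (hb η hη)) hv' hη'
  refine tendsto_nhds_unique (tendsto_const_nhds.congr' ?_) h1
  filter_upwards [eventually_le_atBot 0] with t ht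
  exact h.symplectic_const hG hF₁ hF₃ h' ht Icc_subset_Iic_self

theorem exists_bound_of_tendsto_zero {H : Type*} [NormedAddCommGroup H] {w : ℝ → H} (hc : ContinuousOn w (Ici 0))
    (hw : Tendsto w atTop (𝓝 0)) : ∃ C, ∀ t, 0 ≤ t → ‖w t‖ ≤ C := by
  have h1 := hw.norm.eventually (gt_mem_nhds (show ‖(0 : H)‖ < 1 by simp))
  obtain ⟨T, hT⟩ := eventually_atTop.1 h1
  obtain ⟨C, hC⟩ := (isCompact_Icc (a := (0 : ℝ)) (b := T)).exists_bound_of_continuousOn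
    (hc.mono Icc_subset_Ici_self)
  refine ⟨max C 1, fun t ht => ?_⟩
  rcases le_total t T with h | h
  · exact (hC t ⟨ht, h⟩).trans (le_max_left _ _)
  · exact (hT t h).le.trans (le_max_right _ _)

theorem mem_stableSubspace_of_tendsto {v η : ℝ → H} (h : SolvesOn G B F₁ F₂ F₃ (Ici 0) v η)
    (hv : Tendsto v atTop (𝓝 0)) (hη : Tendsto η atTop (𝓝 0)) :
    WithLp.toLp 2 (v 0, η 0) ∈ stableSubspace G B F₁ F₂ F₃ := by
  obtain ⟨C, hC⟩ := exists_bound_of_tendsto_zero h.cont_v hv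
  obtain ⟨C', hC'⟩ := exists_bound_of_tendsto_zero h.cont_eta hη
  exact ⟨v, η, isMildSolution_iff.2 h, rfl, rfl, max C C', fun t ht =>
    ⟨(hC t ht).trans (le_max_left _ _), (hC' t ht).trans (le_max_right _ _)⟩⟩

end Symplectic

/-! ### Lagrange subspaces and Fredholm pairs -/

section Lagrange

variable {H : Type*} [NormedAddCommGroup H] [InnerProductSpace ℝ H]

theorem inner_complexStructure (x y : WithLp 2 (H × H)) :
    inner ℝ (complexStructure H x) y = inner ℝ x.fst y.snd - inner ℝ y.fst x.snd := by
  rw [WithLp.prod_inner_apply]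
  change inner ℝ (-x.snd) y.fst + inner ℝ x.fst y.snd = _
  rw [inner_neg_left, real_inner_comm]
  ring

theorem inner_complexStructure_right (x y : WithLp 2 (H × H)) :
    inner ℝ x (complexStructure H y) = - inner ℝ (complexStructure H x) y := by
  rw [real_inner_comm, inner_complexStructure, inner_complexStructure]
  ring

theorem complexStructure_complexStructure (x : WithLp 2 (H × H)) :
    complexStructure H (complexStructure H x) = -x := by
  apply WithLp.ofLp_injective
  ext <;> simp [complexStructure]

theorem complexStructure_injective : Function.Injective (complexStructure H) := fun x y h => by
  have := congrArg (complexStructure H) h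
  rwa [complexStructure_complexStructure, complexStructure_complexStructure, neg_inj] at this

/-- A subspace that is isotropic and contains its symplectic complement is Lagrange. -/
theorem isLagrange_of_forall {L : Submodule ℝ (WithLp 2 (H × H))}
    (h : ∀ x, x ∈ L ↔ ∀ y ∈ L, inner ℝ (complexStructure H x) y = 0) : IsLagrange L := by
  refine le_antisymm ?_ fun y hy => ?_
  · rintro _ ⟨x, hx, rfl⟩
    rw [Submodule.mem_orthogonal']
    exact (h x).1 hx
  · refine ⟨-complexStructure H y, ?_, ?_⟩
    · refine (h _).2 fun l hl => ?_
      rw [map_neg, complexStructure_complexStructure, neg_neg]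
      exact (Submodule.mem_orthogonal' L y).1 hy l hl
    · rw [map_neg, complexStructure_complexStructure, neg_neg]

/-- Lagrange property from a splitting of the phase space into isotropic pieces. -/
theorem isLagrange_of_splitting {L : Submodule ℝ (WithLp 2 (H × H))} {L₀ M : Set (WithLp 2 (H × H))}
    (hL₀ : L₀ ⊆ L) (hspan : ∀ x, ∃ a ∈ L₀, ∃ b ∈ M, x = a - b)
    (hLL : ∀ x ∈ L, ∀ y ∈ L₀, inner ℝ (complexStructure H x) y = 0)
    (hMM : ∀ x ∈ M, ∀ y ∈ M, inner ℝ (complexStructure H x) y = 0) : IsLagrange L := by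
  -- Write x = a - b. Both x and a annihilate `L₀`, hence so does b; as b also annihilates `M`, it
  -- annihilates everything and vanishes by nondegeneracy.
  have key : ∀ x, (∀ y ∈ L₀, inner ℝ (complexStructure H x) y = 0) → x ∈ L₀ := by
    intro x hx
    obtain ⟨a, ha, b, hb, rfl⟩ := hspan x
    have hbL : ∀ y ∈ L₀, inner ℝ (complexStructure H b) y = 0 := fun y hy => by
      have h1 := hx y hy
      rw [map_sub, inner_sub_left, hLL a (hL₀ ha) y hy, zero_sub, neg_eq_zero] at h1
      exact h1
    have hb0 : complexStructure H b = 0 := by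
      refine ext_inner_right ℝ fun y => ?_
      obtain ⟨a', ha', b', hb', rfl⟩ := hspan y
      rw [inner_sub_right, hbL a' ha', hMM b hb b' hb', sub_zero, inner_zero_left]
    have : b = 0 := complexStructure_injective (by rw [hb0, map_zero])
    rwa [this, sub_zero]
  -- For the Hamiltonian system: initial data of bounded solutions are already initial data of
  -- decaying ones.
  have hLeq : ∀ x ∈ L, x ∈ L₀ := fun x hx => key x (hLL x hx)
  refine isLagrange_of_forall fun x => ⟨fun hx y hy => hLL x hx y (hLeq y hy), fun hx => ?_⟩
  exact hL₀ (key x fun y hy => hx y (hL₀ hy))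

/-- Since J is skew with J² = -1, a Lagrange subspace is itself an orthogonal complement, namely
that of its image under J. -/
theorem IsLagrange.isClosed {L : Submodule ℝ (WithLp 2 (H × H))} (h : IsLagrange L) :
    IsClosed (L : Set (WithLp 2 (H × H))) := by
  have : L = (L.map (complexStructure H))ᗮ := by
    ext x
    rw [Submodule.mem_orthogonal']
    constructor
    · rintro hx _ ⟨y, hy, rfl⟩
      have h1 : complexStructure H x ∈ Lᗮ := h ▸ Submodule.mem_map_of_mem hx
      rw [inner_complexStructure_right, (Submodule.mem_orthogonal' L _).1 h1 y hy, neg_zero]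
    · intro hx
      have h1 : complexStructure H x ∈ Lᗮ := (Submodule.mem_orthogonal' L _).2 fun y hy => by
        have := hx _ (Submodule.mem_map_of_mem hy)
        rwa [inner_complexStructure_right, neg_eq_zero] at this
      rw [← h] at h1
      obtain ⟨y, hy, hxy⟩ := h1
      rwa [← complexStructure_injective hxy]
  rw [this]
  exact Submodule.isClosed_orthogonal _

theorem mem_verticalSubspace {x : WithLp 2 (H × H)} : x ∈ verticalSubspace H ↔ x.fst = 0 := Iff.rfl

theorem isLagrange_verticalSubspace : IsLagrange (verticalSubspace H) := by
  refine isLagrange_of_forall fun x => ⟨fun hx y hy => ?_, fun hx => ?_⟩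
  · rw [mem_verticalSubspace] at hx hy
    rw [inner_complexStructure, hx, hy, inner_zero_left, inner_zero_left, sub_zero]
  · rw [mem_verticalSubspace]
    have := hx (WithLp.toLp 2 (0, x.fst)) (mem_verticalSubspace.2 rfl)
    rw [inner_complexStructure] at this
    simpa using this

/-- The intersection of Lagrange subspaces embeds into the quotient by their sum. -/
theorem IsLagrange.injective_inf_to_quotient {L M : Submodule ℝ (WithLp 2 (H × H))}
    (hL : IsLagrange L) (hM : IsLagrange M) :
    Function.Injective ((L ⊔ M).mkQ.comp ((complexStructure H).comp (L ⊓ M).subtype)) := by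
  rw [injective_iff_map_eq_zero]
  rintro ⟨x, hx⟩ h
  rw [LinearMap.comp_apply, LinearMap.comp_apply, Submodule.mkQ_apply,
    Submodule.Quotient.mk_eq_zero, Submodule.subtype_apply] at h
  -- J sends the intersection into the orthogonal complement of the sum, which meets the sum only in
  -- zero.
  have h1 : complexStructure H x ∈ (L ⊔ M)ᗮ := by
    rw [← Submodule.inf_orthogonal]
    exact ⟨hL ▸ Submodule.mem_map_of_mem hx.1, hM ▸ Submodule.mem_map_of_mem hx.2⟩
  have h2 : complexStructure H x = 0 := by
    rw [← inner_self_eq_zero (𝕜 := ℝ)]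
    exact (Submodule.mem_orthogonal _ _).1 h1 _ h
  exact Subtype.ext (complexStructure_injective (h2.trans (map_zero _).symm))

/-- In a Banach space, a sum of closed subspaces with finite codimension is closed. -/
theorem isClosed_sup_of_finite_codim {E : Type*} [NormedAddCommGroup E] [NormedSpace ℝ E]
    [CompleteSpace E] {L M : Submodule ℝ E} (hL : IsClosed (L : Set E)) (hM : IsClosed (M : Set E))
    [FiniteDimensional ℝ (E ⧸ (L ⊔ M))] : IsClosed ((L ⊔ M : Submodule ℝ E) : Set E) := by
  obtain ⟨N, hN⟩ := Submodule.exists_isCompl (L ⊔ M)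
  have : FiniteDimensional ℝ N :=
    (Submodule.quotientEquivOfIsCompl (L ⊔ M) N hN).finiteDimensional
  have : CompleteSpace L := hL.completeSpace_coe
  have : CompleteSpace M := hM.completeSpace_coe
  let T : ((L × M) × N) →L[ℝ] E := (L.subtypeL.coprod M.subtypeL).coprod N.subtypeL
  have hT : ∀ x, T x = (x.1.1 : E) + x.1.2 + x.2 := fun x => rfl
  have hsurj : Function.Surjective T := fun x => by
    obtain ⟨y, hy, n, hn, rfl⟩ := Submodule.mem_sup.1
      (show x ∈ (L ⊔ M) ⊔ N by rw [hN.sup_eq_top]; trivial)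
    obtain ⟨l, hl, m, hm, rfl⟩ := Submodule.mem_sup.1 hy
    exact ⟨((⟨l, hl⟩, ⟨m, hm⟩), ⟨n, hn⟩), rfl⟩
  -- By the open mapping theorem `T` is a quotient map, so closedness may be tested on the preimage,
  -- which is the closed kernel of the `N` coordinate.
  rw [← (T.isOpenMap hsurj).isQuotientMap T.continuous hsurj |>.isClosed_preimage]
  have : T ⁻¹' ((L ⊔ M : Submodule ℝ E) : Set E) = {x | x.2 = 0} := by
    ext x
    have hlm : (x.1.1 : E) + x.1.2 ∈ L ⊔ M := Submodule.add_mem_sup x.1.1.2 x.1.2.2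
    simp only [mem_preimage, SetLike.mem_coe, mem_ofPred_eq, hT]
    rw [Submodule.add_mem_iff_right _ hlm]
    constructor
    · intro h
      exact Subtype.ext (Submodule.disjoint_def.1 hN.disjoint _ h x.2.2)
    · intro h
      rw [h]
      exact Submodule.zero_mem _
  rw [this]
  exact isClosed_eq continuous_snd continuous_const

end Lagrange

end FredPair

theorem mainTheorem7 {H U : Type*}
    [NormedAddCommGroup H] [InnerProductSpace ℝ H] [CompleteSpace H]
    [NormedAddCommGroup U] [InnerProductSpace ℝ U] [CompleteSpace U]
    (A : H →ₗ.[ℝ] H) (G : ℝ → H →L[ℝ] H) (j : ℕ)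
    (hG : FredPair.IsC0Semigroup G) (hA : FredPair.IsGenerator A G)
    (hdich : FredPair.HasExpDichotomy G j)
    (B : U →L[ℝ] H) (F₁ : H →L[ℝ] H) (F₂ : H →L[ℝ] U) (F₃ : U →L[ℝ] U)
    (hF₁ : IsSelfAdjoint F₁) (hF₃ : IsSelfAdjoint F₃) (hF₃unit : IsUnit F₃)
    (hF₃pos : ∃ δ : ℝ, 0 < δ ∧ ∀ ξ : U, δ * ‖ξ‖ ^ 2 ≤ inner ℝ (F₃ ξ) ξ)
    (hfreq : FredPair.FrequencyCondition A B F₁ F₂ F₃) :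
    FredPair.IsLagrange (FredPair.stableSubspace G B F₁ F₂ F₃) ∧
    FredPair.IsLagrange (FredPair.verticalSubspace H) ∧
    Module.rank ℝ ↥(FredPair.stableSubspace G B F₁ F₂ F₃ ⊓ FredPair.verticalSubspace H)
      ≤ (j : Cardinal) ∧
    IsClosed ((FredPair.stableSubspace G B F₁ F₂ F₃ ⊔ FredPair.verticalSubspace H :
      Submodule ℝ (WithLp 2 (H × H))) : Set (WithLp 2 (H × H))) ∧
    Module.rank ℝ (WithLp 2 (H × H) ⧸
      (FredPair.stableSubspace G B F₁ F₂ F₃ ⊔ FredPair.verticalSubspace H))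
      ≤ (j : Cardinal) ∧
    FredPair.IsFredholmPair (FredPair.stableSubspace G B F₁ F₂ F₃)
      (FredPair.verticalSubspace H) := by
  obtain ⟨E, C, ε, Hu, hfd, hj, hE, hHu⟩ := hdich.exists_unstableFlow hG
  set L := FredPair.stableSubspace G B F₁ F₂ F₃ with hLdef
  set V := FredPair.verticalSubspace H with hVdef
  have hL : FredPair.IsLagrange L := by
    -- `L₀` and `M` are the values at zero of solutions decaying at +∞ and at -∞.
    refine FredPair.isLagrange_of_splitting
      (L₀ := {x | ∃ v η : ℝ → H, FredPair.SolvesOn G B F₁ F₂ F₃ (Ici 0) v η ∧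
        Tendsto v atTop (𝓝 0) ∧ Tendsto η atTop (𝓝 0) ∧ x = WithLp.toLp 2 (v 0, η 0)})
      (M := {x | ∃ v η : ℝ → H, FredPair.SolvesOn G B F₁ F₂ F₃ (Iic 0) v η ∧
        Tendsto v atBot (𝓝 0) ∧ Tendsto η atBot (𝓝 0) ∧ x = WithLp.toLp 2 (v 0, η 0)})
      ?_ (fun x => ?_) ?_ ?_
    · rintro _ ⟨v, η, h, hv, hη, rfl⟩
      exact FredPair.mem_stableSubspace_of_tendsto h hv hη
    · obtain ⟨v, η, v', η', h1, h2, h3, h4, h5, h6, h7, h8⟩ :=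
        FredPair.exists_jump_solution hA hG hE hF₃unit hF₃ hfreq x.fst x.snd
      refine ⟨_, ⟨v, η, h1, h2, h3, rfl⟩, _, ⟨v', η', h4, h5, h6, rfl⟩, ?_⟩
      apply WithLp.ofLp_injective
      exact Prod.ext h7.symm h8.symm
    · rintro x ⟨v, η, h, hv0, hη0, C, hC⟩ _ ⟨v', η', h', hv', hη', rfl⟩
      rw [FredPair.inner_complexStructure, ← hv0, ← hη0]
      exact (FredPair.isMildSolution_iff.1 h).symplectic_eq_zero_atTop hG hF₁ hF₃ h' hC hv' hη'
    · rintro _ ⟨v, η, h, hv, hη, rfl⟩ _ ⟨v', η', h', hv', hη', rfl⟩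
      rw [FredPair.inner_complexStructure]
      exact h.symplectic_eq_zero_atBot hG hF₁ hF₃ h' hv hη hv' hη'
  have hV : FredPair.IsLagrange V := FredPair.isLagrange_verticalSubspace
  -- Modulo the sum, the second component is free by `V`, and the first is reduced to an unstable
  -- vector by the half-line solutions; so `Hu` covers the quotient.
  let Φ : Hu →ₗ[ℝ] WithLp 2 (H × H) ⧸ (L ⊔ V) := (L ⊔ V).mkQ.comp
    ((WithLp.linearEquiv 2 ℝ (H × H)).symm.toLinearMap.comp
      ((LinearMap.inl ℝ H H).comp Hu.subtype))
  have hΦ : ∀ u : Hu, Φ u = (L ⊔ V).mkQ (WithLp.toLp 2 ((u : H), 0)) := fun u => rfl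
  have hsurj : Function.Surjective Φ := by
    intro y
    obtain ⟨x, rfl⟩ := Submodule.mkQ_surjective _ y
    obtain ⟨v, η, h, hv, hη, hu⟩ := FredPair.exists_halfline_solution hA hG hE hHu hF₃unit hF₃
      hfreq x.fst
    refine ⟨⟨_, hu⟩, ?_⟩
    rw [hΦ, eq_comm, ← sub_eq_zero, ← map_sub, Submodule.mkQ_apply, Submodule.Quotient.mk_eq_zero]
    have : x - WithLp.toLp 2 (x.fst - v 0, 0) =
        WithLp.toLp 2 (v 0, η 0) + WithLp.toLp 2 (0, x.snd - η 0) := by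
      apply WithLp.ofLp_injective
      refine Prod.ext ?_ ?_ <;> simp
    rw [this]
    exact Submodule.add_mem_sup (FredPair.mem_stableSubspace_of_tendsto h hv hη)
      (FredPair.mem_verticalSubspace.2 rfl)
  have hfinQ : FiniteDimensional ℝ (WithLp 2 (H × H) ⧸ (L ⊔ V)) :=
    Module.Finite.of_surjective Φ hsurj
  have hrankQ : Module.rank ℝ (WithLp 2 (H × H) ⧸ (L ⊔ V)) ≤ (j : Cardinal) := by
    refine (LinearMap.rank_le_of_surjective Φ hsurj).trans_eq ?_
    rw [← Module.finrank_eq_rank, hj]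
  have hinj := hL.injective_inf_to_quotient hV
  have hclosed := FredPair.isClosed_sup_of_finite_codim hL.isClosed hV.isClosed
  exact ⟨hL, hV, (LinearMap.rank_le_of_injective _ hinj).trans hrankQ, hclosed, hrankQ,
    hL.isClosed, hV.isClosed, FiniteDimensional.of_injective _ hinj, hclosed, hfinQ⟩
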